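/- Let $d\ge 5$, and let $\mathbb N=\{1,2,\dots\}$. Let $\mathcal V_d$ be the complex vector space of all pairs $((f_n)_{n\in\mathbb N},(g_n)_{n\in\mathbb N})$ of sequences in $C^\infty(S^{d-1})$ such that $\sup_n n^k\|f_n\|_\infty<\infty$ and $\sup_n n^k\|g_n\|_\infty<\infty$ for all $k\ge 0$, with the locally convex topology given by these seminorms, and let $\mathcal V_d^*$ be its continuous dual. With $\hat f(\xi)=\int_{\mathbb R^d} f(x)e^{-2\pi i x\cdot\xi}\,dx$, consider the linear map $$\Phi_d:\mathcal S(\mathbb R^d)\to\mathcal V_d,\qquad f\mapsto\big((f(\sqrt n\,\cdot)|_{S^{d-1}})_{n\in\mathbb N},(\hat f(\sqrt n\,\cdot)|_{S^{d-1}})_{n\in\mathbb N}\big).$$ Then $\Phi_d$ has infinite-dimensional cokernel $\mathcal V_d/\Phi_d(\mathcal S(\mathbb R^d))$. In fact, the annihilator of $\Phi_d(\mathcal S(\mathbb R^d))$ in $\mathcal V_d^*$ is infinite-dimensional. More precisely, let $\Theta_3(\tau)=\sum_{n\in\mathbb Z}e^{\pi i n^2\tau}$. For $k\in\frac12\mathbb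 Z_{\ge 0}$ let $M_k(\Gamma(2))$ be the space of holomorphic functions $\varphi$ on the upper half plane with $\varphi(\gamma\tau)=\big(\Theta_3(\gamma\tau)/\Theta_3(\tau)\big)^{2k}\varphi(\tau)$ for all $\gamma\in\Gamma(2)$ that are holomorphic at all cusps, i.e. $|c\tau+e|^{-k}|\varphi(\gamma\tau)|$ is bounded as $\operatorname{Im}\tau\to\infty$ for every $\gamma\in SL_2(\mathbb Z)$ with bottom row $(c,e)$. Put $\varphi_0(\tau)=(-i\tau)^{-k}\varphi(-1/\tau)$ (principal branch), let $J_k$ be the space of $\varphi\in M_k(\Gamma(2))$ such that $\varphi$ and $\varphi_0$ tend to $0$ as $\operatorname{Im}\tau\to\infty$, and write $\varphi(\tau)=\sum_{n\ge 0}\widehat\varphi(n)e^{\pi i n\tau}$. For each $m\ge 0$ fix a basis $\mathcal B_m$ of the complex harmonic polynomials on $\mathbb R^d$ that are homogeneous of degree $m$, orthonormal in $L^2(S^{d-1})$ for the probability surface measure $d\zeta$, and put $P_m(x)=\sum_{u\in\mathcal B_m}\overline{u(x)}$. For $\varphi\in J_{d/2+m}$ define $$\varphi^*((f_n),(g_n))=\sum_{n\ge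 1}\widehat\varphi(n)\int_{S^{d-1}}f_n(\zeta)P_m(\zeta/\sqrt n)\,d\zeta-i^m\sum_{n\ge 1}\widehat{\varphi_0}(n)\int_{S^{d-1}}g_n(\zeta)P_m(\zeta/\sqrt n)\,d\zeta .$$ Then both series converge absolutely on $\mathcal V_d$, the space $\bigoplus_{m\ge 0}J_{d/2+m}$ is infinite-dimensional, and $\varphi\mapsto\varphi^*$ extends linearly to an injective map from $\bigoplus_{m\ge 0}J_{d/2+m}$ into the annihilator of $\Phi_d(\mathcal S(\mathbb R^d))$ in $\mathcal V_d^*$. -/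

import Mathlib

open MeasureTheory UpperHalfPlane
open scoped SchwartzMap FourierTransform Manifold ContDiff ComplexConjugate MatrixGroups

noncomputable section

namespace SphereRestriction

/-! ### The sphere and the target space -/

/-- Euclidean space `ℝ^d`. -/
abbrev Rd (d : ℕ) : Type := EuclideanSpace ℝ (Fin d)

/-- The unit sphere `S^{d-1}` in `ℝ^d`. -/
abbrev Sph (d : ℕ) : Type := Metric.sphere (0 : Rd d) 1

/-- Supplies Mathlib's smooth manifold structure (of dimension `d - 1`) on `S^{d-1}`. -/
instance factFinrank (d : ℕ) [NeZero d] : Fact (Module.finrank ℝ (Rd d) = (d - 1) + 1) :=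
  ⟨by
    have h := Nat.pos_of_ne_zero (NeZero.ne d)
    rw [finrank_euclideanSpace_fin]
    omega⟩

/-- The surface measure on `S^{d-1}`, normalised to a probability measure. -/
def sphereProb (d : ℕ) : Measure (Sph d) :=
  ((volume : Measure (Rd d)).toSphere Set.univ)⁻¹ • (volume : Measure (Rd d)).toSphere

/-- Sequences `(f_n)_{n ≥ 1}` of smooth complex functions on `S^{d-1}` whose sup-norms decay
faster than every power of `n`. -/
def rapidSubmodule (d : ℕ) [NeZero d] : Submodule ℂ (ℕ+ → Sph d → ℂ) where
  carrier := {f | (∀ n, ContMDiff (𝓡 (d - 1)) 𝓘(ℝ, ℂ) ∞ (f n)) ∧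
    ∀ k : ℕ, ∃ C : ℝ, ∀ (n : ℕ+) (ζ : Sph d), (n : ℝ) ^ k * ‖f n ζ‖ ≤ C}
  add_mem' := by
    rintro f g ⟨hf, hf'⟩ ⟨hg, hg'⟩
    refine ⟨fun n => (hf n).add (hg n), fun k => ?_⟩
    obtain ⟨C, hC⟩ := hf' k
    obtain ⟨D, hD⟩ := hg' k
    refine ⟨C + D, fun n ζ => ?_⟩
    calc (n : ℝ) ^ k * ‖(f + g) n ζ‖ ≤ (n : ℝ) ^ k * (‖f n ζ‖ + ‖g n ζ‖) := by
          gcongr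
          exact norm_add_le _ _
      _ ≤ C + D := by
          rw [mul_add]
          exact add_le_add (hC n ζ) (hD n ζ)
  zero_mem' := ⟨fun _ => contMDiff_const, fun k => ⟨0, fun n ζ => by simp⟩⟩
  smul_mem' := by
    rintro c f ⟨hf, hf'⟩
    refine ⟨fun n => ?_, fun k => ?_⟩
    · exact ((contDiff_const_smul (𝕜 := ℝ) (n := ∞) (F := ℂ) c).contMDiff).comp (hf n)
    · obtain ⟨C, hC⟩ := hf' k
      refine ⟨‖c‖ * C, fun n ζ => ?_⟩
      have h := mul_le_mul_of_nonneg_left (hC n ζ) (norm_nonneg c)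
      simp only [Pi.smul_apply, smul_eq_mul, norm_mul]
      linarith [h]

/-- The space of rapidly decaying sequences of smooth functions on `S^{d-1}`. -/
def RapidSeq (d : ℕ) [NeZero d] : Type := ↥(rapidSubmodule d)

instance (d : ℕ) [NeZero d] : AddCommGroup (RapidSeq d) :=
  inferInstanceAs (AddCommGroup ↥(rapidSubmodule d))

instance (d : ℕ) [NeZero d] : Module ℂ (RapidSeq d) :=
  inferInstanceAs (Module ℂ ↥(rapidSubmodule d))

instance (d : ℕ) [NeZero d] : CoeFun (RapidSeq d) (fun _ => ℕ+ → Sph d → ℂ) :=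
  ⟨fun f => f.1⟩

theorem RapidSeq.bddAbove {d : ℕ} [NeZero d] (f : RapidSeq d) (k : ℕ) :
    BddAbove (Set.range fun p : ℕ+ × Sph d => (p.1 : ℝ) ^ k * ‖f p.1 p.2‖) := by
  obtain ⟨C, hC⟩ := f.2.2 k
  exact ⟨C, by rintro _ ⟨p, rfl⟩; exact hC p.1 p.2⟩

/-- The seminorm `f ↦ sup_{n ≥ 1} n ^ k * ‖f_n‖_∞`. -/
def rapidSeminorm (d : ℕ) [NeZero d] (k : ℕ) : Seminorm ℂ (RapidSeq d) :=
  Seminorm.of (fun f => ⨆ p : ℕ+ × Sph d, (p.1 : ℝ) ^ k * ‖f p.1 p.2‖)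
    (by
      intro f g
      have h0 : ∀ h : RapidSeq d, 0 ≤ ⨆ p : ℕ+ × Sph d, (p.1 : ℝ) ^ k * ‖h p.1 p.2‖ :=
        fun h => Real.iSup_nonneg fun p => by positivity
      refine Real.iSup_le (fun p => ?_) (add_nonneg (h0 f) (h0 g))
      calc (p.1 : ℝ) ^ k * ‖(f + g) p.1 p.2‖
          ≤ (p.1 : ℝ) ^ k * (‖f p.1 p.2‖ + ‖g p.1 p.2‖) := by
            gcongr
            exact norm_add_le _ _
        _ ≤ _ := by
            rw [mul_add]
            exact add_le_add (le_ciSup (f.bddAbove k) p) (le_ciSup (g.bddAbove k) p))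
    (by
      intro c f
      rw [Real.mul_iSup_of_nonneg (norm_nonneg c)]
      congr 1
      ext p
      have : (c • f) p.1 p.2 = c * f p.1 p.2 := rfl
      rw [this, norm_mul]
      ring)

/-- The locally convex topology generated by the seminorms `sup_n n ^ k * ‖f_n‖_∞`, `k ∈ ℕ`. -/
instance (d : ℕ) [NeZero d] : TopologicalSpace (RapidSeq d) :=
  SeminormFamily.moduleFilterBasis (𝕜 := ℂ) (rapidSeminorm d) |>.topology

theorem rapid_withSeminorms (d : ℕ) [NeZero d] :
    WithSeminorms (rapidSeminorm d : SeminormFamily ℂ (RapidSeq d) ℕ) :=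
  ⟨rfl⟩

/-- Pairs of rapidly decaying sequences of smooth functions on `S^{d-1}`. -/
abbrev V (d : ℕ) [NeZero d] : Type := RapidSeq d × RapidSeq d

theorem sqrt_smul_mem_rapid {d : ℕ} [NeZero d] (f : 𝓢(Rd d, ℂ)) :
    (fun (n : ℕ+) (ζ : Sph d) => f (Real.sqrt (n : ℝ) • (ζ : Rd d))) ∈ rapidSubmodule d := by
  refine ⟨fun n => ?_, fun k => ?_⟩
  · have h1 : ContDiff ℝ ∞ (fun x : Rd d => f (Real.sqrt (n : ℝ) • x)) :=
      (f.smooth ⊤).comp (contDiff_const_smul _)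
    exact h1.contMDiff.comp contMDiff_coe_sphere
  · obtain ⟨C, hC⟩ := f.decay (2 * k) 0
    refine ⟨C, fun n ζ => ?_⟩
    have h := hC.2 (Real.sqrt (n : ℝ) • (ζ : Rd d))
    have hζ : ‖(ζ : Rd d)‖ = 1 := by simp
    rw [norm_smul, hζ, mul_one, Real.norm_of_nonneg (Real.sqrt_nonneg _), pow_mul,
      Real.sq_sqrt (by positivity), norm_iteratedFDeriv_zero] at h
    exact h

/-- `f ↦ (f(√n ·)|_{S^{d-1}})_{n ≥ 1}`. -/
def restrictSpheres (d : ℕ) [NeZero d] : 𝓢(Rd d, ℂ) →ₗ[ℂ] RapidSeq d where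
  toFun f := ⟨fun n ζ => f (Real.sqrt (n : ℝ) • (ζ : Rd d)), sqrt_smul_mem_rapid f⟩
  map_add' _ _ := rfl
  map_smul' _ _ := rfl

/-- `Φ_d f = ((f(√n ·))_{n ≥ 1}, (f̂(√n ·))_{n ≥ 1})`. -/
def Phi (d : ℕ) [NeZero d] : 𝓢(Rd d, ℂ) →ₗ[ℂ] V d :=
  (restrictSpheres d).prod
    ((restrictSpheres d).comp (FourierTransform.fourierCLM ℂ 𝓢(Rd d, ℂ)).toLinearMap)

/-- The continuous linear functionals on `V d` that vanish on the image of `Φ_d`. -/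
def annihilator (d : ℕ) [NeZero d] : Submodule ℂ (V d →L[ℂ] ℂ) where
  carrier := {ℓ | ∀ f : 𝓢(Rd d, ℂ), ℓ (Phi d f) = 0}
  add_mem' := by
    intro a b ha hb f
    simp [ha f, hb f]
  zero_mem' := fun _ => rfl
  smul_mem' := by
    intro c a ha f
    simp [ha f]

/-! ### Harmonic polynomials -/

/-- The complex harmonic polynomials in `d` variables, homogeneous of degree `m`. -/
def harmonicPoly (d m : ℕ) : Submodule ℂ (MvPolynomial (Fin d) ℂ) :=
  MvPolynomial.homogeneousSubmodule (Fin d) ℂ m ⊓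
    LinearMap.ker (∑ i : Fin d,
      (MvPolynomial.pderiv i : Derivation ℂ (MvPolynomial (Fin d) ℂ) _).toLinearMap ∘ₗ
      (MvPolynomial.pderiv i : Derivation ℂ (MvPolynomial (Fin d) ℂ) _).toLinearMap)

/-- The value of a complex polynomial at a point of `ℝ^d`. -/
def evalAt {d : ℕ} (p : MvPolynomial (Fin d) ℂ) (x : Rd d) : ℂ :=
  MvPolynomial.eval (fun i => (x i : ℂ)) p

/-- The family `u` is orthonormal in `L²(S^{d-1})` for the probability surface measure. -/
def IsOrthonormalOnSphere {d m : ℕ} {ι : Type} [DecidableEq ι] (u : ι → harmonicPoly d m) :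
    Prop :=
  ∀ i j, ∫ ζ : Sph d, evalAt (u i : MvPolynomial (Fin d) ℂ) (ζ : Rd d) *
    conj (evalAt (u j : MvPolynomial (Fin d) ℂ) (ζ : Rd d)) ∂(sphereProb d) =
      if i = j then 1 else 0

/-- `P(x) = ∑_u conj (u x)`, the sum over a finite family `u`. -/
def conjSum {d m : ℕ} {ι : Type} [Fintype ι] (u : ι → harmonicPoly d m) (x : Rd d) : ℂ :=
  ∑ i, conj (evalAt (u i : MvPolynomial (Fin d) ℂ) x)

/-! ### Modular forms of half-integral weight `κ / 2` for `Γ(2)` -/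

/-- The slash action of weight `κ / 2`:
`(φ | γ)(z) = j_Θ(γ, z) ^ (-κ) * φ (γ z)`, with `j_Θ(γ, z) = Θ₃(γ z) / Θ₃(z)`. -/
def thetaSlash (κ : ℕ) (φ : ℍ → ℂ) (γ : SL(2, ℤ)) (z : ℍ) : ℂ :=
  ((jacobiTheta (γ • z : ℍ) / jacobiTheta z) ^ κ)⁻¹ * φ (γ • z)

/-- Modular forms of weight `κ / 2` for `Γ(2)`: holomorphic functions on the upper half plane,
invariant under the slash action of weight `κ / 2` of `Γ(2)`, and holomorphic at all cusps, that is,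
`|c z + d| ^ (-κ / 2) * |φ (γ z)|` is bounded as `Im z → ∞` for all `γ ∈ SL(2, ℤ)`. -/
def modForms (κ : ℕ) : Submodule ℂ (ℍ → ℂ) where
  carrier := {φ | MDifferentiable 𝓘(ℂ) 𝓘(ℂ) φ ∧
    (∀ γ ∈ CongruenceSubgroup.Gamma 2, thetaSlash κ φ γ = φ) ∧
    ∀ γ : SL(2, ℤ), IsBoundedAtImInfty fun z : ℍ =>
      ((‖(γ 1 0 : ℂ) * (z : ℂ) + (γ 1 1 : ℂ)‖ ^ (-(κ : ℝ) / 2) : ℝ) : ℂ) * φ (γ • z)}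
  add_mem' := by
    rintro f g ⟨hf1, hf2, hf3⟩ ⟨hg1, hg2, hg3⟩
    refine ⟨hf1.add hg1, fun γ hγ => ?_, fun γ => ?_⟩
    · ext z
      have h1 := congrFun (hf2 γ hγ) z
      have h2 := congrFun (hg2 γ hγ) z
      simp only [thetaSlash, Pi.add_apply, mul_add] at h1 h2 ⊢
      rw [h1, h2]
    · have h := (hf3 γ).add (hg3 γ)
      simpa only [IsBoundedAtImInfty, Pi.add_def, mul_add] using h
  zero_mem' := by
    refine ⟨mdifferentiable_const, fun γ _ => ?_, fun γ => ?_⟩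
    · ext z
      simp [thetaSlash]
    · simp only [Pi.zero_apply, mul_zero]
      exact Filter.const_boundedAtFilter atImInfty (0 : ℂ)
  smul_mem' := by
    rintro c f ⟨hf1, hf2, hf3⟩
    refine ⟨hf1.const_smul c, fun γ hγ => ?_, fun γ => ?_⟩
    · ext z
      have h1 := congrFun (hf2 γ hγ) z
      simp only [thetaSlash, Pi.smul_apply, smul_eq_mul] at h1 ⊢
      rw [mul_left_comm, h1]
    · have h := (hf3 γ).smul c
      simpa only [IsBoundedAtImInfty, Pi.smul_def, smul_eq_mul, mul_left_comm] using h

/-- `φ ↦ φ₀`, where `φ₀(τ) = (-iτ) ^ (-κ / 2) * φ(-1/τ)` (principal branch). -/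
def swapCusps (κ : ℕ) : (ℍ → ℂ) →ₗ[ℂ] (ℍ → ℂ) where
  toFun φ := fun τ => (-Complex.I * (τ : ℂ)) ^ (-(κ : ℂ) / 2) * φ (ModularGroup.S • τ)
  map_add' f g := by
    ext τ
    simp [mul_add]
  map_smul' c f := by
    ext τ
    simp [mul_left_comm]

/-- The forms `φ` of weight `κ / 2` such that `φ` and `φ₀` vanish at infinity, i.e. `φ` vanishes
at the cusps `∞` and `0` of `Γ(2)`. -/
def cuspType (κ : ℕ) : Submodule ℂ (ℍ → ℂ) :=
  modForms κ ⊓ zeroAtImInftySubmodule ℂ ⊓ (zeroAtImInftySubmodule ℂ).comap (swapCusps κ)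

/-- The Fourier coefficient `φ̂(n)` in `φ(z) = ∑ φ̂(n) e^{π i n z}`. -/
def fourierCoeffAt (φ : ℍ → ℂ) (n : ℕ) : ℂ :=
  (qExpansion 2 φ).coeff n

/-- The term `φ̂(n) ∫_{S^{d-1}} h_n(ζ) P(ζ/√n) dζ`. -/
def pairingTerm {d : ℕ} [NeZero d] (φ : ℍ → ℂ) (P : Rd d → ℂ) (h : RapidSeq d) (n : ℕ+) : ℂ :=
  fourierCoeffAt φ n *
    ∫ ζ : Sph d, h n ζ * P ((Real.sqrt (n : ℝ))⁻¹ • (ζ : Rd d)) ∂(sphereProb d)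

end SphereRestriction

end

/-!
The functionals `φ^*` vanish on the image of `Φ_d` because of a Poisson-type summation formula.
Let `φ` be a form of weight `k = d/2 + m`, and let `a_n` and `b_n` be the Fourier coefficients of
`φ` and `φ₀`. On the imaginary axis the definition of `φ₀` reads
`∑ a_n e^(-πnt) = t^(-k) ∑ b_n e^(-πn/t)`. Differentiating this `l` times in `t` and summing over
`l` against the coefficients of the Bessel series `J(x) = ∑ x^l / (l! (k)_l)` gives
`∑ a_n e^(-πnt) J(sn) = t^(-k) e^(s/(πt)) ∑ b_n e^(-πn/t) J(-sn/t²)`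
(`tsum_mul_besselSeries_eq`). By the Funk–Hecke formula (`integral_exp_inner_mul`), Bessel series
are the integrals over the sphere of plane waves against a harmonic polynomial `P` of degree `m`;
it is obtained here from the Gaussian moments of harmonic polynomials, which integration by parts
determines recursively. For `t = r²` and `s = (π r² ‖y‖)²` the identity therefore becomes the
desired formula for the Gaussian `r^d e^(-π r² ‖x - y‖²)` as a function of `x`
(`tsum_gauss_eq`). Integrating over `y` against a Schwartz function `f` gives the formula for a
Gaussian regularisation of `f`, and letting `r → ∞` gives it for `f` itself (`tsum_sphereInt_eq`).
The density of the Gaussians in the Schwartz space is not needed.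

The interchanges of limits rest on the polynomial growth of `a_n` and `b_n`. The eighth powers of
the three theta constants are permuted, up to automorphy factors, by `SL(2, ℤ)`
(`thetaEight_smul`); hence `|Θ₃(γz)/Θ₃(z)|² = |cz + d|` on `Γ(2)`, the function
`|φ(z)| (Im z)^(k/2)` is `Γ(2)`-invariant, and Hecke's argument applies. The products
`θ₂⁸ θ₄⁸ Θ₃^(2k-16)` show that the spaces of forms are nonzero in all large weights
(`not_finiteDimensional_directSum_cuspType`).

For injectivity (`starMap_injective`), test a sum of functionals `φ_m^*` against a sequence that is
supported on a single sphere, of radius `√N`, and equal to the conjugate of one of the harmonic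
polynomials there. Harmonic polynomials of different degrees are orthogonal, so this isolates the
`N`-th Fourier coefficient of one component, and a form is determined by its Fourier coefficients.
Only the degrees of the harmonic polynomials and their not being zero enter; hence `(x₀ + i x₁)^m`
can be used where no orthonormal basis is given. Finally, the annihilator embeds in the dual of the
cokernel, so both are infinite-dimensional.
-/


noncomputable section

namespace SphereRestriction

/-! ### The three theta constants -/

/-- The theta constant `θ₂(τ) = ∑ exp (π i (n + 1/2)² τ)`. -/
def theta2 (τ : ℂ) : ℂ := Complex.exp (Real.pi * Complex.I * τ / 4) * jacobiTheta₂ (τ / 2) τ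

/-- The theta constant `θ₄(τ) = ∑ (-1)ⁿ exp (π i n² τ)`. -/
def theta4 (τ : ℂ) : ℂ := jacobiTheta₂ (1 / 2) τ

theorem jacobiTheta₂_add_one_right (z τ : ℂ) :
    jacobiTheta₂ z (τ + 1) = jacobiTheta₂ (z + 1 / 2) τ := by
  refine tsum_congr fun n => ?_
  simp_rw [jacobiTheta₂_term]
  rw [Complex.exp_eq_exp_iff_exists_int]
  obtain ⟨k, hk⟩ := Int.even_mul_succ_self (n - 1)
  refine ⟨k, ?_⟩
  have hk' : ((n : ℂ) - 1) * (n - 1 + 1) = k + k := by exact_mod_cast hk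
  linear_combination (Real.pi : ℂ) * Complex.I * hk'

theorem jacobiTheta_add_one (τ : ℂ) : jacobiTheta (τ + 1) = theta4 τ := by
  rw [jacobiTheta_eq_jacobiTheta₂, jacobiTheta₂_add_one_right, zero_add, theta4]

theorem theta4_add_one (τ : ℂ) : theta4 (τ + 1) = jacobiTheta τ := by
  rw [jacobiTheta_eq_jacobiTheta₂, theta4, jacobiTheta₂_add_one_right, add_halves,
    ← zero_add (1 : ℂ), jacobiTheta₂_add_left]

theorem theta2_add_one (τ : ℂ) :
    theta2 (τ + 1) = Complex.exp (Real.pi * Complex.I / 4) * theta2 τ := by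
  rw [theta2, theta2, jacobiTheta₂_add_one_right,
    show (τ + 1) / 2 + 1 / 2 = τ / 2 + 1 by ring, jacobiTheta₂_add_left, ← mul_assoc,
    ← Complex.exp_add]
  congr 2
  ring

theorem jacobiTheta_S (τ : ℂ) (h : τ ≠ 0) :
    jacobiTheta (-1 / τ) = (-Complex.I * τ) ^ (1 / 2 : ℂ) * jacobiTheta τ := by
  have h1 : (-Complex.I * τ) ^ (1 / 2 : ℂ) ≠ 0 := by
    simp [Complex.cpow_eq_zero_iff, h]
  rw [jacobiTheta_eq_jacobiTheta₂, jacobiTheta_eq_jacobiTheta₂,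
    jacobiTheta₂_functional_equation 0 τ]
  field_simp
  simp

theorem theta2_S (τ : ℂ) (h : τ ≠ 0) :
    theta2 (-1 / τ) = (-Complex.I * τ) ^ (1 / 2 : ℂ) * theta4 τ := by
  have h1 : (-Complex.I * τ) ^ (1 / 2 : ℂ) ≠ 0 := by
    simp [Complex.cpow_eq_zero_iff, h]
  rw [theta2, theta4, jacobiTheta₂_functional_equation (1 / 2) τ,
    ← jacobiTheta₂_neg_left (-1 / τ / 2),
    show -(-1 / τ / 2) = 1 / 2 / τ by ring,
    show (Real.pi : ℂ) * Complex.I * (-1 / τ) / 4 = -Real.pi * Complex.I * (1 / 2) ^ 2 / τ by ring]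
  field_simp

theorem cpow_half_pow_eight (τ : ℂ) : ((-Complex.I * τ) ^ (1 / 2 : ℂ)) ^ 8 = τ ^ 4 := by
  rw [← Complex.cpow_nat_mul, show ((8 : ℕ) : ℂ) * (1 / 2) = ((4 : ℕ) : ℂ) by norm_num,
    Complex.cpow_natCast, neg_mul, neg_pow, mul_pow, Complex.I_pow_four]
  norm_num

/-- The eighth powers of the three theta constants, indexed by the nonzero vectors of `(ℤ/2)²`
(with value `0` at the zero vector). In this indexing `SL(2, ℤ)` permutes them through its
action on row vectors modulo `2`; the eighth power removes all roots of unity. -/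
def thetaEight (v : Fin 2 → ZMod 2) (τ : ℂ) : ℂ :=
  if v 0 = 0 then (if v 1 = 0 then 0 else theta2 τ ^ 8)
  else if v 1 = 0 then theta4 τ ^ 8 else jacobiTheta τ ^ 8

theorem zmod_two_cases (a : ZMod 2) : a = 0 ∨ a = 1 := by
  revert a; decide

theorem thetaEight_add_one (v : Fin 2 → ZMod 2) (τ : ℂ) :
    thetaEight v (τ + 1) = thetaEight ![v 0, v 0 + v 1] τ := by
  have h8 : Complex.exp (Real.pi * Complex.I / 4) ^ 8 = 1 := by
    rw [← Complex.exp_nat_mul, ← Complex.exp_two_pi_mul_I]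
    congr 1
    push_cast
    ring
  have h11 : (1 : ZMod 2) + 1 = 0 := by decide
  rcases zmod_two_cases (v 0) with h0 | h0 <;> rcases zmod_two_cases (v 1) with h1 | h1 <;>
    simp [thetaEight, h0, h1, h11, theta2_add_one, theta4_add_one, jacobiTheta_add_one,
      mul_pow, h8]

theorem thetaEight_S (v : Fin 2 → ZMod 2) (τ : ℂ) (h : τ ≠ 0) :
    thetaEight v (-1 / τ) = τ ^ 4 * thetaEight ![v 1, - v 0] τ := by
  have hneg : (-1 : ZMod 2) = 1 := by decide
  have h4 : theta4 (-1 / τ) ^ 8 = τ ^ 4 * theta2 τ ^ 8 := by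
    have h' : -1 / τ ≠ 0 := by simpa using h
    have := theta2_S (-1 / τ) h'
    rw [show -1 / (-1 / τ) = τ by field_simp] at this
    rw [this, mul_pow, cpow_half_pow_eight]
    field_simp
  rcases zmod_two_cases (v 0) with h0 | h0 <;> rcases zmod_two_cases (v 1) with h1 | h1 <;>
    simp only [thetaEight, h0, h1, hneg, theta2_S τ h, h4, jacobiTheta_S τ h, mul_pow,
      cpow_half_pow_eight, Matrix.cons_val_zero, Matrix.cons_val_one, neg_zero, mul_zero,
      if_true, one_ne_zero, if_false]

/-- Reduction of the action of `SL(2, ℤ)` on row vectors modulo `2`. -/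
def rowAct (v : Fin 2 → ZMod 2) (γ : SL(2, ℤ)) : Fin 2 → ZMod 2 :=
  Matrix.vecMul v ((γ : Matrix (Fin 2) (Fin 2) ℤ).map (Int.cast : ℤ → ZMod 2))

theorem rowAct_mul (v : Fin 2 → ZMod 2) (γ δ : SL(2, ℤ)) :
    rowAct v (γ * δ) = rowAct (rowAct v γ) δ := by
  unfold rowAct
  rw [Matrix.vecMul_vecMul, Matrix.SpecialLinearGroup.coe_mul]
  congr 1
  exact Matrix.map_mul (f := Int.castRingHom (ZMod 2))

theorem rowAct_of_mem_Gamma_two (v : Fin 2 → ZMod 2) {γ : SL(2, ℤ)}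
    (h : γ ∈ CongruenceSubgroup.Gamma 2) : rowAct v γ = v := by
  rw [CongruenceSubgroup.Gamma_mem] at h
  obtain ⟨h1, h2, h3, h4⟩ := h
  ext i
  fin_cases i <;> simp [rowAct, Matrix.vecMul, dotProduct, Fin.sum_univ_two, h1, h2, h3, h4]

/-- The factor of automorphy `c z + d`. -/
def autFactor (γ : SL(2, ℤ)) (z : ℍ) : ℂ := (γ 1 0 : ℂ) * z + (γ 1 1 : ℂ)

theorem autFactor_ne_zero (γ : SL(2, ℤ)) (z : ℍ) : autFactor γ z ≠ 0 := by
  have := denom_ne_zero (γ : GL (Fin 2) ℝ) z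
  rwa [ModularGroup.denom_apply] at this

theorem coe_smul_eq_div_autFactor (γ : SL(2, ℤ)) (z : ℍ) :
    ((γ • z : ℍ) : ℂ) = ((γ 0 0 : ℂ) * z + (γ 0 1 : ℂ)) / autFactor γ z := by
  rw [coe_specialLinearGroup_apply]
  simp [autFactor]

theorem autFactor_mul (γ δ : SL(2, ℤ)) (z : ℍ) :
    autFactor (γ * δ) z = autFactor γ (δ • z) * autFactor δ z := by
  rw [autFactor, autFactor, coe_smul_eq_div_autFactor]
  have h := autFactor_ne_zero δ z
  field_simp
  simp only [autFactor, Matrix.SpecialLinearGroup.coe_mul, Matrix.mul_apply, Fin.sum_univ_two]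
  push_cast
  ring

theorem im_smul_eq_div_autFactor (γ : SL(2, ℤ)) (z : ℍ) :
    (γ • z).im = z.im / ‖autFactor γ z‖ ^ 2 := by
  rw [ModularGroup.im_smul_eq_div_normSq, ModularGroup.denom_apply, Complex.normSq_eq_norm_sq,
    autFactor]

theorem coe_S_smul (z : ℍ) : ((ModularGroup.S • z : ℍ) : ℂ) = -1 / z := by
  rw [coe_smul_eq_div_autFactor]
  simp [autFactor, ModularGroup.S]

theorem coe_T_smul (z : ℍ) : ((ModularGroup.T • z : ℍ) : ℂ) = z + 1 := by
  rw [coe_smul_eq_div_autFactor]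
  simp [autFactor, ModularGroup.T]

/-- The transformation law of the eighth powers of the theta constants under all of `SL(2, ℤ)`,
checked on the generators `S` and `T`. -/
theorem thetaEight_smul (γ : SL(2, ℤ)) (v : Fin 2 → ZMod 2) (z : ℍ) :
    thetaEight v (γ • z : ℍ) = autFactor γ z ^ 4 * thetaEight (rowAct v γ) z := by
  have h1 : ∀ v, rowAct v 1 = v := fun v => by
    simp [rowAct]
  have hγ : γ ∈ Subgroup.closure {ModularGroup.S, ModularGroup.T} := by
    rw [SpecialLinearGroup.SL2Z_generators]
    trivial
  induction hγ using Subgroup.closure_induction generalizing v z with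
  | mem x hx =>
    rcases hx with rfl | rfl
    · have hr : rowAct v ModularGroup.S = ![v 1, - v 0] := by
        ext i
        fin_cases i <;> simp [rowAct, Matrix.vecMul, dotProduct, Fin.sum_univ_two, ModularGroup.S]
      rw [coe_S_smul, thetaEight_S _ _ (ne_zero z), hr]
      simp [autFactor, ModularGroup.S]
    · have hr : rowAct v ModularGroup.T = ![v 0, v 0 + v 1] := by
        ext i
        fin_cases i <;> simp [rowAct, Matrix.vecMul, dotProduct, Fin.sum_univ_two, ModularGroup.T]
      rw [coe_T_smul, thetaEight_add_one, hr]
      simp [autFactor, ModularGroup.T]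
  | one => simp [h1, autFactor]
  | mul x y _ _ hx hy =>
    rw [mul_smul, hx, hy, rowAct_mul, autFactor_mul]
    ring
  | inv x _ hx =>
    have h := hx (rowAct v x⁻¹) (x⁻¹ • z)
    have hj := autFactor_mul x x⁻¹ z
    rw [mul_inv_cancel, show autFactor 1 z = 1 by simp [autFactor]] at hj
    rw [← rowAct_mul, inv_mul_cancel, h1, smul_inv_smul] at h
    rw [h, ← mul_assoc, ← mul_pow, mul_comm (autFactor x⁻¹ z), ← hj, one_pow, one_mul]

theorem thetaEight_smul_of_mem_Gamma_two {γ : SL(2, ℤ)} (h : γ ∈ CongruenceSubgroup.Gamma 2)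
    (v : Fin 2 → ZMod 2) (z : ℍ) :
    thetaEight v (γ • z : ℍ) = autFactor γ z ^ 4 * thetaEight v z := by
  rw [thetaEight_smul, rowAct_of_mem_Gamma_two v h]

/-- The modulus of the automorphy factor `j_Θ`, by extracting an eighth root from the
transformation law of `Θ₃⁸`. -/
theorem norm_jacobiTheta_smul {γ : SL(2, ℤ)} (h : γ ∈ CongruenceSubgroup.Gamma 2) (z : ℍ) :
    ‖jacobiTheta (γ • z : ℍ)‖ = ‖autFactor γ z‖ ^ (1 / 2 : ℝ) * ‖jacobiTheta z‖ := by
  have h8 := congrArg norm (thetaEight_smul_of_mem_Gamma_two h ![1, 1] z)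
  simp only [thetaEight, Matrix.cons_val_zero, Matrix.cons_val_one, one_ne_zero, if_false,
    norm_mul, norm_pow] at h8
  refine (pow_left_inj₀ (norm_nonneg _) (by positivity) (n := 8) (by norm_num)).1 ?_
  rw [h8, mul_pow, ← Real.rpow_mul_natCast (norm_nonneg _),
    show (1 / 2 : ℝ) * (8 : ℕ) = (4 : ℕ) by norm_num, Real.rpow_natCast]

/-! ### Analyticity, boundedness and non-vanishing of the theta constants -/

theorem differentiableAt_theta4 {τ : ℂ} (h : 0 < τ.im) : DifferentiableAt ℂ theta4 τ :=
  differentiableAt_jacobiTheta₂_snd _ h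

theorem differentiableAt_theta2 {τ : ℂ} (h : 0 < τ.im) : DifferentiableAt ℂ theta2 τ := by
  have h1 : DifferentiableAt ℂ (fun p : ℂ × ℂ => jacobiTheta₂ p.1 p.2) (τ / 2, τ) :=
    (hasFDerivAt_jacobiTheta₂ (τ / 2) h).differentiableAt
  have h2 : DifferentiableAt ℂ (fun τ : ℂ => (τ / 2, τ)) τ := by fun_prop
  have h3 : DifferentiableAt ℂ (fun τ : ℂ => jacobiTheta₂ (τ / 2) τ) τ :=
    h1.comp (f := fun τ : ℂ => (τ / 2, τ)) τ h2
  unfold theta2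
  fun_prop

theorem norm_theta4_le {τ : ℂ} (h : 1 ≤ τ.im) :
    ‖theta4 τ‖ ≤ ∑' n : ℤ, Real.exp (-Real.pi * (1 * n ^ 2 - 2 * (1 / 2) * |n|)) := by
  have hs : Summable fun n : ℤ => Real.exp (-Real.pi * (1 * n ^ 2 - 2 * (1 / 2) * |n|)) := by
    simpa using summable_pow_mul_jacobiTheta₂_term_bound (1 / 2) one_pos 0
  refine tsum_of_norm_bounded hs.hasSum fun n => ?_
  have := norm_jacobiTheta₂_term_le (S := 1 / 2) one_pos (z := 1 / 2) (by norm_num) h n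
  exact_mod_cast this

theorem norm_jacobiTheta_le {τ : ℂ} (h : 1 ≤ τ.im) :
    ‖jacobiTheta τ‖ ≤ ∑' n : ℤ, Real.exp (-Real.pi * (1 * n ^ 2 - 2 * (1 / 2) * |n|)) := by
  rw [← theta4_add_one]
  exact norm_theta4_le (by simpa using h)

theorem norm_theta2_le {τ : ℂ} (h : 1 ≤ τ.im) :
    ‖theta2 τ‖ ≤ Real.exp (-Real.pi * τ.im / 4) *
      ∑' n : ℤ, Real.exp (-Real.pi * (1 * n ^ 2 - 2 * (1 / 2) * |n|)) := by
  have hs : Summable fun n : ℤ => Real.exp (-Real.pi * (1 * n ^ 2 - 2 * (1 / 2) * |n|)) := by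
    simpa using summable_pow_mul_jacobiTheta₂_term_bound (1 / 2) one_pos 0
  rw [theta2, norm_mul, Complex.norm_exp]
  gcongr
  · simp
  · refine tsum_of_norm_bounded hs.hasSum fun n => ?_
    rw [norm_jacobiTheta₂_term]
    have h1 : (0 : ℝ) ≤ n ^ 2 + n := by
      have : (0 : ℤ) ≤ n ^ 2 + n := by
        rcases le_or_gt 0 n with h | h <;> nlinarith
      exact_mod_cast this
    have h2 : -(n : ℝ) ≤ |(n : ℝ)| := neg_le_abs _
    have h3 : (τ / 2).im = τ.im / 2 := by simp
    rw [h3, Real.exp_le_exp]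
    push_cast
    have h4 : (n : ℝ) ^ 2 - |(n : ℝ)| ≤ (n ^ 2 + n) * τ.im := by nlinarith
    nlinarith [Real.pi_pos]

theorem thetaEight_isBoundedAtImInfty (v : Fin 2 → ZMod 2) :
    IsBoundedAtImInfty fun z : ℍ => thetaEight v z := by
  rw [isBoundedAtImInfty_iff]
  refine ⟨(∑' n : ℤ, Real.exp (-Real.pi * (1 * n ^ 2 - 2 * (1 / 2) * |n|))) ^ 8, 1,
    fun z hz => ?_⟩
  have hz' : 1 ≤ (z : ℂ).im := hz
  unfold thetaEight
  split_ifs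
  · simp only [norm_zero]
    positivity
  · rw [norm_pow]
    gcongr
    refine (norm_theta2_le hz').trans (mul_le_of_le_one_left (by positivity) ?_)
    rw [Real.exp_le_one_iff]
    nlinarith [Real.pi_pos]
  · rw [norm_pow]
    gcongr
    exact norm_theta4_le hz'
  · rw [norm_pow]
    gcongr
    exact norm_jacobiTheta_le hz'

theorem theta2_pow_isZeroAtImInfty : IsZeroAtImInfty fun z : ℍ => thetaEight ![0, 1] z := by
  have h1 : Filter.Tendsto (fun z : ℍ => (Real.exp (-Real.pi * z.im / 4) *
      ∑' n : ℤ, Real.exp (-Real.pi * (1 * n ^ 2 - 2 * (1 / 2) * |n|))) ^ 8) atImInfty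
      (nhds 0) := by
    have h2 : Filter.Tendsto (fun x : ℝ => Real.exp (-Real.pi * x / 4)) Filter.atTop (nhds 0) := by
      refine Real.tendsto_exp_atBot.comp ?_
      have h4 : -Real.pi / 4 < 0 := by linarith [Real.pi_pos]
      refine (Filter.Tendsto.const_mul_atTop_of_neg h4 Filter.tendsto_id).congr fun x => ?_
      simp only [id]
      ring
    have h3 := ((h2.comp (Filter.tendsto_comap (f := UpperHalfPlane.im))).mul_const
      (∑' n : ℤ, Real.exp (-Real.pi * (1 * n ^ 2 - 2 * (1 / 2) * |n|)))).pow 8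
    rw [zero_mul, zero_pow (by norm_num)] at h3
    exact h3
  refine squeeze_zero_norm' ?_ h1
  have h4 : ∀ᶠ z : ℍ in atImInfty, 1 ≤ z.im :=
    Filter.tendsto_comap.eventually (Filter.eventually_ge_atTop 1)
  filter_upwards [h4] with z hz
  simp only [thetaEight, Matrix.cons_val_zero, Matrix.cons_val_one, one_ne_zero, if_false,
    if_true, norm_pow]
  gcongr
  exact norm_theta2_le hz

/-- Nonvanishing on the imaginary axis: a theta series with positive terms is positive. -/
theorem jacobiTheta₂_ne_zero_of_real_terms {z τ : ℂ} (hτ : 0 < τ.im)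
    (h : ∀ n : ℤ, ∃ r : ℝ, 0 < r ∧ jacobiTheta₂_term n z τ = r) : jacobiTheta₂ z τ ≠ 0 := by
  choose r hr hr' using h
  have hs := hasSum_jacobiTheta₂_term z hτ
  simp_rw [hr'] at hs
  have hs' : Summable r := by
    have := hs.summable
    exact_mod_cast this
  have h0 : 0 < ∑' n, r n := hs'.tsum_pos (fun n => (hr n).le) 0 (hr 0)
  rw [← hs.tsum_eq, ← Complex.ofReal_tsum]
  exact_mod_cast h0.ne'

theorem thetaEight_I_ne_zero (v : Fin 2 → ZMod 2) (hv : v ≠ 0) : thetaEight v Complex.I ≠ 0 := by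
  have h3 : jacobiTheta Complex.I ≠ 0 := by
    rw [jacobiTheta_eq_jacobiTheta₂]
    refine jacobiTheta₂_ne_zero_of_real_terms (by simp) fun n =>
      ⟨Real.exp (-Real.pi * n ^ 2), Real.exp_pos _, ?_⟩
    rw [jacobiTheta₂_term, Complex.ofReal_exp]
    congr 1
    push_cast
    linear_combination (Real.pi : ℂ) * n ^ 2 * Complex.I_sq
  have h2 : theta2 Complex.I ≠ 0 := by
    refine mul_ne_zero (Complex.exp_ne_zero _) ?_
    refine jacobiTheta₂_ne_zero_of_real_terms (by simp) fun n =>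
      ⟨Real.exp (-Real.pi * (n ^ 2 + n)), Real.exp_pos _, ?_⟩
    rw [jacobiTheta₂_term, Complex.ofReal_exp]
    congr 1
    push_cast
    linear_combination (Real.pi : ℂ) * (n ^ 2 + n) * Complex.I_sq
  have h4 : theta4 Complex.I ≠ 0 := by
    intro h
    have := theta2_S Complex.I Complex.I_ne_zero
    rw [h, mul_zero, show -1 / Complex.I = Complex.I by simp] at this
    exact h2 this
  unfold thetaEight
  split_ifs with h5 h6 h6
  · exact absurd (by ext i; fin_cases i <;> simp [h5, h6]) hv
  · exact pow_ne_zero _ h2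
  · exact pow_ne_zero _ h4
  · exact pow_ne_zero _ h3

/-- The zeros of `Θ₃` have dense complement, so factors of `Θ₃` cancel from identities between
continuous functions. -/
theorem eq_of_jacobiTheta_ne_zero {X : Type*} [TopologicalSpace X] [T2Space X] {F G : ℍ → X}
    (hF : Continuous F) (hG : Continuous G) (h : ∀ z : ℍ, jacobiTheta z ≠ 0 → F z = G z) :
    F = G := by
  by_contra hne
  obtain ⟨z₀, hz₀⟩ := Function.ne_iff.1 hne
  have h1 : ∀ᶠ z in nhds z₀, F z ≠ G z :=
    (isOpen_ne_fun hF hG).mem_nhds hz₀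
  have h2 : ∀ᶠ z : ℍ in nhds z₀, jacobiTheta z = 0 :=
    h1.mono fun z hz => by_contra fun h' => hz (h z h')
  have h3 : jacobiTheta =ᶠ[nhds (z₀ : ℂ)] 0 := by
    rw [← isOpenEmbedding_coe.map_nhds_eq]
    exact h2
  have h4 : AnalyticOnNhd ℂ jacobiTheta {z | 0 < z.im} := by
    refine DifferentiableOn.analyticOnNhd (fun z hz => ?_) isOpen_upperHalfPlaneSet
    exact (differentiableAt_jacobiTheta hz).differentiableWithinAt
  have h5 := h4.eqOn_zero_of_preconnected_of_eventuallyEq_zero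
    (convex_halfSpace_im_gt 0).isPreconnected z₀.im_pos h3
  have h6 := thetaEight_I_ne_zero ![1, 1] (by simp)
  have h7 : jacobiTheta Complex.I = 0 := h5 (by simp)
  simp [thetaEight, h7] at h6

/-! ### Growth and Fourier coefficients of cusp-type forms -/

/-- The transformation law under `Γ(2)`. At a zero of `Θ₃` the inverse in `thetaSlash` is the junk
value `0`, so such points are excluded. -/
theorem modForms_smul_mul {κ : ℕ} {φ : ℍ → ℂ} (hφ : φ ∈ modForms κ) {γ : SL(2, ℤ)}
    (hγ : γ ∈ CongruenceSubgroup.Gamma 2) {z : ℍ} (hz : jacobiTheta z ≠ 0) :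
    φ (γ • z) = (jacobiTheta (γ • z : ℍ) / jacobiTheta z) ^ κ * φ z := by
  have h1 := congrFun (hφ.2.1 γ hγ) z
  have h2 : jacobiTheta (γ • z : ℍ) ≠ 0 := by
    rw [← norm_ne_zero_iff, norm_jacobiTheta_smul hγ]
    have := norm_ne_zero_iff.2 (autFactor_ne_zero γ z)
    have := norm_ne_zero_iff.2 hz
    positivity
  rw [← h1, thetaSlash, mul_inv_cancel_left₀]
  exact pow_ne_zero _ (div_ne_zero h2 hz)

theorem continuous_of_mem_modForms {κ : ℕ} {φ : ℍ → ℂ} (hφ : φ ∈ modForms κ) : Continuous φ :=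
  hφ.1.continuous

theorem T_sq_mem_Gamma_two : ModularGroup.T ^ 2 ∈ CongruenceSubgroup.Gamma 2 := by
  rw [CongruenceSubgroup.Gamma_mem]
  have : (ModularGroup.T ^ 2 : SL(2, ℤ)) = ModularGroup.T ^ (2 : ℤ) := rfl
  rw [this]
  simp
  decide

theorem T_sq_smul (z : ℍ) : (ModularGroup.T ^ 2 : SL(2, ℤ)) • z = (2 : ℝ) +ᵥ z := by
  have := modular_T_zpow_smul z 2
  exact_mod_cast this

theorem continuous_two_vadd : Continuous fun z : ℍ => (2 : ℝ) +ᵥ z := by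
  rw [isEmbedding_coe.continuous_iff]
  simp only [Function.comp_def, coe_vadd]
  fun_prop

theorem modForms_add_two {κ : ℕ} {φ : ℍ → ℂ} (hφ : φ ∈ modForms κ) (z : ℍ) :
    φ ((2 : ℝ) +ᵥ z) = φ z := by
  have hc := continuous_of_mem_modForms hφ
  refine congrFun (eq_of_jacobiTheta_ne_zero (F := fun z => φ ((2 : ℝ) +ᵥ z))
    (hc.comp continuous_two_vadd) hc fun z hz => ?_) z
  have h := modForms_smul_mul hφ T_sq_mem_Gamma_two hz
  rw [jacobiTheta_T_sq_smul, div_self hz, one_pow, one_mul, T_sq_smul] at h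
  exact h

/-- Hecke's bound: `|φ| (Im z)^(κ/4)` is invariant under `Γ(2)` and grows at most like
`(Im z)^(κ/4)` at every cusp. -/
theorem exists_norm_le_of_mem_modForms {κ : ℕ} {φ : ℍ → ℂ} (hφ : φ ∈ modForms κ) :
    ∃ C : ℝ, 0 ≤ C ∧ ∀ z : ℍ, ‖φ z‖ ≤ C * max 1 (z.im ^ (-(κ : ℝ) / 2)) := by
  have hc := continuous_of_mem_modForms hφ
  set f : ℍ → ℝ := fun z => ‖φ z‖ * z.im ^ ((κ : ℝ) / 4) with hf
  have hfc : Continuous f := hc.norm.mul (continuous_im.rpow_const fun z => .inl z.im_ne_zero)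
  have him : ∀ (γ : SL(2, ℤ)) (z : ℍ), (γ • z).im ^ ((κ : ℝ) / 4) =
      ‖autFactor γ z‖ ^ (-(κ : ℝ) / 2) * z.im ^ ((κ : ℝ) / 4) := by
    intro γ z
    have := norm_nonneg (autFactor γ z)
    rw [im_smul_eq_div_autFactor, Real.div_rpow z.im_pos.le (by positivity),
      ← Real.rpow_natCast, ← Real.rpow_mul this, div_eq_mul_inv, mul_comm,
      ← Real.rpow_neg this]
    congr 2
    push_cast
    ring
  have hinv : ∀ γ ∈ CongruenceSubgroup.Gamma 2, ∀ z, f (γ • z) = f z := by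
    intro γ hγ
    have hs : Continuous fun z : ℍ => γ • z := by
      simp only [ModularGroup.sl_moeb]
      fun_prop
    refine congrFun (eq_of_jacobiTheta_ne_zero (F := fun z => f (γ • z))
      (hfc.comp hs) hfc fun z hz => ?_)
    have h0 : 0 < ‖autFactor γ z‖ := norm_pos_iff.2 (autFactor_ne_zero γ z)
    have h1 : 0 < ‖jacobiTheta z‖ := norm_pos_iff.2 hz
    simp only [hf]
    rw [modForms_smul_mul hφ hγ hz, norm_mul, norm_pow, norm_div, norm_jacobiTheta_smul hγ, him,
      mul_div_assoc, div_self h1.ne', mul_one, ← Real.rpow_natCast, ← Real.rpow_mul h0.le,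
      show -(κ : ℝ) / 2 = -(1 / 2 * κ) by ring, Real.rpow_neg h0.le]
    have := (Real.rpow_pos_of_pos h0 (1 / 2 * κ)).ne'
    field_simp
  have hinf : ∀ γ : SL(2, ℤ),
      (fun z => f (γ • z)) =O[atImInfty] fun z => z.im ^ ((κ : ℝ) / 4) := by
    intro γ
    have h1 := hφ.2.2 γ
    have h2 := h1.norm_left.mul
      (Asymptotics.isBigO_refl (fun z : ℍ => z.im ^ ((κ : ℝ) / 4)) atImInfty)
    refine (h2.congr (fun z => ?_) (fun z => ?_))
    · simp only [hf]
      rw [him, norm_mul, Complex.norm_real, Real.norm_of_nonneg (by positivity)]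
      simp only [autFactor]
      ring
    · simp
  obtain ⟨C, hC⟩ := ModularGroup.exists_bound_of_subgroup_invariant_of_isBigO hfc
    (by positivity) hinf hinv
  have hC0 : 0 ≤ C := by
    have := (norm_nonneg _).trans (hC UpperHalfPlane.I)
    simpa using this
  refine ⟨C, hC0, fun z => ?_⟩
  have h1 := hC z
  have h2 : 0 < z.im ^ ((κ : ℝ) / 4) := by positivity
  rw [Real.norm_of_nonneg (by positivity), ← le_div_iff₀ h2] at h1
  refine h1.trans ?_
  rw [mul_div_assoc]
  gcongr
  rw [div_le_iff₀ h2]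
  rcases le_total z.im (1 / z.im) with h | h
  · rw [max_eq_right h]
    refine le_trans (le_of_eq ?_) (mul_le_mul_of_nonneg_right (le_max_right _ _) h2.le)
    rw [← Real.rpow_add z.im_pos, one_div, Real.inv_rpow z.im_pos.le, ← Real.rpow_neg z.im_pos.le]
    congr 1
    ring
  · rw [max_eq_left h]
    exact le_mul_of_one_le_left h2.le (le_max_left _ _)

/-- Coefficient bound: a 2-periodic holomorphic function on `ℍ`, bounded at `∞`, of moderate
growth `O(Im z ^ (-A))` on the strip `0 ≤ Re z ≤ 2`, `Im z ≤ 1`, has polynomially bounded Fourier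
coefficients. -/
theorem exists_norm_fourierCoeffAt_le {φ : ℍ → ℂ}
    (hper : Function.Periodic (φ ∘ ofComplex) (2 : ℝ))
    (hhol : MDifferentiable 𝓘(ℂ) 𝓘(ℂ) φ) (hbdd : IsBoundedAtImInfty φ) {C : ℝ} {A : ℕ}
    (hC : ∀ z : ℍ, 0 ≤ z.re → z.re ≤ 2 → z.im ≤ 1 → ‖φ z‖ ≤ C * (z.im⁻¹) ^ A) :
    ∃ D : ℝ, 0 ≤ D ∧ ∀ n : ℕ, 0 < n → ‖fourierCoeffAt φ n‖ ≤ D * n ^ A := by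
  -- Integrate over the segment at height `1 / n`, where `|exp (-π i n z)| = exp π`.
  refine ⟨Real.exp Real.pi * |C|, by positivity, fun n hn => ?_⟩
  have hn' : (0 : ℝ) < n := by exact_mod_cast hn
  rw [fourierCoeffAt, qExpansion_coeff_eq_intervalIntegral two_pos hper hhol hbdd n
    (t := 1 / n) (by positivity), norm_mul]
  have h1 : ∀ u ∈ Set.uIoc (0 : ℝ) 2,
      ‖1 / Function.Periodic.qParam 2 (u + (1 / n : ℝ) * Complex.I) ^ n *
        φ ⟨u + (1 / n : ℝ) * Complex.I, by simpa using hn'⟩‖ ≤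
      Real.exp Real.pi * |C| * n ^ A := by
    intro u hu
    rw [Set.uIoc_of_le two_pos.le] at hu
    rw [norm_mul, norm_div, norm_one, norm_pow, Function.Periodic.norm_qParam, ← Real.exp_nat_mul,
      mul_assoc (Real.exp Real.pi)]
    refine mul_le_mul (le_of_eq ?_) ?_ (norm_nonneg _) (by positivity)
    · rw [one_div, ← Real.exp_neg]
      congr 1
      simp [field]
    · refine (hC _ ?_ ?_ ?_).trans ?_
      · simpa [UpperHalfPlane.re] using hu.1.le
      · simpa [UpperHalfPlane.re] using hu.2
      · simpa [UpperHalfPlane.im] using inv_le_one_of_one_le₀ (by exact_mod_cast hn)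
      · refine (le_of_eq ?_).trans (mul_le_mul_of_nonneg_right (le_abs_self C) (by positivity))
        simp [UpperHalfPlane.im]
  have h2 := intervalIntegral.norm_integral_le_of_norm_le_const h1
  rw [sub_zero, abs_two] at h2
  calc _ ≤ ‖(1 / (2 : ℝ) : ℂ)‖ * (Real.exp Real.pi * |C| * n ^ A * 2) := by
        exact mul_le_mul_of_nonneg_left h2 (norm_nonneg _)
    _ = _ := by
        norm_num
        ring

/-! ### Interchanging the cusps -/

theorem neg_I_mul_ne_zero (z : ℍ) : -Complex.I * (z : ℂ) ≠ 0 :=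
  mul_ne_zero (neg_ne_zero.2 Complex.I_ne_zero) (ne_zero z)

theorem neg_I_mul_mem_slitPlane (z : ℍ) : -Complex.I * (z : ℂ) ∈ Complex.slitPlane := by
  left
  simpa using z.im_pos

theorem cpow_half_pow (w : ℂ) (κ : ℕ) : (w ^ (1 / 2 : ℂ)) ^ κ = w ^ ((κ : ℂ) / 2) := by
  rw [← Complex.cpow_nat_mul]
  congr 1
  ring

theorem norm_swapCusps (κ : ℕ) (φ : ℍ → ℂ) (z : ℍ) :
    ‖swapCusps κ φ z‖ = ‖(z : ℂ)‖ ^ (-(κ : ℝ) / 2) * ‖φ (ModularGroup.S • z)‖ := by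
  have : (-(κ : ℂ) / 2) = ((-(κ : ℝ) / 2 : ℝ) : ℂ) := by push_cast; ring
  simp only [swapCusps, LinearMap.coe_mk, AddHom.coe_mk]
  rw [norm_mul, this, Complex.norm_cpow_real]
  simp

theorem mdifferentiable_swapCusps {κ : ℕ} {φ : ℍ → ℂ} (hφ : φ ∈ modForms κ) :
    MDifferentiable 𝓘(ℂ) 𝓘(ℂ) (swapCusps κ φ) := by
  have h1 : MDifferentiable 𝓘(ℂ) 𝓘(ℂ) fun z : ℍ => φ (ModularGroup.S • z) := by
    have hS : MDifferentiable 𝓘(ℂ) 𝓘(ℂ)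
        fun z : ℍ => (ModularGroup.S : GL (Fin 2) ℝ) • z := mdifferentiable_smul (by simp)
    exact hφ.1.comp hS
  have h2 : MDifferentiable 𝓘(ℂ) 𝓘(ℂ)
      fun z : ℍ => (-Complex.I * (z : ℂ)) ^ (-(κ : ℂ) / 2) := by
    intro z
    have h3 : DifferentiableAt ℂ (fun w : ℂ => (-Complex.I * w) ^ (-(κ : ℂ) / 2)) z :=
      DifferentiableAt.cpow_const (by fun_prop) (neg_I_mul_mem_slitPlane z)
    exact h3.mdifferentiableAt.comp z z.mdifferentiable_coe
  exact h2.mul h1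

theorem swapCusps_add_two {κ : ℕ} {φ : ℍ → ℂ} (hφ : φ ∈ modForms κ) (z : ℍ) :
    swapCusps κ φ ((2 : ℝ) +ᵥ z) = swapCusps κ φ z := by
  have hc : Continuous (swapCusps κ φ) := (mdifferentiable_swapCusps hφ).continuous
  refine congrFun (eq_of_jacobiTheta_ne_zero (F := fun z => swapCusps κ φ ((2 : ℝ) +ᵥ z))
    (hc.comp continuous_two_vadd) hc fun z hz => ?_) z
  -- `S T² = γ S`, where `γ` lies in `Γ(2)` as a conjugate of `T²`.
  set γ : SL(2, ℤ) := ModularGroup.S * ModularGroup.T ^ 2 * ModularGroup.S⁻¹ with hγdef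
  have hγ : γ ∈ CongruenceSubgroup.Gamma 2 :=
    (CongruenceSubgroup.Gamma_normal 2).conj_mem _ T_sq_mem_Gamma_two _
  have hsm : ModularGroup.S • ((2 : ℝ) +ᵥ z) = γ • (ModularGroup.S • z) := by
    rw [← T_sq_smul, hγdef, smul_smul, smul_smul, inv_mul_cancel_right]
  have h0 : ∀ w : ℍ, (-Complex.I * (w : ℂ)) ^ (1 / 2 : ℂ) ≠ 0 := fun w => by
    rw [Ne, Complex.cpow_eq_zero_iff]
    exact fun h => neg_I_mul_ne_zero w h.1
  have hz' : jacobiTheta (ModularGroup.S • z : ℍ) ≠ 0 := by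
    rw [jacobiTheta_S_smul]
    exact mul_ne_zero (h0 z) hz
  simp only [swapCusps, LinearMap.coe_mk, AddHom.coe_mk]
  rw [hsm, modForms_smul_mul hφ hγ hz', ← hsm, jacobiTheta_S_smul, jacobiTheta_S_smul,
    ← T_sq_smul, jacobiTheta_T_sq_smul, mul_div_mul_right _ _ hz, div_pow, cpow_half_pow,
    cpow_half_pow, neg_div, Complex.cpow_neg, Complex.cpow_neg]
  have h1 : (-Complex.I * ((ModularGroup.T ^ 2 • z : ℍ) : ℂ)) ^ ((κ : ℂ) / 2) ≠ 0 := by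
    rw [← cpow_half_pow]
    exact pow_ne_zero _ (h0 _)
  rw [← mul_assoc, ← mul_div_assoc, inv_mul_cancel₀ h1, one_div]

theorem periodic_comp_ofComplex_two {ψ : ℍ → ℂ} (h : ∀ z : ℍ, ψ ((2 : ℝ) +ᵥ z) = ψ z) :
    Function.Periodic (ψ ∘ ofComplex) (2 : ℝ) := by
  intro w
  by_cases hw : 0 < w.im
  · have h2 : 0 < (w + (2 : ℝ)).im := by simpa using hw
    simp only [Function.comp_apply, ofComplex_apply_of_im_pos h2, ofComplex_apply_of_im_pos hw]
    rw [← h ⟨w, hw⟩]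
    congr 1
    ext
    simp [add_comm]
  · have h2 : (w + (2 : ℝ)).im ≤ 0 := by simpa using hw
    simp only [Function.comp_apply, ofComplex_apply_of_im_nonpos h2,
      ofComplex_apply_of_im_nonpos (not_lt.1 hw)]

/-- The properties of `φ` and `φ₀` used in the summation formula: 2-periodic holomorphic functions
vanishing at `∞`, of moderate growth towards the real axis. -/
structure IsModerate (ψ : ℍ → ℂ) : Prop where
  periodic : Function.Periodic (ψ ∘ ofComplex) (2 : ℝ)
  holo : MDifferentiable 𝓘(ℂ) 𝓘(ℂ) ψ
  zero : IsZeroAtImInfty ψ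
  growth : ∃ (C : ℝ) (A : ℕ), ∀ z : ℍ, 0 ≤ z.re → z.re ≤ 2 → z.im ≤ 1 → ‖ψ z‖ ≤ C * (z.im⁻¹) ^ A

theorem rpow_neg_le_inv_pow {y : ℝ} (hy : 0 < y) (hy1 : y ≤ 1) (κ : ℕ) :
    y ^ (-(κ : ℝ) / 2) ≤ y⁻¹ ^ κ := by
  rw [← Real.rpow_natCast, Real.inv_rpow hy.le, ← Real.rpow_neg hy.le]
  exact Real.rpow_le_rpow_of_exponent_ge hy hy1 (by linarith [Nat.cast_nonneg (α := ℝ) κ])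

theorem isModerate_of_mem_cuspType {κ : ℕ} {φ : ℍ → ℂ} (hφ : φ ∈ cuspType κ) : IsModerate φ := by
  obtain ⟨⟨h1, h2⟩, h3⟩ := hφ
  refine ⟨periodic_comp_ofComplex_two (modForms_add_two h1), h1.1, h2, ?_⟩
  obtain ⟨C, hC, hb⟩ := exists_norm_le_of_mem_modForms h1
  refine ⟨C, κ, fun z _ _ hz => (hb z).trans ?_⟩
  gcongr
  exact max_le (one_le_pow₀ ((one_le_inv₀ z.im_pos).2 hz)) (rpow_neg_le_inv_pow z.im_pos hz κ)

/-- The growth of `φ₀` follows from that of `φ`, as `Im (-1/z) = Im z / |z|²` and `|z|` is bounded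
on the strip. -/
theorem isModerate_swapCusps {κ : ℕ} {φ : ℍ → ℂ} (hφ : φ ∈ cuspType κ) :
    IsModerate (swapCusps κ φ) := by
  obtain ⟨⟨h1, h2⟩, h3⟩ := hφ
  refine ⟨periodic_comp_ofComplex_two (swapCusps_add_two h1), mdifferentiable_swapCusps h1, h3, ?_⟩
  obtain ⟨C, hC, hb⟩ := exists_norm_le_of_mem_modForms h1
  refine ⟨C * 3 ^ κ, κ, fun z hz0 hz2 hz => ?_⟩
  have hn : 0 < ‖(z : ℂ)‖ := norm_pos_iff.2 (ne_zero z)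
  have hn3 : ‖(z : ℂ)‖ ≤ 3 := by
    refine (Complex.norm_le_abs_re_add_abs_im _).trans ?_
    have ha : |(z : ℂ).re| ≤ 2 := abs_le.2 ⟨by linarith [show (0 : ℝ) ≤ (z : ℂ).re from hz0], hz2⟩
    have hb : |(z : ℂ).im| ≤ 1 :=
      abs_le.2 ⟨by linarith [show (0 : ℝ) < (z : ℂ).im from z.im_pos], hz⟩
    linarith
  have hni : z.im ≤ ‖(z : ℂ)‖ := (le_abs_self _).trans (Complex.abs_im_le_norm _)
  have h4 : ‖(z : ℂ)‖ ^ (-(κ : ℝ) / 2) ≤ z.im ^ (-(κ : ℝ) / 2) :=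
    Real.rpow_le_rpow_of_nonpos z.im_pos hni (by
      have := Nat.cast_nonneg (α := ℝ) κ
      linarith)
  have him : (ModularGroup.S • z).im = z.im / ‖(z : ℂ)‖ ^ 2 := by
    rw [im_smul_eq_div_autFactor]
    simp [autFactor, ModularGroup.S]
  have hk : z.im ^ (-(κ : ℝ) / 2) ≤ z.im⁻¹ ^ κ := rpow_neg_le_inv_pow z.im_pos hz κ
  have h5 : ‖(z : ℂ)‖ ^ (-(κ : ℝ) / 2) * (z.im / ‖(z : ℂ)‖ ^ 2) ^ (-(κ : ℝ) / 2) ≤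
      3 ^ κ * z.im⁻¹ ^ κ := by
    have h6 : ‖(z : ℂ)‖ ^ ((κ : ℝ) / 2) ≤ 3 ^ κ := by
      refine (Real.rpow_le_rpow hn.le hn3 (by positivity)).trans ?_
      rw [← Real.rpow_natCast]
      exact Real.rpow_le_rpow_of_exponent_le (by norm_num) (by
        have := Nat.cast_nonneg (α := ℝ) κ
        linarith)
    refine le_trans (le_of_eq ?_) (mul_le_mul h6 hk (by positivity) (by positivity))
    rw [Real.div_rpow z.im_pos.le (by positivity), ← Real.rpow_natCast, ← Real.rpow_mul hn.le,
      div_eq_mul_inv (z.im ^ _), ← Real.rpow_neg hn.le, mul_left_comm, ← Real.rpow_add hn, mul_comm]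
    congr 2
    push_cast
    ring
  rw [norm_swapCusps]
  have h7 := hb (ModularGroup.S • z)
  rw [him] at h7
  calc _ ≤ ‖(z : ℂ)‖ ^ (-(κ : ℝ) / 2) *
        (C * max 1 ((z.im / ‖(z : ℂ)‖ ^ 2) ^ (-(κ : ℝ) / 2))) := by gcongr
    _ = C * max (‖(z : ℂ)‖ ^ (-(κ : ℝ) / 2))
        (‖(z : ℂ)‖ ^ (-(κ : ℝ) / 2) * (z.im / ‖(z : ℂ)‖ ^ 2) ^ (-(κ : ℝ) / 2)) := by
      rw [mul_left_comm, mul_max_of_nonneg _ _ (by positivity), mul_one]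
    _ ≤ C * (3 ^ κ * z.im⁻¹ ^ κ) := by
      gcongr
      refine max_le ((h4.trans hk).trans ?_) h5
      refine le_mul_of_one_le_left (by have := z.im_pos; positivity) ?_
      exact one_le_pow₀ (by norm_num)
    _ = _ := by ring

theorem IsModerate.exists_norm_coeff_le {ψ : ℍ → ℂ} (h : IsModerate ψ) :
    ∃ (D : ℝ) (A : ℕ), 0 ≤ D ∧ ∀ n : ℕ+, ‖fourierCoeffAt ψ n‖ ≤ D * (n : ℝ) ^ A := by
  obtain ⟨C, A, hC⟩ := h.growth
  obtain ⟨D, hD, hb⟩ := exists_norm_fourierCoeffAt_le h.periodic h.holo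
    h.zero.isBoundedAtImInfty hC
  exact ⟨D, A, hD, fun n => hb n n.pos⟩

theorem IsModerate.hasSum {ψ : ℍ → ℂ} (h : IsModerate ψ) (z : ℍ) :
    HasSum (fun n : ℕ+ => fourierCoeffAt ψ n * Complex.exp (Real.pi * Complex.I * n * z))
      (ψ z) := by
  have h1 := hasSum_qExpansion two_pos h.periodic h.holo h.zero.isBoundedAtImInfty z
  have h0 : (qExpansion 2 ψ).coeff 0 = 0 := by
    rw [qExpansion_coeff_zero two_pos
      (analyticAt_cuspFunction_zero two_pos h.periodic h.holo h.zero.isBoundedAtImInfty) h.periodic,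
      h.zero.valueAtInfty_eq_zero]
  have h2 : HasSum (fun n : ℕ+ =>
      (qExpansion 2 ψ).coeff (n : ℕ) • Function.Periodic.qParam 2 z ^ (n : ℕ)) (ψ z) := by
    refine (Function.Injective.hasSum_iff PNat.coe_injective fun n hn => ?_).2 h1
    have : n = 0 := by
      by_contra hne
      exact hn ⟨⟨n, Nat.pos_of_ne_zero hne⟩, rfl⟩
    simp [this, h0]
  convert h2 using 2 with n
  rw [fourierCoeffAt, smul_eq_mul, Function.Periodic.qParam, ← Complex.exp_nat_mul]
  congr 2
  push_cast
  ring

/-! ### Fourier series on the imaginary axis -/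

/-- The modular relation between the Fourier series of `φ` and `φ₀` on the imaginary axis. -/
theorem tsum_fourierCoeffAt_eq {κ : ℕ} {φ : ℍ → ℂ} (hφ : φ ∈ cuspType κ) {t : ℝ} (ht : 0 < t) :
    ∑' n : ℕ+, fourierCoeffAt φ n * Complex.exp (-Real.pi * n * t) =
      ((t ^ (-(κ : ℝ) / 2) : ℝ) : ℂ) *
        ∑' n : ℕ+, fourierCoeffAt (swapCusps κ φ) n * Complex.exp (-Real.pi * n / t) := by
  have hz : ∀ s : ℝ, 0 < s → 0 < ((s : ℂ) * Complex.I).im := fun s hs => by simpa using hs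
  have h1 := (isModerate_of_mem_cuspType hφ).hasSum ⟨t * Complex.I, hz t ht⟩
  have h2 := (isModerate_swapCusps hφ).hasSum ⟨(t⁻¹ : ℝ) * Complex.I, hz _ (inv_pos.2 ht)⟩
  have e1 : ∀ (n : ℕ+) (s : ℝ), Complex.exp (Real.pi * Complex.I * n * ((s : ℂ) * Complex.I)) =
      Complex.exp (-Real.pi * n * s) := fun n s => by
    congr 1
    linear_combination (Real.pi : ℂ) * n * s * Complex.I_sq
  simp only [e1] at h1 h2
  have e2 : ∀ n : ℕ+, Complex.exp (-Real.pi * n / t) =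
      Complex.exp (-Real.pi * n * (t⁻¹ : ℝ)) := fun n => by
    rw [Complex.ofReal_inv, div_eq_mul_inv]
  simp only [e2]
  rw [h1.tsum_eq, h2.tsum_eq]
  have hS : ModularGroup.S • (⟨(t⁻¹ : ℝ) * Complex.I, hz _ (inv_pos.2 ht)⟩ : ℍ) =
      ⟨t * Complex.I, hz t ht⟩ := by
    ext
    rw [coe_S_smul]
    have := ht.ne'
    push_cast
    field_simp
    simp
  simp only [swapCusps, LinearMap.coe_mk, AddHom.coe_mk]
  rw [hS, ← mul_assoc]
  have e3 : -Complex.I * ((t⁻¹ : ℝ) * Complex.I) = ((t⁻¹ : ℝ) : ℂ) := by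
    linear_combination (-(t⁻¹ : ℝ) : ℂ) * Complex.I_sq
  have e4 : (-(κ : ℂ) / 2) = ((-(κ : ℝ) / 2 : ℝ) : ℂ) := by push_cast; ring
  rw [e3, e4, ← Complex.ofReal_cpow (by positivity), ← Complex.ofReal_mul,
    ← Real.mul_rpow ht.le (by positivity), mul_inv_cancel₀ ht.ne', Real.one_rpow,
    Complex.ofReal_one, one_mul]

theorem exists_fourierCoeffAt_ne_zero {ψ : ℍ → ℂ} (h : IsModerate ψ) (h0 : ψ ≠ 0) :
    ∃ n : ℕ+, fourierCoeffAt ψ n ≠ 0 := by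
  by_contra! hn
  refine h0 (funext fun z => ?_)
  have := h.hasSum z
  simp only [hn, zero_mul] at this
  exact this.unique hasSum_zero

/-! ### Existence of cusp-type forms -/

/-- The form `θ₂⁸ θ₄⁸ Θ₃^(κ - 16)` of weight `κ / 2`, invariant under interchanging the cusps `0`
and `∞` of `Γ(2)` and vanishing at both. -/
def thetaProd (κ : ℕ) (z : ℍ) : ℂ :=
  thetaEight ![0, 1] z * thetaEight ![1, 0] z * jacobiTheta z ^ (κ - 16)

theorem swapCusps_thetaProd {κ : ℕ} (hκ : 16 ≤ κ) : swapCusps κ (thetaProd κ) = thetaProd κ := by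
  ext z
  have hz := ne_zero z
  simp only [swapCusps, LinearMap.coe_mk, AddHom.coe_mk, thetaProd]
  have h16 : (-Complex.I * (z : ℂ)) ^ ((κ : ℂ) / 2) =
      (z : ℂ) ^ 8 * ((-Complex.I * (z : ℂ)) ^ (1 / 2 : ℂ)) ^ (κ - 16) := by
    have h8 : (z : ℂ) ^ 8 = (((-Complex.I * (z : ℂ)) ^ (1 / 2 : ℂ)) ^ 8) ^ 2 := by
      rw [cpow_half_pow_eight]
      ring
    rw [← cpow_half_pow, h8, ← pow_mul, ← pow_add]
    congr 1
    omega
  have h0 : (-Complex.I * (z : ℂ)) ^ ((κ : ℂ) / 2) ≠ 0 := by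
    rw [Ne, Complex.cpow_eq_zero_iff]
    exact fun h => neg_I_mul_ne_zero z h.1
  have hneg : (-1 : ZMod 2) = 1 := by decide
  rw [coe_S_smul, thetaEight_S _ _ hz, thetaEight_S _ _ hz, jacobiTheta_S _ hz, neg_div,
    Complex.cpow_neg, mul_pow, inv_mul_eq_iff_eq_mul₀ h0, h16]
  simp only [Matrix.cons_val_zero, Matrix.cons_val_one, neg_zero, hneg]
  ring

theorem norm_jacobiTheta_eq (z : ℂ) : ‖jacobiTheta z‖ = ‖thetaEight ![1, 1] z‖ ^ (1 / 8 : ℝ) := by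
  simp only [thetaEight, Matrix.cons_val_zero, Matrix.cons_val_one, one_ne_zero, if_false,
    norm_pow]
  rw [← Real.rpow_natCast, ← Real.rpow_mul (norm_nonneg _)]
  norm_num

/-- For `κ ≥ 17` the factor `Θ₃` is present, so that the product vanishes at the zeros of `Θ₃`, in
accordance with the junk value of `thetaSlash` there. -/
theorem thetaProd_mem_modForms {κ : ℕ} (hκ : 17 ≤ κ) : thetaProd κ ∈ modForms κ := by
  have hd : ∀ F : ℂ → ℂ, (∀ τ : ℂ, 0 < τ.im → DifferentiableAt ℂ F τ) →
      MDifferentiable 𝓘(ℂ) 𝓘(ℂ) fun z : ℍ => F z := fun F hF z =>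
    (hF z z.im_pos).mdifferentiableAt.comp z z.mdifferentiable_coe
  refine ⟨?_, fun γ hγ => ?_, fun γ => ?_⟩
  · refine hd (fun τ => thetaEight ![0, 1] τ * thetaEight ![1, 0] τ * jacobiTheta τ ^ (κ - 16))
      fun τ hτ => ?_
    have h2 := differentiableAt_theta2 hτ
    have h3 := differentiableAt_jacobiTheta hτ
    have h4 := differentiableAt_theta4 hτ
    simp only [thetaEight, Matrix.cons_val_zero, Matrix.cons_val_one, one_ne_zero, if_false,
      if_true]
    fun_prop
  · ext z
    by_cases hz : jacobiTheta z = 0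
    · have : κ - 16 ≠ 0 := by omega
      have hκ0 : κ ≠ 0 := by omega
      simp [thetaSlash, hz, thetaProd, this, hκ0]
    · have h2 : jacobiTheta (γ • z : ℍ) ≠ 0 := by
        rw [← norm_ne_zero_iff, norm_jacobiTheta_smul hγ]
        have := norm_ne_zero_iff.2 (autFactor_ne_zero γ z)
        have := norm_ne_zero_iff.2 hz
        positivity
      have h3 : jacobiTheta (γ • z : ℍ) ^ 8 = autFactor γ z ^ 4 * jacobiTheta z ^ 8 := by
        simpa [thetaEight] using thetaEight_smul_of_mem_Gamma_two hγ ![1, 1] z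
      rw [thetaSlash, thetaProd, thetaEight_smul_of_mem_Gamma_two hγ,
        thetaEight_smul_of_mem_Gamma_two hγ, inv_mul_eq_iff_eq_mul₀
          (pow_ne_zero _ (div_ne_zero h2 hz)), thetaProd, div_pow]
      have h4 : ∀ x : ℂ, x ^ κ = (x ^ 8) ^ 2 * x ^ (κ - 16) := fun x => by
        rw [← pow_mul, ← pow_add]
        congr 1
        omega
      rw [h4, h4 (jacobiTheta z), h3]
      field_simp
  · set e : ℝ := ((κ - 16 : ℕ) : ℝ) / 8 with he
    -- All three theta constants have weight `1/2`, so the factors `|c z + d|` cancel.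
    have key : ∀ z : ℍ,
        ‖((‖autFactor γ z‖ ^ (-(κ : ℝ) / 2) : ℝ) : ℂ) * thetaProd κ (γ • z)‖ =
        ‖thetaEight (rowAct ![0, 1] γ) z‖ * ‖thetaEight (rowAct ![1, 0] γ) z‖ *
          ‖thetaEight (rowAct ![1, 1] γ) z‖ ^ e := by
      intro z
      have hj : 0 < ‖autFactor γ z‖ := norm_pos_iff.2 (autFactor_ne_zero γ z)
      rw [norm_mul, Complex.norm_real, Real.norm_of_nonneg (by positivity), thetaProd, norm_mul,
        norm_pow, norm_jacobiTheta_eq, ← Real.rpow_mul_natCast (norm_nonneg _), norm_mul,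
        thetaEight_smul, thetaEight_smul, thetaEight_smul, norm_mul, norm_mul, norm_mul,
        norm_pow, Real.mul_rpow (by positivity) (norm_nonneg _), ← Real.rpow_natCast,
        ← Real.rpow_mul hj.le]
      have h5 : ‖autFactor γ z‖ ^ (-(κ : ℝ) / 2) * (‖autFactor γ z‖ ^ ((4 : ℕ) : ℝ) *
          ‖autFactor γ z‖ ^ ((4 : ℕ) : ℝ) *
          ‖autFactor γ z‖ ^ (((4 : ℕ) : ℝ) * (1 / 8 * ((κ - 16 : ℕ) : ℝ)))) = 1 := by
        rw [← Real.rpow_add hj, ← Real.rpow_add hj, ← Real.rpow_add hj, Nat.cast_sub (by omega)]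
        convert Real.rpow_zero _ using 2
        push_cast
        ring
      rw [show e = 1 / 8 * ((κ - 16 : ℕ) : ℝ) by rw [he]; ring]
      linear_combination (‖thetaEight (rowAct ![0, 1] γ) z‖ * ‖thetaEight (rowAct ![1, 0] γ) z‖ *
        ‖thetaEight (rowAct ![1, 1] γ) z‖ ^ (1 / 8 * ((κ - 16 : ℕ) : ℝ))) * h5
    obtain ⟨M1, A1, h1⟩ := isBoundedAtImInfty_iff.1 (thetaEight_isBoundedAtImInfty
      (rowAct ![0, 1] γ))
    obtain ⟨M2, A2, h2⟩ := isBoundedAtImInfty_iff.1 (thetaEight_isBoundedAtImInfty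
      (rowAct ![1, 0] γ))
    obtain ⟨M3, A3, h3⟩ := isBoundedAtImInfty_iff.1 (thetaEight_isBoundedAtImInfty
      (rowAct ![1, 1] γ))
    refine isBoundedAtImInfty_iff.2 ⟨M1 * M2 * M3 ^ e, max A1 (max A2 A3), fun z hz => ?_⟩
    refine (key z).trans_le ?_
    have g1 := h1 z ((le_max_left _ _).trans hz)
    have g2 := h2 z ((le_max_left _ _).trans ((le_max_right _ _).trans hz))
    have g3 := h3 z ((le_max_right _ _).trans ((le_max_right _ _).trans hz))
    have g1' := (norm_nonneg _).trans g1
    have g2' := (norm_nonneg _).trans g2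
    gcongr

theorem thetaProd_mem_cuspType {κ : ℕ} (hκ : 17 ≤ κ) : thetaProd κ ∈ cuspType κ := by
  have hz : IsZeroAtImInfty (thetaProd κ) := by
    have h1 := thetaEight_isBoundedAtImInfty ![1, 0]
    have h2 : IsBoundedAtImInfty fun z : ℍ => jacobiTheta z ^ (κ - 16) := by
      refine isBoundedAtImInfty_iff.2
        ⟨(∑' n : ℤ, Real.exp (-Real.pi * (1 * n ^ 2 - 2 * (1 / 2) * |n|))) ^ (κ - 16), 1,
          fun z hz => ?_⟩
      rw [norm_pow]
      gcongr
      exact norm_jacobiTheta_le hz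
    exact Filter.ZeroAtFilter.mul_boundedAtFilter
      (Filter.ZeroAtFilter.mul_boundedAtFilter theta2_pow_isZeroAtImInfty h1) h2
  refine ⟨⟨thetaProd_mem_modForms hκ, hz⟩, ?_⟩
  change IsZeroAtImInfty (swapCusps κ (thetaProd κ))
  rw [swapCusps_thetaProd (by omega)]
  exact hz

theorem thetaProd_ne_zero (κ : ℕ) : thetaProd κ ≠ 0 := by
  intro h
  have h1 := congrFun h UpperHalfPlane.I
  simp only [thetaProd, Pi.zero_apply, coe_I] at h1
  have h3 : jacobiTheta Complex.I ≠ 0 := by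
    have := thetaEight_I_ne_zero ![1, 1] (by simp)
    intro h3
    simp [thetaEight, h3] at this
  exact mul_ne_zero (mul_ne_zero (thetaEight_I_ne_zero _ (by simp))
    (thetaEight_I_ne_zero _ (by simp))) (pow_ne_zero _ h3) h1

/-- Infinitely many summands are nonzero, as `thetaProd` lies in all those of large weight. -/
theorem not_finiteDimensional_directSum_cuspType (d : ℕ) :
    ¬ FiniteDimensional ℂ (DirectSum ℕ fun m => cuspType (d + 2 * m)) := by
  intro hfin
  classical
  obtain ⟨s, hs⟩ := hfin.fg_top
  -- A finite generating set only involves finitely many of the summands.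
  obtain ⟨N, hN⟩ : ∃ N, ∀ x ∈ s, ∀ m, N ≤ m → x m = 0 := by
    refine ⟨(s.biUnion fun x => DFinsupp.support x).sup id + 1, fun x hx m hm => ?_⟩
    by_contra h
    have h1 : m ∈ s.biUnion fun x => DFinsupp.support x :=
      Finset.mem_biUnion.2 ⟨x, hx, DFinsupp.mem_support_iff.2 h⟩
    have := Finset.le_sup (f := id) h1
    simp only [id] at this
    omega
  -- The weight index `d + 2 * (N + 9)` is at least `17`.
  set M := N + 9 with hM
  have hker : (⊤ : Submodule ℂ (DirectSum ℕ fun m => cuspType (d + 2 * m))) ≤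
      LinearMap.ker (DirectSum.component ℂ ℕ (fun m => cuspType (d + 2 * m)) M) := by
    rw [← hs, Submodule.span_le]
    intro x hx
    exact hN x hx M (by omega)
  have h1 := hker (Submodule.mem_top (x := DirectSum.lof ℂ ℕ (fun m => cuspType (d + 2 * m)) M
    ⟨_, thetaProd_mem_cuspType (κ := d + 2 * M) (by omega)⟩))
  rw [LinearMap.mem_ker, DirectSum.component.lof_self] at h1
  exact thetaProd_ne_zero _ (congrArg Subtype.val h1)

/-! ### Gaussian moments of harmonic polynomials -/

section Gaussian

open MvPolynomial (pderiv X C)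

variable {d : ℕ}

/-- The polynomial ring in `d` complex variables. -/
abbrev Poly (d : ℕ) : Type := MvPolynomial (Fin d) ℂ

/-- The Gaussian weight `exp (-π ‖x‖²)`. -/
def gauss (x : Rd d) : ℂ := ((Real.exp (-Real.pi * ‖x‖ ^ 2) : ℝ) : ℂ)

@[simp] theorem evalAt_add (p q : Poly d) (x : Rd d) :
    evalAt (p + q) x = evalAt p x + evalAt q x := by simp [evalAt]

@[simp] theorem evalAt_mul (p q : Poly d) (x : Rd d) :
    evalAt (p * q) x = evalAt p x * evalAt q x := by simp [evalAt]

@[simp] theorem evalAt_C (c : ℂ) (x : Rd d) : evalAt (C c : Poly d) x = c := by simp [evalAt]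

@[simp] theorem evalAt_X (i : Fin d) (x : Rd d) : evalAt (X i : Poly d) x = x i := by
  simp [evalAt]

@[simp] theorem evalAt_smul (c : ℂ) (p : Poly d) (x : Rd d) :
    evalAt (c • p) x = c * evalAt p x := by simp [evalAt, MvPolynomial.smul_eval]

@[simp] theorem evalAt_pow (p : Poly d) (n : ℕ) (x : Rd d) :
    evalAt (p ^ n) x = evalAt p x ^ n := by simp [evalAt]

theorem evalAt_sum {ι : Type*} (s : Finset ι) (p : ι → Poly d) (x : Rd d) :
    evalAt (∑ i ∈ s, p i) x = ∑ i ∈ s, evalAt (p i) x := by simp [evalAt]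

theorem continuous_evalAt (p : Poly d) : Continuous (evalAt p) := by
  unfold evalAt
  exact (MvPolynomial.continuous_eval p).comp (by fun_prop)

theorem continuous_gauss : Continuous (gauss (d := d)) := by
  unfold gauss
  fun_prop

theorem evalAt_homogeneous {p : Poly d} {m : ℕ} (hp : p.IsHomogeneous m) (r : ℝ) (x : Rd d) :
    evalAt p (r • x) = (r : ℂ) ^ m * evalAt p x := by
  unfold evalAt
  rw [MvPolynomial.eval_eq', MvPolynomial.eval_eq', Finset.mul_sum]
  refine Finset.sum_congr rfl fun e he => ?_
  have hdeg : ∑ i, e i = m := by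
    rw [← hp (MvPolynomial.mem_support_iff.1 he)]
    simp [Finsupp.weight_apply, Finsupp.sum_fintype]
  simp only [PiLp.smul_apply, smul_eq_mul, Complex.ofReal_mul, mul_pow]
  rw [Finset.prod_mul_distrib, Finset.prod_pow_eq_pow_sum, hdeg]
  ring

theorem exists_norm_evalAt_le (p : Poly d) :
    ∃ (K : ℝ) (N : ℕ), 0 ≤ K ∧ ∀ x : Rd d, ‖evalAt p x‖ ≤ K * (1 + ‖x‖) ^ N := by
  induction p using MvPolynomial.induction_on with
  | C a => exact ⟨‖a‖, 0, norm_nonneg _, fun x => by simp⟩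
  | add p q hp hq =>
    obtain ⟨K, N, hK, h⟩ := hp
    obtain ⟨K', N', hK', h'⟩ := hq
    refine ⟨K + K', max N N', by positivity, fun x => ?_⟩
    have h1 : 1 ≤ 1 + ‖x‖ := by linarith [norm_nonneg x]
    rw [evalAt_add, add_mul]
    refine (norm_add_le _ _).trans (add_le_add ((h x).trans ?_) ((h' x).trans ?_))
    · gcongr
      exact le_max_left _ _
    · gcongr
      exact le_max_right _ _
  | mul_X p i hp =>
    obtain ⟨K, N, hK, h⟩ := hp
    refine ⟨K, N + 1, hK, fun x => ?_⟩
    rw [evalAt_mul, norm_mul, pow_succ, ← mul_assoc]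
    gcongr
    · exact h x
    · rw [evalAt_X, Complex.norm_real]
      exact (PiLp.norm_apply_le x i).trans (by linarith)

theorem integrable_mul_gauss {f : Rd d → ℂ} (hf : AEStronglyMeasurable f) {K : ℝ} {N : ℕ}
    (h : ∀ x, ‖f x‖ ≤ K * (1 + ‖x‖) ^ N) : Integrable fun x => f x * gauss x := by
  have h1 : Integrable fun x : Rd d => Real.exp (-1 * ‖x‖ ^ 2) := by
    have := (GaussianFourier.integrable_cexp_neg_mul_sq_norm_add (V := Rd d) (b := 1)
      (by simp) 0 0).norm
    refine this.congr (Filter.Eventually.of_forall fun x => ?_)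
    simp only [Complex.norm_exp]
    congr 1
    simp [← Complex.ofReal_pow]
  refine (h1.const_mul (K * (N.factorial * Real.exp 2))).mono'
    (hf.mul continuous_gauss.aestronglyMeasurable) (Filter.Eventually.of_forall fun x => ?_)
  have h2 : 0 ≤ ‖x‖ := norm_nonneg x
  have hK : 0 ≤ K * (1 + ‖x‖) ^ N := (norm_nonneg _).trans (h x)
  have hK' : 0 ≤ K := nonneg_of_mul_nonneg_left hK (by positivity)
  have h3 : (1 + ‖x‖) ^ N ≤ N.factorial * Real.exp (1 + ‖x‖) := by
    have := Real.pow_div_factorial_le_exp (1 + ‖x‖) (by positivity) N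
    rwa [div_le_iff₀' (by positivity)] at this
  rw [norm_mul, gauss, Complex.norm_real, Real.norm_of_nonneg (Real.exp_pos _).le]
  calc ‖f x‖ * Real.exp (-Real.pi * ‖x‖ ^ 2)
      ≤ K * (N.factorial * Real.exp (1 + ‖x‖)) * Real.exp (-Real.pi * ‖x‖ ^ 2) := by
        gcongr
        exact (h x).trans (by gcongr)
    _ = K * N.factorial * Real.exp (1 + ‖x‖ + -Real.pi * ‖x‖ ^ 2) := by
        rw [Real.exp_add (1 + ‖x‖)]
        ring
    _ ≤ K * N.factorial * Real.exp (2 + -1 * ‖x‖ ^ 2) := by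
        gcongr K * N.factorial * Real.exp ?_
        nlinarith [Real.pi_gt_three, sq_nonneg (‖x‖ - 1), sq_nonneg ‖x‖]
    _ = _ := by
        rw [Real.exp_add]
        ring

theorem integrable_evalAt_mul_gauss (p : Poly d) : Integrable fun x => evalAt p x * gauss x := by
  obtain ⟨K, N, _, h⟩ := exists_norm_evalAt_le p
  exact integrable_mul_gauss (continuous_evalAt p).aestronglyMeasurable h

theorem integrable_norm_pow_mul_gaussian (D : ℕ) :
    Integrable fun x : Rd d => ‖x‖ ^ D * Real.exp (-Real.pi * ‖x‖ ^ 2) := by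
  have h := integrable_mul_gauss (d := d) (f := fun x => ((‖x‖ ^ D : ℝ) : ℂ)) (K := 1) (N := D)
    (by fun_prop) fun x => by
      rw [Complex.norm_real, norm_pow, norm_norm, one_mul]
      gcongr
      linarith
  have := h.norm
  refine this.congr (Filter.Eventually.of_forall fun x => ?_)
  beta_reduce
  rw [norm_mul, gauss, Complex.norm_real, Complex.norm_real, norm_pow, norm_norm,
    Real.norm_of_nonneg (Real.exp_pos _).le]

/-- The Gaussian integral `∫ p(x) exp (-π ‖x‖²) dx` of a polynomial. -/
def gaussInt (d : ℕ) : Poly d →ₗ[ℂ] ℂ where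
  toFun p := ∫ x : Rd d, evalAt p x * gauss x
  map_add' p q := by
    rw [← integral_add (integrable_evalAt_mul_gauss p) (integrable_evalAt_mul_gauss q)]
    simp [add_mul]
  map_smul' c p := by
    rw [RingHom.id_apply, smul_eq_mul, ← integral_const_mul]
    simp [mul_assoc]

theorem gaussInt_apply (p : Poly d) : gaussInt d p = ∫ x : Rd d, evalAt p x * gauss x := rfl

theorem gaussInt_one : gaussInt d 1 = 1 := by
  have h := GaussianFourier.integral_cexp_neg_mul_sq_norm (V := Rd d) (b := Real.pi)
    (by simpa using Real.pi_pos)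
  have hpi : (Real.pi : ℂ) ≠ 0 := by exact_mod_cast Real.pi_ne_zero
  rw [div_self hpi, Complex.one_cpow] at h
  rw [gaussInt_apply, ← h]
  refine integral_congr_ae (Filter.Eventually.of_forall fun x => ?_)
  simp [evalAt, gauss]

/-- The derivative in the direction `v`, as a derivation of polynomials. -/
def dirDeriv (v : Rd d) : Derivation ℂ (Poly d) (Poly d) :=
  ∑ i, (C (v i : ℂ) : Poly d) • (pderiv i : Derivation ℂ (Poly d) (Poly d))

/-- The linear form `x ↦ ⟨v, x⟩`. -/
def linForm (v : Rd d) : Poly d := ∑ i, C (v i : ℂ) * X i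

theorem dirDeriv_apply (v : Rd d) (p : Poly d) : dirDeriv v p = ∑ i, C (v i : ℂ) * pderiv i p := by
  unfold dirDeriv
  induction (Finset.univ : Finset (Fin d)) using Finset.induction_on with
  | empty => simp
  | insert a s ha ih => rw [Finset.sum_insert ha, Finset.sum_insert ha, Derivation.add_apply, ih,
      Derivation.smul_apply, smul_eq_mul]

theorem dirDeriv_X (v : Rd d) (i : Fin d) : dirDeriv v (X i) = C (v i : ℂ) := by
  rw [dirDeriv_apply, Finset.sum_eq_single i]
  · simp
  · intro j _ hj
    rw [MvPolynomial.pderiv_X_of_ne hj.symm, mul_zero]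
  · simp

theorem evalAt_linForm (v x : Rd d) : evalAt (linForm v) x = ((inner ℝ v x : ℝ) : ℂ) := by
  simp [linForm, evalAt_sum, PiLp.inner_apply, mul_comm]

theorem dirDeriv_linForm (v : Rd d) : dirDeriv v (linForm v) = C ((‖v‖ ^ 2 : ℝ) : ℂ) := by
  rw [linForm, map_sum, EuclideanSpace.real_norm_sq_eq, Complex.ofReal_sum, map_sum]
  refine Finset.sum_congr rfl fun i _ => ?_
  rw [← MvPolynomial.smul_eq_C_mul, Derivation.map_smul, dirDeriv_X, MvPolynomial.smul_eq_C_mul,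
    ← map_mul]
  push_cast
  ring_nf

theorem hasLineDerivAt_evalAt (p : Poly d) (x v : Rd d) :
    HasLineDerivAt ℝ (evalAt p) (evalAt (dirDeriv v p) x) x v := by
  induction p using MvPolynomial.induction_on with
  | C a =>
    have : dirDeriv v (C a) = 0 := MvPolynomial.derivation_C _ _
    rw [this]
    simpa [HasLineDerivAt, evalAt] using hasDerivAt_const (0 : ℝ) a
  | add p q hp hq =>
    have := HasDerivAt.add hp hq
    rw [map_add, evalAt_add]
    simpa [HasLineDerivAt, Pi.add_def] using! this
  | mul_X p i hp =>
    have h1 : HasDerivAt (fun t : ℝ => ((x i + t * v i : ℝ) : ℂ)) (v i : ℂ) 0 := by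
      have h2 : HasDerivAt (fun t : ℝ => x i + t * v i) (v i) 0 := by
        simpa using ((hasDerivAt_id (0 : ℝ)).mul_const (v i)).const_add (x i)
      exact h2.ofReal_comp
    have h3 := HasDerivAt.mul hp h1
    rw [Derivation.leibniz, dirDeriv_X]
    unfold HasLineDerivAt
    convert! h3 using 1
    · ext t
      simp
    · simp
      ring

theorem hasLineDerivAt_gauss (x v : Rd d) :
    HasLineDerivAt ℝ gauss (-(2 * Real.pi) * evalAt (linForm v) x * gauss x) x v := by
  have h1 : HasDerivAt (fun t : ℝ => ‖x + t • v‖ ^ 2) (2 * inner ℝ x v) 0 := by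
    have h2 : HasDerivAt (fun t : ℝ => x + t • v) v 0 := by
      simpa using ((hasDerivAt_id (0 : ℝ)).smul_const v).const_add x
    simpa using h2.norm_sq
  have h3 := (h1.const_mul (-Real.pi)).exp.ofReal_comp
  unfold HasLineDerivAt gauss
  convert! h3 using 1
  rw [evalAt_linForm, real_inner_comm]
  simp
  ring

/-- Integration by parts against the Gaussian. -/
theorem gaussInt_dirDeriv (v : Rd d) (p : Poly d) :
    gaussInt d (dirDeriv v p) = 2 * Real.pi * gaussInt d (linForm v * p) := by
  have h := integral_bilinear_hasLineDerivAt_right_eq_neg_left_of_integrable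
    (μ := (volume : Measure (Rd d))) (v := v) (B := ContinuousLinearMap.mul ℝ ℂ)
    (f := evalAt p) (f' := evalAt (dirDeriv v p)) (g := gauss)
    (g' := fun x => -(2 * Real.pi) * evalAt (linForm v) x * gauss x)
    (integrable_evalAt_mul_gauss _)
    (by
      have := (integrable_evalAt_mul_gauss (linForm v * p)).const_mul (-(2 * Real.pi) : ℂ)
      refine this.congr (Filter.Eventually.of_forall fun x => ?_)
      simp
      ring)
    (integrable_evalAt_mul_gauss _) (fun x _ => hasLineDerivAt_evalAt p x v)
    (fun x _ => hasLineDerivAt_gauss x v)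
  simp only [ContinuousLinearMap.mul_apply'] at h
  rw [gaussInt_apply, gaussInt_apply, ← neg_inj, ← h, ← neg_mul (2 * Real.pi : ℂ),
    ← integral_const_mul]
  refine integral_congr_ae (Filter.Eventually.of_forall fun x => ?_)
  simp only [evalAt_mul]
  ring

theorem gaussInt_pderiv (i : Fin d) (p : Poly d) :
    gaussInt d (pderiv i p) = 2 * Real.pi * gaussInt d (X i * p) := by
  have h := gaussInt_dirDeriv (EuclideanSpace.single i (1 : ℝ)) p
  have h1 : dirDeriv (EuclideanSpace.single i (1 : ℝ)) p = pderiv i p := by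
    rw [dirDeriv_apply, Finset.sum_eq_single i]
    · simp
    · intro j _ hj
      simp [hj]
    · simp
  have h2 : linForm (EuclideanSpace.single i (1 : ℝ)) = X i := by
    rw [linForm, Finset.sum_eq_single i]
    · simp
    · intro j _ hj
      simp [hj]
    · simp
  rwa [h1, h2] at h

theorem pderiv_pderiv_comm (i j : Fin d) (p : Poly d) :
    pderiv i (pderiv j p) = pderiv j (pderiv i p) := by
  have h : ⁅(pderiv i : Derivation ℂ (Poly d) (Poly d)),
      (pderiv j : Derivation ℂ (Poly d) (Poly d))⁆ = 0 := by
    refine MvPolynomial.derivation_ext fun k => ?_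
    rw [Derivation.commutator_apply]
    simp only [MvPolynomial.pderiv_X, Pi.single_apply]
    split_ifs <;> simp
  have := congrArg (fun D => D p) h
  simp only [Derivation.commutator_apply, Derivation.coe_zero, Pi.zero_apply] at this
  exact sub_eq_zero.1 this

theorem mem_harmonicPoly {m : ℕ} {p : Poly d} :
    p ∈ harmonicPoly d m ↔ p.IsHomogeneous m ∧ ∑ i, pderiv i (pderiv i p) = 0 := by
  simp [harmonicPoly, MvPolynomial.mem_homogeneousSubmodule, LinearMap.sum_apply]

theorem dirDeriv_mem_harmonicPoly {m : ℕ} {p : Poly d} (hp : p ∈ harmonicPoly d m) (v : Rd d) :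
    dirDeriv v p ∈ harmonicPoly d (m - 1) := by
  rw [mem_harmonicPoly] at hp ⊢
  constructor
  · rw [dirDeriv_apply]
    refine MvPolynomial.IsHomogeneous.sum _ _ _ fun i _ => ?_
    have := hp.1.pderiv (i := i)
    simpa using (MvPolynomial.isHomogeneous_C _ _).mul this
  · have h : ∀ i, pderiv i (pderiv i (dirDeriv v p)) = dirDeriv v (pderiv i (pderiv i p)) := by
      intro i
      simp only [dirDeriv_apply, map_sum, MvPolynomial.pderiv_C_mul]
      refine Finset.sum_congr rfl fun j _ => ?_
      rw [pderiv_pderiv_comm i j, pderiv_pderiv_comm i j]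
    simp_rw [h, ← map_sum, hp.2, map_zero]

theorem evalAt_dirDeriv_self {m : ℕ} {p : Poly d} (hp : p.IsHomogeneous m) (y : Rd d) :
    evalAt (dirDeriv y p) y = m * evalAt p y := by
  have h := congrArg (fun q => evalAt q y) hp.sum_X_mul_pderiv
  simp only [evalAt_sum, evalAt_mul, evalAt_X] at h
  rw [dirDeriv_apply, evalAt_sum]
  simp only [evalAt_mul, evalAt_C]
  rw [h]
  simp [nsmul_eq_mul, evalAt]

/-- Green's identity for the Gaussian: `2 π m E[p q] = ∑ E[∂ᵢp ∂ᵢq]` if `p` is harmonic of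
degree `m`, by Euler's identity and integration by parts. -/
theorem natCast_mul_gaussInt_mul {m : ℕ} {p : Poly d} (hp : p ∈ harmonicPoly d m) (q : Poly d) :
    2 * Real.pi * (m * gaussInt d (p * q)) = ∑ i, gaussInt d (pderiv i p * pderiv i q) := by
  rw [mem_harmonicPoly] at hp
  have h1 : (m : ℂ) * gaussInt d (p * q) = ∑ i, gaussInt d (X i * (pderiv i p * q)) := by
    rw [← map_sum, ← smul_eq_mul, ← map_smul]
    congr 1
    have := hp.1.sum_X_mul_pderiv
    simp_rw [← mul_assoc, ← Finset.sum_mul, this]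
    rw [MvPolynomial.smul_eq_C_mul]
    simp [nsmul_eq_mul, mul_assoc]
  rw [h1, Finset.mul_sum]
  simp_rw [← gaussInt_pderiv, MvPolynomial.pderiv_mul, map_add]
  rw [Finset.sum_add_distrib, ← map_sum, ← Finset.sum_mul, hp.2, zero_mul, map_zero, zero_add]

/-- Harmonic polynomials of different degrees are orthogonal for the Gaussian: the previous identity
is symmetric in `p` and `q` except for the degree on its left-hand side. -/
theorem gaussInt_mul_eq_zero {m n : ℕ} (hmn : m ≠ n) {p q : Poly d} (hp : p ∈ harmonicPoly d m)
    (hq : q ∈ harmonicPoly d n) : gaussInt d (p * q) = 0 := by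
  have h1 := natCast_mul_gaussInt_mul hp q
  have h2 := natCast_mul_gaussInt_mul hq p
  simp_rw [mul_comm q p, mul_comm (pderiv _ q)] at h2
  have h3 : (2 * Real.pi * ((m : ℂ) - n)) * gaussInt d (p * q) = 0 := by
    linear_combination h1 - h2
  refine (mul_eq_zero.1 h3).resolve_left ?_
  have : (m : ℂ) - n ≠ 0 := sub_ne_zero.2 (by exact_mod_cast hmn)
  have := Real.pi_ne_zero
  simp_all

/-- The recursion for the Gaussian moments of a harmonic polynomial against powers of a linear
form. -/
theorem gaussInt_linForm_pow_succ_mul (y : Rd d) (j : ℕ) (p : Poly d) :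
    2 * Real.pi * gaussInt d (linForm y ^ (j + 1) * p) =
      j * (‖y‖ ^ 2 : ℝ) * gaussInt d (linForm y ^ (j - 1) * p) +
        gaussInt d (linForm y ^ j * dirDeriv y p) := by
  rw [pow_succ', mul_assoc (linForm y), ← gaussInt_dirDeriv, Derivation.leibniz, map_add,
    Derivation.leibniz_pow, dirDeriv_linForm, add_comm]
  congr 1
  have : (p • j • linForm y ^ (j - 1) • (C (((‖y‖ ^ 2 : ℝ)) : ℂ) : Poly d)) =
      ((j : ℂ) * (‖y‖ ^ 2 : ℝ)) • (linForm y ^ (j - 1) * p) := by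
    rw [MvPolynomial.smul_eq_C_mul]
    simp only [smul_eq_mul, nsmul_eq_mul, map_mul, map_natCast]
    ring
  rw [this, map_smul, smul_eq_mul]

/-- The Gaussian moments of a harmonic polynomial of degree `m` against `⟨y, x⟩ ^ j`: up to an
explicit constant `‖y‖ ^ (2 l) p(y)` if `j = m + 2 l`, and zero for all other `j`. -/
theorem gaussInt_linForm_pow_mul (y : Rd d) (j : ℕ) : ∀ (m : ℕ) (p : Poly d),
    p ∈ harmonicPoly d m →
    (∀ l, j = m + 2 * l → gaussInt d (linForm y ^ j * p) =
      j.factorial / ((4 * Real.pi) ^ l * l.factorial * (2 * Real.pi) ^ m) * (‖y‖ ^ 2 : ℝ) ^ l *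
        evalAt p y * gaussInt d 1) ∧
    ((∀ l, j ≠ m + 2 * l) → gaussInt d (linForm y ^ j * p) = 0) := by
  have hC : ∀ p : Poly d, p ∈ harmonicPoly d 0 → ∃ c, p = C c := by
    intro p hp
    have h := (mem_harmonicPoly.1 hp).1
    refine ⟨_, MvPolynomial.totalDegree_eq_zero_iff_eq_C.1 ?_⟩
    exact Nat.le_zero.1 h.totalDegree_le
  have hpi : (Real.pi : ℂ) ≠ 0 := by exact_mod_cast Real.pi_ne_zero
  induction j using Nat.strong_induction_on with
  | _ j ih =>
  intro m p hp
  rcases j with _ | j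
  · refine ⟨fun l hl => ?_, fun h => ?_⟩
    · obtain ⟨rfl, rfl⟩ : m = 0 ∧ l = 0 := by omega
      obtain ⟨c, rfl⟩ := hC p hp
      have : (C c : Poly d) = c • 1 := by rw [MvPolynomial.smul_eq_C_mul, mul_one]
      simp [this, evalAt]
    · have h0 := natCast_mul_gaussInt_mul hp 1
      have hm : (m : ℂ) ≠ 0 := by
        have := h 0
        exact_mod_cast (by omega : m ≠ 0)
      simpa [hpi, hm] using h0
  · have hrec := gaussInt_linForm_pow_succ_mul y j p
    refine ⟨fun l hl => ?_, fun h => ?_⟩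
    · have hA : (j : ℂ) * (‖y‖ ^ 2 : ℝ) * gaussInt d (linForm y ^ (j - 1) * p) =
          2 * Real.pi * (2 * l) * (j.factorial / ((4 * Real.pi) ^ l * l.factorial *
            (2 * Real.pi) ^ m) * (‖y‖ ^ 2 : ℝ) ^ l * evalAt p y * gaussInt d 1) := by
        rcases l with _ | l
        · rcases j with _ | j
          · simp
          · have := (ih j (by omega) m p hp).2 (by omega)
            simp [this]
        · obtain rfl : j = m + 2 * l + 1 := by omega
          have := (ih (m + 2 * l) (by omega) m p hp).1 l rfl
          rw [Nat.add_sub_cancel, this, Nat.factorial_succ (m + 2 * l), Nat.factorial_succ l]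
          have : ((l : ℂ) + 1) ≠ 0 := by exact_mod_cast Nat.succ_ne_zero l
          push_cast
          field_simp
          ring
      have hB : gaussInt d (linForm y ^ j * dirDeriv y p) =
          2 * Real.pi * m * (j.factorial / ((4 * Real.pi) ^ l * l.factorial *
            (2 * Real.pi) ^ m) * (‖y‖ ^ 2 : ℝ) ^ l * evalAt p y * gaussInt d 1) := by
        rcases m with _ | m
        · obtain ⟨c, rfl⟩ := hC p hp
          have : dirDeriv y (C c) = 0 := MvPolynomial.derivation_C _ _
          simp [this]
        · have := (ih j (by omega) m _ (dirDeriv_mem_harmonicPoly hp y)).1 l (by omega)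
          rw [this, evalAt_dirDeriv_self (mem_harmonicPoly.1 hp).1]
          push_cast
          field_simp
          ring
      rw [hA, hB] at hrec
      have h2 : (2 * Real.pi : ℂ) ≠ 0 := by simp [hpi]
      refine mul_left_cancel₀ h2 (hrec.trans ?_)
      rw [Nat.factorial_succ, hl]
      push_cast
      ring
    · have hA : (j : ℂ) * (‖y‖ ^ 2 : ℝ) * gaussInt d (linForm y ^ (j - 1) * p) = 0 := by
        rcases j with _ | j
        · simp
        · have := (ih j (by omega) m p hp).2 fun l hl => h (l + 1) (by omega)
          simp [this]
      have hB : gaussInt d (linForm y ^ j * dirDeriv y p) = 0 := by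
        rcases m with _ | m
        · obtain ⟨c, rfl⟩ := hC p hp
          have : dirDeriv y (C c) = 0 := MvPolynomial.derivation_C _ _
          simp [this]
        · exact (ih j (by omega) m _ (dirDeriv_mem_harmonicPoly hp y)).2
            fun l hl => h l (by omega)
      rw [hA, hB] at hrec
      simpa [hpi] using hrec

end Gaussian

/-! ### Integration over the sphere -/

section Sphere

open MvPolynomial (pderiv X C)

variable {d : ℕ} [NeZero d]

instance nontrivialRd : Nontrivial (Rd d) :=
  Module.nontrivial_of_finrank_pos (R := ℝ) (by
    rw [finrank_euclideanSpace_fin]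
    exact Nat.pos_of_ne_zero (NeZero.ne d))

instance isProbabilityMeasure_sphereProb : IsProbabilityMeasure (sphereProb d) := by
  refine ⟨?_⟩
  have h0 : (volume : Measure (Rd d)).toSphere Set.univ ≠ 0 := by
    rw [Ne, Measure.measure_univ_eq_zero]
    exact Measure.toSphere_ne_zero _
  rw [sphereProb, Measure.smul_apply, smul_eq_mul]
  exact ENNReal.inv_mul_cancel h0 (measure_ne_top _ _)

theorem continuous_integrable_sphere {E : Type*} [NormedAddCommGroup E] {f : Sph d → E}
    (hf : Continuous f) : Integrable f (sphereProb d) :=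
  hf.integrable_of_hasCompactSupport (HasCompactSupport.of_compactSpace f)

/-- The radial moment `∫ ‖x‖ ^ D exp (-π ‖x‖²) dx`. -/
def polarConst (d D : ℕ) : ℝ := ∫ x : Rd d, ‖x‖ ^ D * Real.exp (-Real.pi * ‖x‖ ^ 2)

/-- Integration in polar coordinates of a function with separated variables. -/
theorem integral_polar (F : Rd d → ℂ) (f : Sph d → ℂ) (g : ℝ → ℂ)
    (h : ∀ r : ℝ, 0 < r → ∀ ζ : Sph d, F (r • (ζ : Rd d)) = f ζ * g r) :
    ∫ x, F x = (∫ ζ, f ζ ∂(volume : Measure (Rd d)).toSphere) *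
      ∫ r : Set.Ioi (0 : ℝ), g r ∂(Measure.volumeIoiPow (Module.finrank ℝ (Rd d) - 1)) := by
  rw [← integral_prod_mul f (fun r : Set.Ioi (0 : ℝ) => g r)]
  have h1 := (volume : Measure (Rd d)).measurePreserving_homeomorphUnitSphereProd.integral_comp
    (Homeomorph.measurableEmbedding _) (fun p : Sph d × Set.Ioi (0 : ℝ) => f p.1 * g p.2)
  rw [← h1]
  have h2 : ∫ x, F x = ∫ x : ({0}ᶜ : Set (Rd d)), F x ∂((volume : Measure (Rd d)).comap (↑)) := by
    rw [integral_subtype_comap (measurableSet_singleton _).compl F, restrict_compl_singleton]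
  rw [h2]
  refine integral_congr_ae (Filter.Eventually.of_forall fun x => ?_)
  have hx : 0 < ‖(x : Rd d)‖ := norm_pos_iff.2 x.2
  have h3 := h ‖(x : Rd d)‖ hx ((homeomorphUnitSphereProd (Rd d) x).1)
  rw [homeomorphUnitSphereProd_apply_fst_coe, smul_smul, mul_inv_cancel₀ hx.ne', one_smul] at h3
  simp only [homeomorphUnitSphereProd_apply_snd_coe]
  exact h3

theorem integral_mul_gauss_of_homogeneous {f : Rd d → ℂ} {D : ℕ}
    (hf : ∀ r : ℝ, 0 < r → ∀ ζ : Sph d, f (r • (ζ : Rd d)) = (r : ℂ) ^ D * f ζ) :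
    ∫ x, f x * gauss x = polarConst d D * ∫ ζ : Sph d, f ζ ∂(sphereProb d) := by
  have hn : ∀ r : ℝ, 0 < r → ∀ ζ : Sph d, ‖r • (ζ : Rd d)‖ = r := fun r hr ζ => by
    simp [norm_smul, abs_of_pos hr]
  set g : ℝ → ℂ := fun r => (r : ℂ) ^ D * ((Real.exp (-Real.pi * r ^ 2) : ℝ) : ℂ) with hg
  have h1 := integral_polar (fun x => f x * gauss x) (fun ζ => f ζ) g fun r hr ζ => by
    simp only [hg, hf r hr, gauss, hn r hr]
    ring
  have h2 := integral_polar (fun x : Rd d => ((‖x‖ ^ D * Real.exp (-Real.pi * ‖x‖ ^ 2) : ℝ) : ℂ))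
    (fun _ => 1) g fun r hr ζ => by
    simp only [hg, hn r hr]
    push_cast
    ring
  rw [h1, polarConst, ← integral_complex_ofReal, h2, sphereProb, integral_smul_measure]
  have h0 : (volume : Measure (Rd d)).toSphere.real Set.univ ≠ 0 := by
    rw [Ne, measureReal_eq_zero_iff, Measure.measure_univ_eq_zero]
    exact Measure.toSphere_ne_zero _
  simp only [integral_const, mul_one, ENNReal.toReal_inv, Complex.real_smul]
  change _ = _ * (((((volume : Measure (Rd d)).toSphere.real Set.univ)⁻¹ : ℝ) : ℂ) * _)
  have h0' : (((volume : Measure (Rd d)).toSphere.real Set.univ : ℝ) : ℂ) ≠ 0 := by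
    exact_mod_cast h0
  push_cast
  field_simp

theorem polarConst_pos (D : ℕ) : 0 < polarConst d D := by
  obtain ⟨v, hv⟩ := exists_ne (0 : Rd d)
  refine integral_pos_of_integrable_nonneg_nonzero (x := v) (by fun_prop)
    (integrable_norm_pow_mul_gaussian D) (fun x => by positivity) ?_
  have := norm_pos_iff.2 hv
  positivity

theorem gaussInt_eq_sphere {p : Poly d} {D : ℕ} (hp : p.IsHomogeneous D) :
    gaussInt d p = polarConst d D * ∫ ζ : Sph d, evalAt p ζ ∂(sphereProb d) :=
  integral_mul_gauss_of_homogeneous fun r _ ζ => evalAt_homogeneous hp r ζ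

/-- The polynomial `‖x‖²`. -/
def normSqPoly (d : ℕ) : Poly d := ∑ i, X i * X i

/-- The recursion for the radial moments, by integrating `‖x‖² ‖x‖^(2j)` by parts. -/
theorem polarConst_even_succ (j : ℕ) :
    polarConst d (2 * (j + 1)) = (2 * j + d) / (2 * Real.pi) * polarConst d (2 * j) := by
  have hN : (normSqPoly d).IsHomogeneous 2 :=
    MvPolynomial.IsHomogeneous.sum _ _ _ fun i _ =>
      (MvPolynomial.isHomogeneous_X _ _).mul (MvPolynomial.isHomogeneous_X _ _)
  have hNe : ∀ ζ : Sph d, evalAt (normSqPoly d) ζ = 1 := by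
    intro ζ
    have h1 : ‖(ζ : Rd d)‖ ^ 2 = 1 := by simp
    rw [EuclideanSpace.real_norm_sq_eq] at h1
    simp only [normSqPoly, evalAt_sum, evalAt_mul, evalAt_X]
    have h2 := congrArg (fun r : ℝ => (r : ℂ)) h1
    simp only [Complex.ofReal_sum, Complex.ofReal_pow, Complex.ofReal_one] at h2
    rw [← h2]
    exact Finset.sum_congr rfl fun i _ => by ring
  have hI : ∀ l, gaussInt d (normSqPoly d ^ l) = polarConst d (2 * l) := by
    intro l
    rw [gaussInt_eq_sphere (hN.pow l)]
    simp [hNe]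
  have h1 : 2 * Real.pi * gaussInt d (normSqPoly d ^ (j + 1)) =
      (2 * j + d) * gaussInt d (normSqPoly d ^ j) := by
    have h2 : ∀ i : Fin d, 2 * Real.pi * gaussInt d (X i * (X i * normSqPoly d ^ j)) =
        gaussInt d (normSqPoly d ^ j) + gaussInt d (X i * pderiv i (normSqPoly d ^ j)) := by
      intro i
      rw [← gaussInt_pderiv, MvPolynomial.pderiv_mul, MvPolynomial.pderiv_X_self, one_mul, map_add]
    have h3 : normSqPoly d ^ (j + 1) = ∑ i, X i * (X i * normSqPoly d ^ j) := by
      rw [pow_succ', normSqPoly, Finset.sum_mul]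
      simp_rw [mul_assoc]
    rw [h3, map_sum, Finset.mul_sum]
    simp_rw [h2]
    have h5 : ∑ i, gaussInt d (X i * pderiv i (normSqPoly d ^ j)) =
        2 * j * gaussInt d (normSqPoly d ^ j) := by
      rw [← map_sum, (hN.pow j).sum_X_mul_pderiv, map_nsmul]
      simp
    rw [Finset.sum_add_distrib, h5]
    simp
    ring
  rw [hI, hI] at h1
  have hpi := Real.pi_ne_zero
  field_simp
  have h4 : ((2 * Real.pi * polarConst d (2 * (j + 1)) : ℝ) : ℂ) =
    (((2 * j + d) * polarConst d (2 * j) : ℝ) : ℂ) := by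
    push_cast
    exact h1
  have h5 := Complex.ofReal_injective h4
  linarith

end Sphere

/-! ### Bessel series and plane waves on the sphere -/

/-- The coefficient `1 / (l! (k)_l)` of the normalised Bessel series, where
`(k)_l = k (k + 1) ⋯ (k + l - 1)`. -/
def besselCoeff (k : ℝ) (l : ℕ) : ℝ := ((l.factorial : ℝ) * ∏ i ∈ Finset.range l, (k + i))⁻¹

/-- The series `J_k(x) = ∑ x^l / (l! (k)_l)`, which is `₀F₁(; k; x)`. -/
def besselSeries (k : ℝ) (x : ℂ) : ℂ := ∑' l : ℕ, (besselCoeff k l : ℂ) * x ^ l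

theorem prod_pos_of_pos {k : ℝ} (hk : 0 < k) (l : ℕ) : 0 < ∏ i ∈ Finset.range l, (k + i) :=
  Finset.prod_pos fun _ _ => by positivity

theorem besselCoeff_pos {k : ℝ} (hk : 0 < k) (l : ℕ) : 0 < besselCoeff k l := by
  have := prod_pos_of_pos hk l
  unfold besselCoeff
  positivity

theorem besselCoeff_le {k : ℝ} (hk : 1 ≤ k) (l : ℕ) :
    besselCoeff k l ≤ ((l.factorial : ℝ) * l.factorial)⁻¹ := by
  have h : (l.factorial : ℝ) ≤ ∏ i ∈ Finset.range l, (k + i) := by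
    rw [← Finset.prod_range_add_one_eq_factorial]
    push_cast
    refine Finset.prod_le_prod (fun _ _ => by positivity) fun i _ => by linarith
  unfold besselCoeff
  gcongr

section Sphere

open MvPolynomial (pderiv X C)

variable {d : ℕ} [NeZero d]

theorem polarConst_even_add (m l : ℕ) :
    polarConst d (2 * (m + l)) * Real.pi ^ l =
      polarConst d (2 * m) * ∏ i ∈ Finset.range l, ((d : ℝ) / 2 + m + i) := by
  have hpi := Real.pi_ne_zero
  induction l with
  | zero => simp
  | succ l ih =>
    rw [Finset.prod_range_succ, ← mul_assoc, ← ih, ← add_assoc, polarConst_even_succ]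
    push_cast
    field_simp
    ring

/-- The constant in the Funk–Hecke formula for plane waves. -/
def waveConst (d m : ℕ) : ℂ := (((2 * Real.pi) ^ m * polarConst d (2 * m) : ℝ) : ℂ)⁻¹

/-- The moments of a harmonic polynomial on the sphere, by dividing the Gaussian moments by the
radial ones. -/
theorem integral_inner_pow_mul {m : ℕ} {p : Poly d} (hp : p ∈ harmonicPoly d m) (y : Rd d)
    (l : ℕ) :
    ∫ ζ : Sph d, ((inner ℝ y (ζ : Rd d) : ℝ) : ℂ) ^ (m + 2 * l) * evalAt p ζ ∂(sphereProb d) =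
      (m + 2 * l).factorial * (waveConst d m * evalAt p y *
        (besselCoeff (d / 2 + m) l * ((‖y‖ ^ 2 : ℝ) / 4 : ℂ) ^ l)) := by
  have hL : (linForm y).IsHomogeneous 1 :=
    MvPolynomial.IsHomogeneous.sum _ _ _ fun i _ => by
      simpa using (MvPolynomial.isHomogeneous_C _ _).mul (MvPolynomial.isHomogeneous_X ℂ i)
  have h1 := gaussInt_eq_sphere ((hL.pow (m + 2 * l)).mul (mem_harmonicPoly.1 hp).1)
  rw [(gaussInt_linForm_pow_mul y (m + 2 * l) m p hp).1 l rfl, gaussInt_one] at h1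
  simp only [evalAt_mul, evalAt_pow, evalAt_linForm] at h1
  rw [show 1 * (m + 2 * l) + m = 2 * (m + l) by ring] at h1
  have h2 := congrArg (fun r : ℝ => (r : ℂ)) (polarConst_even_add (d := d) m l)
  have hc := polarConst_pos (d := d) (2 * (m + l))
  have hc' : (polarConst d (2 * (m + l)) : ℂ) ≠ 0 := by exact_mod_cast hc.ne'
  have hc2 : (polarConst d (2 * m) : ℂ) ≠ 0 := by exact_mod_cast (polarConst_pos (2 * m)).ne'
  have hd : (0 : ℝ) < d := by exact_mod_cast Nat.pos_of_ne_zero (NeZero.ne d)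
  have hP := prod_pos_of_pos (k := (d : ℝ) / 2 + m) (by positivity) l
  have hpi : (Real.pi : ℂ) ≠ 0 := by exact_mod_cast Real.pi_ne_zero
  have hl : (l.factorial : ℂ) ≠ 0 := by exact_mod_cast l.factorial_ne_zero
  refine mul_left_cancel₀ hc' (h1.symm.trans ?_)
  rw [waveConst, besselCoeff]
  have hP' : ((∏ i ∈ Finset.range l, ((d : ℝ) / 2 + m + i) : ℝ) : ℂ) ≠ 0 := by
    exact_mod_cast hP.ne'
  generalize (∏ i ∈ Finset.range l, ((d : ℝ) / 2 + m + i)) = Q at *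
  simp only [Complex.ofReal_mul, Complex.ofReal_pow] at h2
  push_cast
  have h3 : (polarConst d (2 * (m + l)) : ℂ) = polarConst d (2 * m) * Q / Real.pi ^ l := by
    rw [eq_div_iff (by positivity), h2]
  rw [h3]
  field_simp
  rw [div_pow, mul_pow]
  field_simp

theorem integral_inner_pow_mul_eq_zero {m : ℕ} {p : Poly d} (hp : p ∈ harmonicPoly d m) (y : Rd d)
    {j : ℕ} (hj : ∀ l, j ≠ m + 2 * l) :
    ∫ ζ : Sph d, ((inner ℝ y (ζ : Rd d) : ℝ) : ℂ) ^ j * evalAt p ζ ∂(sphereProb d) = 0 := by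
  have hL : (linForm y).IsHomogeneous 1 :=
    MvPolynomial.IsHomogeneous.sum _ _ _ fun i _ => by
      simpa using (MvPolynomial.isHomogeneous_C _ _).mul (MvPolynomial.isHomogeneous_X ℂ i)
  have h1 := gaussInt_eq_sphere ((hL.pow j).mul (mem_harmonicPoly.1 hp).1)
  rw [(gaussInt_linForm_pow_mul y j m p hp).2 hj] at h1
  simp only [evalAt_mul, evalAt_pow, evalAt_linForm] at h1
  have hc' : (polarConst d (1 * j + m) : ℂ) ≠ 0 := by exact_mod_cast (polarConst_pos _).ne'
  exact (mul_eq_zero.1 h1.symm).resolve_left hc'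

/-- The Funk–Hecke formula: a plane wave integrated over the sphere against a harmonic
polynomial. -/
theorem integral_exp_inner_mul {m : ℕ} {p : Poly d} (hp : p ∈ harmonicPoly d m) (y : Rd d)
    (z : ℂ) :
    ∫ ζ : Sph d, Complex.exp (z * (inner ℝ y (ζ : Rd d) : ℝ)) * evalAt p ζ ∂(sphereProb d) =
      waveConst d m * z ^ m * evalAt p y *
        besselSeries (d / 2 + m) (z ^ 2 * (‖y‖ ^ 2 : ℝ) / 4) := by
  obtain ⟨M, hM⟩ : ∃ M, ∀ ζ : Sph d, ‖evalAt p (ζ : Rd d)‖ ≤ M := by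
    obtain ⟨M, hM⟩ := (isCompact_univ (X := Sph d)).exists_bound_of_continuousOn
      (f := fun ζ => evalAt p (ζ : Rd d))
      ((continuous_evalAt p).comp continuous_subtype_val).continuousOn
    exact ⟨M, fun ζ => hM ζ trivial⟩
  have hcont : Continuous fun ζ : Sph d => evalAt p (ζ : Rd d) :=
    (continuous_evalAt p).comp continuous_subtype_val
  -- Expand the exponential; only the powers `j = m + 2 l` contribute.
  have h1 : HasSum (fun j : ℕ => ∫ ζ : Sph d, z ^ j / j.factorial *
      (((inner ℝ y (ζ : Rd d) : ℝ) : ℂ) ^ j * evalAt p ζ) ∂(sphereProb d))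
      (∫ ζ : Sph d, Complex.exp (z * (inner ℝ y (ζ : Rd d) : ℝ)) * evalAt p ζ
        ∂(sphereProb d)) := by
    refine hasSum_integral_of_dominated_convergence
      (fun j _ => (‖z‖ * ‖y‖) ^ j / j.factorial * M) (fun j => ?_) (fun j => ?_) ?_ ?_ ?_
    · refine Continuous.aestronglyMeasurable ?_
      fun_prop
    · refine Filter.Eventually.of_forall fun ζ => ?_
      rw [norm_mul, norm_div, norm_mul, norm_pow, norm_pow, Complex.norm_real, Complex.norm_natCast,
        div_mul_eq_mul_div, div_mul_eq_mul_div, mul_pow, ← mul_assoc]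
      have h2 : ‖inner ℝ y (ζ : Rd d)‖ ≤ ‖y‖ := by
        simpa using norm_inner_le_norm (𝕜 := ℝ) y (ζ : Rd d)
      have h0 : (0 : ℝ) ≤ M := (norm_nonneg _).trans (hM ζ)
      gcongr
      exact hM ζ
    · exact Filter.Eventually.of_forall fun ζ =>
        (Real.summable_pow_div_factorial _).mul_right _
    · exact integrable_const _
    · refine Filter.Eventually.of_forall fun ζ => ?_
      have h2 := (NormedSpace.expSeries_div_hasSum_exp (𝔸 := ℂ)
        (z * (inner ℝ y (ζ : Rd d) : ℝ))).mul_right (evalAt p (ζ : Rd d))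
      rw [← Complex.exp_eq_exp_ℂ] at h2
      convert! h2 using 2 with j
      rw [mul_pow]
      ring
  simp_rw [integral_const_mul] at h1
  have hinj : Function.Injective fun l : ℕ => m + 2 * l := fun a b h => by
    simp only at h
    omega
  rw [← hinj.hasSum_iff fun j hj => by
    rw [integral_inner_pow_mul_eq_zero hp y fun l hl => hj ⟨l, hl.symm⟩, mul_zero]] at h1
  rw [← h1.tsum_eq, besselSeries, ← tsum_mul_left]
  refine tsum_congr fun l => ?_
  have hf : ((m + 2 * l).factorial : ℂ) ≠ 0 := by exact_mod_cast Nat.factorial_ne_zero _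
  simp only [Function.comp_apply]
  rw [integral_inner_pow_mul hp y l]
  field_simp
  push_cast
  rw [pow_add, pow_mul, div_pow, div_pow, mul_pow]
  ring

end Sphere

/-! ### Voronoi-type summation for Bessel series -/

section Voronoi

variable {a b : ℕ+ → ℂ}

/-- The sequence grows at most polynomially. -/
def PolyBounded (a : ℕ+ → ℂ) : Prop := ∃ (D : ℝ) (A : ℕ), 0 ≤ D ∧ ∀ n, ‖a n‖ ≤ D * (n : ℝ) ^ A

/-- The exponential series `∑ a_n n^l exp (-π n t)`. -/
def expSum (a : ℕ+ → ℂ) (l : ℕ) (t : ℝ) : ℂ :=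
  ∑' n : ℕ+, a n * (n : ℂ) ^ l * Complex.exp (-Real.pi * n * t)

theorem summable_pow_mul_exp (A : ℕ) {r : ℝ} (hr : 0 < r) :
    Summable fun n : ℕ+ => (n : ℝ) ^ A * Real.exp (-r * n) :=
  (Real.summable_pow_mul_exp_neg_nat_mul A hr).comp_injective PNat.coe_injective

theorem PolyBounded.mul_pow (ha : PolyBounded a) (l : ℕ) :
    PolyBounded fun n => a n * (n : ℂ) ^ l := by
  obtain ⟨D, A, hD, h⟩ := ha
  refine ⟨D, A + l, hD, fun n => ?_⟩
  rw [norm_mul, norm_pow, Complex.norm_natCast, pow_add, ← mul_assoc]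
  gcongr
  exact h n

theorem PolyBounded.summable_norm_mul_exp (ha : PolyBounded a) {r : ℝ} (hr : 0 < r) :
    Summable fun n : ℕ+ => ‖a n‖ * Real.exp (-r * n) := by
  obtain ⟨D, A, hD, h⟩ := ha
  refine Summable.of_nonneg_of_le (fun _ => by positivity) (fun n => ?_)
    ((summable_pow_mul_exp A hr).mul_left D)
  rw [← mul_assoc]
  gcongr
  exact h n

theorem norm_exp_neg (n : ℕ+) (t : ℝ) :
    ‖Complex.exp (-Real.pi * n * t)‖ = Real.exp (-(Real.pi * t) * n) := by
  rw [Complex.norm_exp]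
  congr 1
  have : (-Real.pi * n * t : ℂ) = ((-(Real.pi * t) * n : ℝ) : ℂ) := by
    push_cast
    ring
  rw [this, Complex.ofReal_re]

theorem hasDerivAt_expSum (ha : PolyBounded a) (l : ℕ) {t : ℝ} (ht : 0 < t) :
    HasDerivAt (expSum a l) (-Real.pi * expSum a (l + 1) t) t := by
  have hpi := Real.pi_pos
  have h := hasDerivAt_tsum_of_isPreconnected
    (g := fun (n : ℕ+) (x : ℝ) => a n * (n : ℂ) ^ l * Complex.exp (-Real.pi * n * x))
    (g' := fun (n : ℕ+) (x : ℝ) =>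
      -Real.pi * (a n * (n : ℂ) ^ (l + 1) * Complex.exp (-Real.pi * n * x)))
    (u := fun n : ℕ+ => Real.pi *
      (‖a n * (n : ℂ) ^ (l + 1)‖ * Real.exp (-(Real.pi * (t / 2)) * n)))
    (t := Set.Ioi (t / 2)) (y₀ := t) (y := t)
    (((ha.mul_pow (l + 1)).summable_norm_mul_exp (by positivity)).mul_left _)
    isOpen_Ioi isPreconnected_Ioi
    (fun n x _ => by
      have h1 : HasDerivAt (fun x : ℝ => (-Real.pi * n * (x : ℂ))) (-Real.pi * n * 1) x :=
        (HasDerivAt.ofReal_comp (hasDerivAt_id x)).const_mul _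
      have h2 := (h1.cexp).const_mul (a n * (n : ℂ) ^ l)
      convert! h2 using 1
      ring)
    (fun n x hx => by
      rw [norm_mul, norm_mul _ (Complex.exp _), norm_exp_neg, norm_neg, Complex.norm_real,
        Real.norm_of_nonneg hpi.le]
      have hx' : t / 2 ≤ x := hx.le
      gcongr)
    (by simp [ht]) ?_ (by simp [ht])
  · rw [tsum_mul_left] at h
    exact h
  · refine Summable.of_norm (((ha.mul_pow l).summable_norm_mul_exp
      (r := Real.pi * t) (by positivity)).congr fun n => ?_)
    rw [norm_mul _ (Complex.exp _), norm_exp_neg]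

/-- The coefficients, up to normalisation, that arise by differentiating `t ^ (-k) g(1/t)` `l`
times: that of `t ^ (-k - l - j) g^(j)(1/t)`. -/
def invCoeff (k : ℝ) (l j : ℕ) : ℝ :=
  (-1) ^ j * l.choose j * ((∏ i ∈ Finset.range l, (k + i)) / ∏ i ∈ Finset.range j, (k + i)) *
    (Real.pi ^ j / Real.pi ^ l)

theorem invCoeff_succ_zero (k : ℝ) (l : ℕ) :
    invCoeff k (l + 1) 0 = (k + l) / Real.pi * invCoeff k l 0 := by
  simp [invCoeff, Finset.prod_range_succ, pow_succ]
  ring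

theorem invCoeff_succ_succ {k : ℝ} (hk : 0 < k) (l j : ℕ) :
    invCoeff k (l + 1) (j + 1) =
      (k + l + (j + 1)) / Real.pi * invCoeff k l (j + 1) - invCoeff k l j := by
  have h1 := prod_pos_of_pos hk j
  have h2 := prod_pos_of_pos hk l
  have h3 : 0 < k + j := by positivity
  have hpi := Real.pi_pos
  have h4 : (l.choose (j + 1) : ℝ) * (j + 1) = l.choose j * (l - j) := by
    rcases le_or_gt j l with h | h
    · have := Nat.choose_succ_right_eq l j
      rw [← Nat.cast_sub h]
      exact_mod_cast this
    · simp [Nat.choose_eq_zero_of_lt h, Nat.choose_eq_zero_of_lt (h.trans (Nat.lt_succ_self j))]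
  unfold invCoeff
  rw [Nat.choose_succ_succ, Finset.prod_range_succ, Finset.prod_range_succ _ j]
  generalize (∏ i ∈ Finset.range j, (k + i)) = Q at *
  generalize (∏ i ∈ Finset.range l, (k + i)) = R at *
  push_cast
  field_simp
  simp only [pow_succ]
  linear_combination Real.pi ^ 2 * Real.pi ^ j * Real.pi ^ l * (-1) ^ j * h4

theorem invCoeff_eq_zero (k : ℝ) {l j : ℕ} (h : l < j) : invCoeff k l j = 0 := by
  simp [invCoeff, Nat.choose_eq_zero_of_lt h]

/-- The transformation behaviour of the derivatives of an exponential series with a functional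
equation under `t ↦ 1/t`. -/
theorem expSum_eq_sum_invCoeff (ha : PolyBounded a) (hb : PolyBounded b) {k : ℝ} (hk : 0 < k)
    (hab : ∀ t : ℝ, 0 < t → expSum a 0 t = ((t ^ (-k) : ℝ) : ℂ) * expSum b 0 t⁻¹) (l : ℕ) :
    ∀ t : ℝ, 0 < t → expSum a l t = ∑ j ∈ Finset.range (l + 1),
      (invCoeff k l j : ℂ) * (((t ^ (-(k + l + j)) : ℝ) : ℂ) * expSum b j t⁻¹) := by
  have hpi : (Real.pi : ℂ) ≠ 0 := by exact_mod_cast Real.pi_ne_zero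
  induction l with
  | zero =>
    intro t ht
    simp [hab t ht, invCoeff]
  | succ l ih =>
    intro t ht
    have hder : ∀ j : ℕ, HasDerivAt
        (fun t : ℝ => ((t ^ (-(k + l + j)) : ℝ) : ℂ) * expSum b j t⁻¹)
        (-(k + l + j) * (((t ^ (-(k + (l + 1 : ℕ) + j)) : ℝ) : ℂ) * expSum b j t⁻¹) +
          Real.pi * (((t ^ (-(k + (l + 1 : ℕ) + (j + 1 : ℕ))) : ℝ) : ℂ) *
            expSum b (j + 1) t⁻¹)) t := by
      intro j
      have h1 := ((Real.hasDerivAt_rpow_const (p := -(k + l + j)) (Or.inl ht.ne')).ofReal_comp)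
      have h2 := (hasDerivAt_expSum hb j (inv_pos.2 ht)).scomp t (hasDerivAt_inv ht.ne')
      convert! h1.mul h2 using 1
      rw [show -(k + (l + 1 : ℕ) + j) = -(k + l + j) - 1 by push_cast; ring,
        show -(k + (l + 1 : ℕ) + (j + 1 : ℕ)) = -(k + l + j) + (-2 : ℝ) by push_cast; ring,
        Real.rpow_add ht _ (-2), Real.rpow_neg ht.le 2, Real.rpow_two, Complex.real_smul]
      push_cast
      simp only [Function.comp_apply]
      ring
    have h1 := HasDerivAt.fun_sum (u := Finset.range (l + 1))
      fun j _ => (hder j).const_mul (invCoeff k l j : ℂ)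
    have h2 := (hasDerivAt_expSum ha l ht).congr_of_eventuallyEq
      (Filter.eventuallyEq_of_mem (Ioi_mem_nhds ht) fun x hx => (ih x hx).symm)
    have h3 := h2.unique h1
    have h4 : expSum a (l + 1) t = -(Real.pi : ℂ)⁻¹ * (-Real.pi * expSum a (l + 1) t) := by
      field_simp
    rw [h4, h3, Finset.mul_sum]
    set T : ℕ → ℂ := fun j => ((t ^ (-(k + (l + 1 : ℕ) + j)) : ℝ) : ℂ) * expSum b j t⁻¹ with hT
    have h5 : ∀ j, -(Real.pi : ℂ)⁻¹ * (invCoeff k l j * (-(k + l + j) * T j +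
        Real.pi * T (j + 1))) = ((k + l + j) / Real.pi * invCoeff k l j) * T j -
          invCoeff k l j * T (j + 1) := by
      intro j
      field_simp
      ring
    change ∑ j ∈ Finset.range (l + 1), -(Real.pi : ℂ)⁻¹ * (invCoeff k l j *
      (-(k + l + j) * T j + Real.pi * T (j + 1))) =
        ∑ j ∈ Finset.range (l + 1 + 1), (invCoeff k (l + 1) j : ℂ) * T j
    simp_rw [h5]
    rw [Finset.sum_sub_distrib, Finset.sum_range_succ' (fun j => (invCoeff k (l + 1) j : ℂ) * T j)]
    have h6 : ∑ j ∈ Finset.range (l + 1), ((k + l + j) / Real.pi * invCoeff k l j : ℂ) * T j =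
        ∑ j ∈ Finset.range (l + 1), ((k + l + (j + 1 : ℕ)) / Real.pi * invCoeff k l (j + 1) : ℂ) *
          T (j + 1) + ((k + l) / Real.pi * invCoeff k l 0 : ℂ) * T 0 := by
      have h7 := Finset.sum_range_succ'
        (fun j => ((k + l + j) / Real.pi * invCoeff k l j : ℂ) * T j) (l + 1)
      rw [Finset.sum_range_succ _ (l + 1), invCoeff_eq_zero k (Nat.lt_succ_self l)] at h7
      simpa using h7
    rw [h6, invCoeff_succ_zero]
    simp_rw [invCoeff_succ_succ hk]
    push_cast
    simp_rw [sub_mul]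
    rw [Finset.sum_sub_distrib]
    ring

/-- Absolute convergence of the double series, since `(x n)^l / l!² ≤ exp (ε n) (x / ε)^l / l!`. -/
theorem summable_bessel_prod (ha : PolyBounded a) {k : ℝ} (hk : 1 ≤ k) {t : ℝ} (ht : 0 < t)
    (x : ℂ) : Summable fun p : ℕ+ × ℕ => a p.1 * Complex.exp (-Real.pi * p.1 * t) *
      (besselCoeff k p.2 * (x * p.1) ^ p.2) := by
  have hpi := Real.pi_pos
  obtain ⟨ε, hε⟩ : ∃ ε, ε = Real.pi * t / 2 := ⟨_, rfl⟩
  have hε0 : 0 < ε := by rw [hε]; positivity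
  have h1 := ha.summable_norm_mul_exp hε0
  have h2 := Real.summable_pow_div_factorial (‖x‖ / ε)
  have h3 := h1.mul_of_nonneg h2 (fun _ => by positivity) (fun _ => by positivity)
  refine Summable.of_norm_bounded h3 fun p => ?_
  rw [norm_mul, norm_mul, norm_mul, norm_exp_neg, Complex.norm_real,
    Real.norm_of_nonneg (besselCoeff_pos (by linarith) _).le, norm_pow, norm_mul,
    Complex.norm_natCast]
  have h4 : (ε * p.1) ^ p.2 / (p.2.factorial : ℝ) ≤ Real.exp (ε * p.1) :=
    Real.pow_div_factorial_le_exp _ (by positivity) _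
  have hf : (0 : ℝ) < p.2.factorial := by positivity
  calc ‖a p.1‖ * Real.exp (-(Real.pi * t) * p.1) * (besselCoeff k p.2 * (‖x‖ * p.1) ^ p.2)
      ≤ ‖a p.1‖ * Real.exp (-(Real.pi * t) * p.1) *
          (((p.2.factorial : ℝ) * p.2.factorial)⁻¹ * (‖x‖ * p.1) ^ p.2) := by
        gcongr
        exact besselCoeff_le hk _
    _ = ‖a p.1‖ * Real.exp (-(Real.pi * t) * p.1) *
          (((ε * p.1) ^ p.2 / (p.2.factorial : ℝ)) * ((‖x‖ / ε) ^ p.2 / p.2.factorial)) := by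
        rw [mul_pow, mul_pow, div_pow]
        field_simp
    _ ≤ ‖a p.1‖ * Real.exp (-(Real.pi * t) * p.1) *
          (Real.exp (ε * p.1) * ((‖x‖ / ε) ^ p.2 / p.2.factorial)) := by gcongr
    _ = _ := by
        rw [← mul_assoc, mul_assoc ‖a p.1‖, ← Real.exp_add]
        congr 4
        rw [hε]
        ring

/-- Summation of an exponential series against a Bessel series, in terms of the derivatives of the
exponential series. -/
theorem tsum_mul_besselSeries (ha : PolyBounded a) {k : ℝ} (hk : 1 ≤ k) {t : ℝ} (ht : 0 < t)
    (x : ℂ) :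
    HasSum (fun l : ℕ => x ^ l * (besselCoeff k l * expSum a l t))
      (∑' n : ℕ+, a n * Complex.exp (-Real.pi * n * t) * besselSeries k (x * n)) := by
  have h := summable_bessel_prod ha hk ht x
  have h2 := h.prod_symm.hasSum.prod_fiberwise fun l =>
    (h.prod_symm.prod_factor l).hasSum
  have h3 : ∀ l : ℕ, ∑' n : ℕ+, a n * Complex.exp (-Real.pi * n * t) *
      (besselCoeff k l * (x * n) ^ l) = x ^ l * (besselCoeff k l * expSum a l t) := by
    intro l
    rw [expSum, ← tsum_mul_left, ← tsum_mul_left]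
    refine tsum_congr fun n => ?_
    rw [mul_pow]
    ring
  have h4 : ∑' p : ℕ × ℕ+, a p.2 * Complex.exp (-Real.pi * p.2 * t) *
      (besselCoeff k p.1 * (x * p.2) ^ p.1) =
      ∑' n : ℕ+, a n * Complex.exp (-Real.pi * n * t) * besselSeries k (x * n) := by
    rw [← (Equiv.prodComm ℕ+ ℕ).tsum_eq]
    refine h.tsum_prod.trans (tsum_congr fun n => ?_)
    rw [besselSeries, ← tsum_mul_left]
  rw [← h4]
  exact h2.congr_fun fun l => (h3 l).symm

/-- The summation formula for Bessel series: expanded in powers of `s`, both sides agree termwise by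
the transformation law of the derivatives of `∑ a_n exp (-π n t)`, the right-hand side being the
Cauchy product of its exponential with its Bessel sum. -/
theorem tsum_mul_besselSeries_eq (ha : PolyBounded a) (hb : PolyBounded b) {k : ℝ} (hk : 1 ≤ k)
    (hab : ∀ t : ℝ, 0 < t → expSum a 0 t = ((t ^ (-k) : ℝ) : ℂ) * expSum b 0 t⁻¹)
    {t : ℝ} (ht : 0 < t) (s : ℂ) :
    ∑' n : ℕ+, a n * Complex.exp (-Real.pi * n * t) * besselSeries k (s * n) =
      ((t ^ (-k) : ℝ) : ℂ) * Complex.exp (s / (Real.pi * t)) *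
        ∑' n : ℕ+, b n * Complex.exp (-Real.pi * n * (t⁻¹ : ℝ)) *
          besselSeries k (-s / t ^ 2 * n) := by
  have hk0 : 0 < k := by linarith
  have hpi : (Real.pi : ℂ) ≠ 0 := by exact_mod_cast Real.pi_ne_zero
  have htc : (t : ℂ) ≠ 0 := by exact_mod_cast ht.ne'
  have hB := tsum_mul_besselSeries hb hk (inv_pos.2 ht) (-s / t ^ 2)
  have hE := NormedSpace.expSeries_div_hasSum_exp (𝔸 := ℂ) (s / (Real.pi * t))
  rw [← Complex.exp_eq_exp_ℂ] at hE
  have hA := tsum_mul_besselSeries ha hk ht s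
  have hC := tsum_mul_tsum_eq_tsum_sum_antidiagonal_of_summable_norm
    hE.summable.norm hB.summable.norm
  rw [hE.tsum_eq, hB.tsum_eq] at hC
  rw [mul_assoc, hC, ← hA.tsum_eq, ← tsum_mul_left]
  refine tsum_congr fun l => ?_
  rw [expSum_eq_sum_invCoeff ha hb hk0 hab l t ht, Finset.mul_sum, Finset.mul_sum,
    Finset.mul_sum, ← Finset.Nat.sum_antidiagonal_swap,
    Finset.Nat.sum_antidiagonal_eq_sum_range_succ_mk]
  refine Finset.sum_congr rfl fun j hj => ?_
  obtain ⟨i, rfl⟩ := Nat.exists_eq_add_of_le (Nat.lt_succ_iff.1 (Finset.mem_range.1 hj))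
  have h1 : t ^ (-(k + (j + i : ℕ) + j)) = t ^ (-k) * (t ^ (2 * j + i))⁻¹ := by
    rw [show -(k + (j + i : ℕ) + j) = -k + -((2 * j + i : ℕ) : ℝ) by push_cast; ring,
      Real.rpow_add ht, Real.rpow_neg ht.le (_ : ℕ), Real.rpow_natCast]
  have h2 : besselCoeff k (j + i) * invCoeff k (j + i) j =
      (-1) ^ j * besselCoeff k j * (1 / (Real.pi ^ i * i.factorial)) := by
    have h3 := prod_pos_of_pos hk0 j
    have h4 := prod_pos_of_pos hk0 (j + i)
    have h5 : (((j + i).choose j : ℕ) : ℝ) * j.factorial * i.factorial = (j + i).factorial := by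
      have := Nat.choose_mul_factorial_mul_factorial (Nat.le_add_right j i)
      rw [Nat.add_sub_cancel_left] at this
      exact_mod_cast this
    have h6 := Real.pi_ne_zero
    unfold besselCoeff invCoeff
    rw [← h5]
    have h7 : (((j + i).choose j : ℕ) : ℝ) ≠ 0 := by
      exact_mod_cast (Nat.choose_pos (Nat.le_add_right j i)).ne'
    field_simp
    rw [pow_add]
  have h3 : s ^ (j + i) * (besselCoeff k (j + i) * (invCoeff k (j + i) j *
      (((t ^ (-(k + (j + i : ℕ) + j)) : ℝ) : ℂ) * expSum b j t⁻¹))) =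
      s ^ (j + i) * (((besselCoeff k (j + i) * invCoeff k (j + i) j : ℝ) : ℂ) *
      (((t ^ (-(k + (j + i : ℕ) + j)) : ℝ) : ℂ) * expSum b j t⁻¹)) := by
    push_cast
    ring
  refine h3.trans ?_
  rw [h2, h1]
  simp only [Prod.swap, Nat.add_sub_cancel_left, div_pow, mul_pow, neg_pow s]
  push_cast
  field_simp
  ring

end Voronoi

/-! ### Gaussian regularisation -/

section Mollify

variable {d : ℕ}

theorem norm_gauss (x : Rd d) : ‖gauss x‖ = Real.exp (-Real.pi * ‖x‖ ^ 2) := by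
  rw [gauss, Complex.norm_real, Real.norm_of_nonneg (Real.exp_pos _).le]

theorem norm_gauss_le_one (x : Rd d) : ‖gauss x‖ ≤ 1 := by
  rw [norm_gauss, Real.exp_le_one_iff]
  nlinarith [Real.pi_pos, sq_nonneg ‖x‖]

theorem exists_pow_mul_norm_gauss_le (K : ℕ) {r : ℝ} (hr : 0 < r) :
    ∃ C : ℝ, 0 ≤ C ∧ ∀ x : Rd d, (1 + ‖x‖) ^ K * ‖gauss (r • x)‖ ≤ C := by
  refine ⟨K.factorial * Real.exp (1 + (r ^ 2)⁻¹), by positivity, fun x => ?_⟩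
  have h3 : (1 + ‖x‖) ^ K ≤ K.factorial * Real.exp (1 + ‖x‖) := by
    have := Real.pow_div_factorial_le_exp (1 + ‖x‖) (by positivity) K
    rwa [div_le_iff₀' (by positivity)] at this
  calc (1 + ‖x‖) ^ K * ‖gauss (r • x)‖
      ≤ K.factorial * Real.exp (1 + ‖x‖) * ‖gauss (r • x)‖ := by gcongr
    _ = K.factorial * Real.exp (1 + ‖x‖ + -Real.pi * (r * ‖x‖) ^ 2) := by
        rw [norm_gauss, mul_assoc, ← Real.exp_add, norm_smul, Real.norm_of_nonneg hr.le]
    _ ≤ _ := by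
        refine mul_le_mul_of_nonneg_left (Real.exp_le_exp.2 ?_) (by positivity)
        have h1 : 0 ≤ (r * ‖x‖ - r⁻¹) ^ 2 := sq_nonneg _
        have h2 : (r * ‖x‖ - r⁻¹) ^ 2 = (r * ‖x‖) ^ 2 - 2 * ‖x‖ + (r ^ 2)⁻¹ := by
          field_simp
          ring
        have h4 := norm_nonneg x
        nlinarith [Real.pi_gt_three, sq_nonneg (r * ‖x‖), inv_pos.2 (pow_pos hr 2)]

theorem SchwartzMap.exists_one_add_norm_pow_mul_le (f : 𝓢(Rd d, ℂ)) (K : ℕ) :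
    ∃ C : ℝ, 0 ≤ C ∧ ∀ x, (1 + ‖x‖) ^ K * ‖f x‖ ≤ C := by
  have h := fun x => SchwartzMap.one_add_le_sup_seminorm_apply (𝕜 := ℝ) (m := (K, 0)) (k := K)
    (n := 0) le_rfl le_rfl f x
  simp only [norm_iteratedFDeriv_zero] at h
  exact ⟨_, le_trans (by positivity) (h 0), h⟩

theorem SchwartzMap.integrable_one_add_norm_pow_mul (f : 𝓢(Rd d, ℂ)) (K : ℕ) :
    Integrable fun x => (1 + ‖x‖) ^ K * ‖f x‖ := by
  refine (((f.integrable_pow_mul volume 0).add (f.integrable_pow_mul volume K)).const_mul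
    (2 ^ (K - 1))).mono' (by fun_prop) (Filter.Eventually.of_forall fun x => ?_)
  rw [Real.norm_of_nonneg (by positivity)]
  have := add_pow_le zero_le_one (norm_nonneg x) K
  simp only [Pi.add_apply, pow_zero]
  calc _ ≤ (2 ^ (K - 1) * (1 ^ K + ‖x‖ ^ K)) * ‖f x‖ := by gcongr
    _ = _ := by ring

/-- The convolution of `f` with the Gaussian of width `1 / r`. -/
def mollify (f : 𝓢(Rd d, ℂ)) (r : ℝ) (x : Rd d) : ℂ := ∫ v : Rd d, f (x - r⁻¹ • v) * gauss v

theorem integrable_mollify (f : 𝓢(Rd d, ℂ)) (r : ℝ) (x : Rd d) :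
    Integrable fun v : Rd d => f (x - r⁻¹ • v) * gauss v := by
  obtain ⟨C, hC, h⟩ := SchwartzMap.exists_one_add_norm_pow_mul_le f 0
  refine integrable_mul_gauss (K := C) (N := 0) (by fun_prop) fun v => ?_
  simpa using h (x - r⁻¹ • v)

theorem mollify_eq (f : 𝓢(Rd d, ℂ)) {r : ℝ} (hr : 0 < r) (x : Rd d) :
    mollify f r x = (r : ℂ) ^ d * ∫ y : Rd d, f y * gauss (r • (x - y)) := by
  have h1 := Measure.integral_comp_smul_of_nonneg (volume : Measure (Rd d))
    (fun v => f (x - r⁻¹ • v) * gauss v) r (hR := hr.le)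
  rw [finrank_euclideanSpace_fin] at h1
  simp_rw [smul_smul, inv_mul_cancel₀ hr.ne', one_smul] at h1
  rw [← integral_sub_left_eq_self _ _ x]
  simp_rw [sub_sub_cancel]
  rw [h1, mollify, Complex.real_smul]
  have hr' : (r : ℂ) ≠ 0 := by exact_mod_cast hr.ne'
  push_cast
  field_simp

/-- Decay of the regularisations, uniform in `r ≥ 1`. -/
theorem exists_pow_mul_norm_mollify_le (f : 𝓢(Rd d, ℂ)) (K : ℕ) :
    ∃ C : ℝ, 0 ≤ C ∧ ∀ r : ℝ, 1 ≤ r → ∀ x, (1 + ‖x‖) ^ K * ‖mollify f r x‖ ≤ C := by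
  obtain ⟨C, hC, h⟩ := SchwartzMap.exists_one_add_norm_pow_mul_le f K
  have hI : Integrable fun v : Rd d => ‖((C * (1 + ‖v‖) ^ K : ℝ) : ℂ) * gauss v‖ :=
    (integrable_mul_gauss (K := C) (N := K) (by fun_prop) fun x => by
      rw [Complex.norm_real, Real.norm_of_nonneg (by positivity)]).norm
  refine ⟨∫ v : Rd d, ‖((C * (1 + ‖v‖) ^ K : ℝ) : ℂ) * gauss v‖,
    integral_nonneg fun _ => norm_nonneg _, fun r hr x => ?_⟩
  have h1 : (1 + ‖x‖) ^ K * ‖mollify f r x‖ =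
      ‖∫ v : Rd d, (((1 + ‖x‖) ^ K : ℝ) : ℂ) * (f (x - r⁻¹ • v) * gauss v)‖ := by
    rw [integral_const_mul, norm_mul, Complex.norm_real, Real.norm_of_nonneg (by positivity),
      mollify]
  rw [h1]
  refine norm_integral_le_of_norm_le hI (Filter.Eventually.of_forall fun v => ?_)
  rw [norm_mul, norm_mul, norm_mul, Complex.norm_real, Complex.norm_real,
    Real.norm_of_nonneg (by positivity), Real.norm_of_nonneg (by positivity), ← mul_assoc]
  refine mul_le_mul_of_nonneg_right ?_ (norm_nonneg _)
  have h2 : ‖r⁻¹ • v‖ ≤ ‖v‖ := by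
    rw [norm_smul, norm_inv, Real.norm_of_nonneg (by linarith)]
    exact mul_le_of_le_one_left (norm_nonneg _) (inv_le_one_of_one_le₀ hr)
  have h3 : 1 + ‖x‖ ≤ (1 + ‖x - r⁻¹ • v‖) * (1 + ‖v‖) := by
    have h4 := norm_le_norm_sub_add x (r⁻¹ • v)
    nlinarith [norm_nonneg v, norm_nonneg (x - r⁻¹ • v)]
  calc _ ≤ ((1 + ‖x - r⁻¹ • v‖) * (1 + ‖v‖)) ^ K * ‖f (x - r⁻¹ • v)‖ := by gcongr
    _ = ((1 + ‖x - r⁻¹ • v‖) ^ K * ‖f (x - r⁻¹ • v)‖) * (1 + ‖v‖) ^ K := by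
      rw [mul_pow]
      ring
    _ ≤ _ := by
      gcongr
      exact h _

theorem tendsto_mollify (f : 𝓢(Rd d, ℂ)) (x : Rd d) :
    Filter.Tendsto (fun r => mollify f r x) Filter.atTop (nhds (f x)) := by
  obtain ⟨C, hC, h⟩ := SchwartzMap.exists_one_add_norm_pow_mul_le f 0
  have h1 : f x = ∫ v : Rd d, f x * gauss v := by
    have h2 := gaussInt_one (d := d)
    simp only [gaussInt_apply, evalAt, map_one, one_mul] at h2
    rw [integral_const_mul, h2, mul_one]
  rw [h1]
  refine tendsto_integral_filter_of_dominated_convergence (fun v => ‖(C : ℂ) * gauss v‖)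
    (Filter.Eventually.of_forall fun r => (integrable_mollify f r x).aestronglyMeasurable)
    (Filter.Eventually.of_forall fun r => Filter.Eventually.of_forall fun v => ?_)
    (integrable_mul_gauss (K := C) (N := 0) (by fun_prop) fun v => ?_).norm
    (Filter.Eventually.of_forall fun v => ?_)
  · rw [norm_mul, norm_mul, Complex.norm_real, Real.norm_of_nonneg hC]
    gcongr
    simpa using h (x - r⁻¹ • v)
  · simp [abs_of_nonneg hC]
  · refine Filter.Tendsto.mul_const _ ?_
    have h3 : Filter.Tendsto (fun r : ℝ => x - r⁻¹ • v) Filter.atTop (nhds x) := by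
      simpa using ((tendsto_inv_atTop_zero (𝕜 := ℝ)).smul_const v).const_sub x
    exact (f.continuous.tendsto x).comp h3

theorem continuous_mollify (f : 𝓢(Rd d, ℂ)) (r : ℝ) : Continuous (mollify f r) := by
  obtain ⟨C, hC, h⟩ := SchwartzMap.exists_one_add_norm_pow_mul_le f 0
  refine continuous_of_dominated (bound := fun v => ‖(C : ℂ) * gauss v‖)
    (fun x => (integrable_mollify f r x).aestronglyMeasurable)
    (fun x => Filter.Eventually.of_forall fun v => ?_)
    (integrable_mul_gauss (K := C) (N := 0) (by fun_prop) fun v => ?_).norm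
    (Filter.Eventually.of_forall fun v => by fun_prop)
  · rw [norm_mul, norm_mul, Complex.norm_real, Real.norm_of_nonneg hC]
    gcongr
    simpa using h (x - r⁻¹ • v)
  · simp [abs_of_nonneg hC]

end Mollify

/-! ### The summation formula for Schwartz functions -/

section Annihilation

variable {d : ℕ} {m : ℕ} {p : Poly d} {a b : ℕ+ → ℂ}

theorem evalAt_inv_sqrt_smul (hp : p ∈ harmonicPoly d m) (n : ℕ+) (x : Rd d) :
    evalAt p ((Real.sqrt (n : ℝ))⁻¹ • x) = (((Real.sqrt n)⁻¹ ^ m : ℝ) : ℂ) * evalAt p x := by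
  rw [evalAt_homogeneous (mem_harmonicPoly.1 hp).1]
  push_cast
  rfl

theorem one_le_sqrt_pnat (n : ℕ+) : 1 ≤ Real.sqrt (n : ℝ) :=
  Real.one_le_sqrt.2 (by exact_mod_cast one_le (a := n))

theorem exists_norm_evalAt_sphere_le (p : Poly d) :
    ∃ M : ℝ, 0 ≤ M ∧ ∀ (n : ℕ+) (ζ : Sph d),
      ‖evalAt p ((Real.sqrt (n : ℝ))⁻¹ • (ζ : Rd d))‖ ≤ M := by
  obtain ⟨K, N, hK, h⟩ := exists_norm_evalAt_le p
  refine ⟨K * 2 ^ N, by positivity, fun n ζ => (h _).trans ?_⟩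
  have h1 : (Real.sqrt (n : ℝ))⁻¹ ≤ 1 := inv_le_one_of_one_le₀ (one_le_sqrt_pnat n)
  have h2 : ‖(Real.sqrt (n : ℝ))⁻¹ • (ζ : Rd d)‖ ≤ 1 := by
    rw [norm_smul, norm_inv, Real.norm_of_nonneg (Real.sqrt_nonneg _)]
    simpa using h1
  gcongr
  linarith

variable [NeZero d]

theorem norm_integral_sphere_le {h : Sph d → ℂ} {C : ℝ} (hh : ∀ ζ, ‖h ζ‖ ≤ C) :
    ‖∫ ζ, h ζ ∂(sphereProb d)‖ ≤ C := by
  simpa using norm_integral_le_of_norm_le_const (μ := sphereProb d)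
    (Filter.Eventually.of_forall hh)

/-- A Gaussian centred at `y`, integrated over the sphere of radius `√n` against a harmonic
polynomial: on that sphere it is a multiple of a plane wave with real exponent. -/
theorem integral_gauss_mul (hp : p ∈ harmonicPoly d m) {r : ℝ} (hr : 0 < r) (y : Rd d) (n : ℕ+) :
    ∫ ζ : Sph d, gauss (r • (Real.sqrt (n : ℝ) • (ζ : Rd d) - y)) *
        evalAt p ((Real.sqrt (n : ℝ))⁻¹ • (ζ : Rd d)) ∂(sphereProb d) =
      waveConst d m * (2 * Real.pi) ^ m * evalAt p y *
        ((r : ℂ) ^ (2 * m) *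
          Complex.exp (-((Real.pi * r ^ 2) ^ 2 * ‖y‖ ^ 2 / (Real.pi * (r ^ 2 : ℝ))))) *
        (Complex.exp (-Real.pi * n * (r ^ 2 : ℝ)) *
          besselSeries (d / 2 + m) ((Real.pi * r ^ 2) ^ 2 * ‖y‖ ^ 2 * n)) := by
  have hs := one_le_sqrt_pnat n
  set s := Real.sqrt (n : ℝ) with hs'
  have hss : s ^ 2 = n := Real.sq_sqrt (by positivity)
  have hs0 : (s : ℂ) ≠ 0 := by exact_mod_cast (by positivity : s ≠ 0)
  have hss' : (s : ℂ) ^ 2 = n := by exact_mod_cast congrArg (fun r : ℝ => (r : ℂ)) hss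
  have hrc : (r : ℂ) ≠ 0 := by exact_mod_cast hr.ne'
  have hpi : (Real.pi : ℂ) ≠ 0 := by exact_mod_cast Real.pi_ne_zero
  have h1 : ∀ ζ : Sph d, gauss (r • (s • (ζ : Rd d) - y)) * evalAt p (s⁻¹ • (ζ : Rd d)) =
      ((s : ℂ)⁻¹ ^ m * Complex.exp (-Real.pi * n * (r ^ 2 : ℝ)) *
        Complex.exp (-((Real.pi * r ^ 2) ^ 2 * ‖y‖ ^ 2 / (Real.pi * (r ^ 2 : ℝ))))) *
      (Complex.exp ((2 * Real.pi * r ^ 2 * s : ℂ) * (inner ℝ y (ζ : Rd d) : ℝ)) *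
        evalAt p ζ) := by
    intro ζ
    have hζ : ‖(ζ : Rd d)‖ = 1 := by simp
    have h2 : ‖r • (s • (ζ : Rd d) - y)‖ ^ 2 =
        r ^ 2 * (n - 2 * s * inner ℝ y (ζ : Rd d) + ‖y‖ ^ 2) := by
      rw [norm_smul, mul_pow, norm_sub_sq_real, norm_smul, hζ, mul_one, real_inner_smul_left,
        real_inner_comm, Real.norm_of_nonneg hr.le, Real.norm_of_nonneg (by positivity), hss]
      ring
    rw [evalAt_homogeneous (mem_harmonicPoly.1 hp).1, gauss, h2]
    push_cast
    have h5 : Complex.exp (-Real.pi * (r ^ 2 * (n - 2 * s * (inner ℝ y (ζ : Rd d) : ℝ) +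
        ‖y‖ ^ 2))) = Complex.exp (-Real.pi * n * r ^ 2) *
        Complex.exp (-((Real.pi * r ^ 2) ^ 2 * ‖y‖ ^ 2 / (Real.pi * r ^ 2))) *
        Complex.exp (2 * Real.pi * r ^ 2 * s * (inner ℝ y (ζ : Rd d) : ℝ)) := by
      rw [← Complex.exp_add, ← Complex.exp_add]
      congr 1
      field_simp
      ring
    rw [h5]
    ring
  simp_rw [h1]
  rw [integral_const_mul, integral_exp_inner_mul hp y]
  have h3 : (2 * Real.pi * r ^ 2 * s : ℂ) ^ 2 * (‖y‖ ^ 2 : ℝ) / 4 =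
      (Real.pi * r ^ 2) ^ 2 * ‖y‖ ^ 2 * n := by
    rw [← hss']
    push_cast
    ring
  rw [h3]
  have h4 : (s : ℂ)⁻¹ ^ m * (2 * Real.pi * r ^ 2 * s) ^ m = (2 * Real.pi) ^ m * r ^ (2 * m) := by
    rw [← mul_pow, pow_mul, ← mul_pow]
    congr 1
    field_simp
  linear_combination (Complex.exp (-Real.pi * n * (r ^ 2 : ℝ)) *
        Complex.exp (-((Real.pi * r ^ 2) ^ 2 * ‖y‖ ^ 2 / (Real.pi * (r ^ 2 : ℝ)))) *
        waveConst d m * evalAt p y *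
        besselSeries (d / 2 + m) ((Real.pi * r ^ 2) ^ 2 * ‖y‖ ^ 2 * n)) * h4

/-- A character, integrated over the sphere of radius `√n` against a harmonic polynomial. -/
theorem integral_character_mul (hp : p ∈ harmonicPoly d m) (y : Rd d) (n : ℕ+) :
    Complex.I ^ m * ∫ ζ : Sph d, Complex.exp ((-2 * Real.pi *
        inner ℝ y (Real.sqrt (n : ℝ) • (ζ : Rd d)) : ℝ) * Complex.I) *
        evalAt p ((Real.sqrt (n : ℝ))⁻¹ • (ζ : Rd d)) ∂(sphereProb d) =
      waveConst d m * (2 * Real.pi) ^ m * evalAt p y *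
        besselSeries (d / 2 + m) (-(Real.pi ^ 2 * ‖y‖ ^ 2) * n) := by
  have hs := one_le_sqrt_pnat n
  set s := Real.sqrt (n : ℝ) with hs'
  have hss : s ^ 2 = n := Real.sq_sqrt (by positivity)
  have hs0 : (s : ℂ) ≠ 0 := by exact_mod_cast (by positivity : s ≠ 0)
  have hss' : (s : ℂ) ^ 2 = n := by exact_mod_cast congrArg (fun r : ℝ => (r : ℂ)) hss
  have h1 : ∀ ζ : Sph d, Complex.exp ((-2 * Real.pi * inner ℝ y (s • (ζ : Rd d)) : ℝ) *
      Complex.I) * evalAt p (s⁻¹ • (ζ : Rd d)) = (s : ℂ)⁻¹ ^ m *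
        (Complex.exp ((-2 * Real.pi * s * Complex.I : ℂ) * (inner ℝ y (ζ : Rd d) : ℝ)) *
          evalAt p ζ) := by
    intro ζ
    rw [evalAt_homogeneous (mem_harmonicPoly.1 hp).1, real_inner_smul_right, mul_left_comm]
    push_cast
    congr 3
    ring
  simp_rw [h1]
  rw [integral_const_mul, integral_exp_inner_mul hp y]
  have h3 : (-2 * Real.pi * s * Complex.I : ℂ) ^ 2 * (‖y‖ ^ 2 : ℝ) / 4 =
      -(Real.pi ^ 2 * ‖y‖ ^ 2) * n := by
    rw [← hss']
    push_cast
    linear_combination (Real.pi ^ 2 * s ^ 2 * ‖y‖ ^ 2 : ℂ) * Complex.I_sq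
  rw [h3]
  have h4 : Complex.I ^ m * ((s : ℂ)⁻¹ ^ m * (-2 * Real.pi * s * Complex.I) ^ m) =
      (2 * Real.pi) ^ m := by
    rw [← mul_pow, ← mul_pow]
    congr 1
    field_simp
    linear_combination (-1 : ℂ) * Complex.I_sq
  linear_combination (waveConst d m * evalAt p y *
    besselSeries (d / 2 + m) (-(Real.pi ^ 2 * ‖y‖ ^ 2) * n)) * h4

/-- The summation formula for the Gaussian `r^d exp (-π r² ‖x - y‖²)`. -/
theorem tsum_gauss_eq (hd : 2 ≤ d) (hp : p ∈ harmonicPoly d m) (ha : PolyBounded a)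
    (hb : PolyBounded b)
    (hab : ∀ t : ℝ, 0 < t →
      expSum a 0 t = ((t ^ (-((d : ℝ) / 2 + m)) : ℝ) : ℂ) * expSum b 0 t⁻¹)
    {r : ℝ} (hr : 0 < r) (y : Rd d) :
    ∑' n : ℕ+, a n * ((r : ℂ) ^ d * ∫ ζ : Sph d,
        gauss (r • (Real.sqrt (n : ℝ) • (ζ : Rd d) - y)) *
        evalAt p ((Real.sqrt (n : ℝ))⁻¹ • (ζ : Rd d)) ∂(sphereProb d)) =
      ∑' n : ℕ+, b n * Complex.exp (-Real.pi * n * ((r ^ 2)⁻¹ : ℝ)) *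
        (Complex.I ^ m * ∫ ζ : Sph d, Complex.exp ((-2 * Real.pi *
        inner ℝ y (Real.sqrt (n : ℝ) • (ζ : Rd d)) : ℝ) * Complex.I) *
        evalAt p ((Real.sqrt (n : ℝ))⁻¹ • (ζ : Rd d)) ∂(sphereProb d)) := by
  have hd' : (2 : ℝ) ≤ d := by exact_mod_cast hd
  have hk : (1 : ℝ) ≤ (d : ℝ) / 2 + m := by
    have : (0 : ℝ) ≤ m := by positivity
    linarith
  have hrc : (r : ℂ) ≠ 0 := by exact_mod_cast hr.ne'
  have hpi : (Real.pi : ℂ) ≠ 0 := by exact_mod_cast Real.pi_ne_zero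
  -- The Bessel summation formula at `t = r²` and `s = (π r² ‖y‖)²`.
  have h := tsum_mul_besselSeries_eq ha hb hk hab (pow_pos hr 2)
    ((Real.pi * r ^ 2) ^ 2 * ‖y‖ ^ 2)
  simp_rw [integral_gauss_mul hp hr, integral_character_mul hp]
  have h1 : ∀ n : ℕ+, a n * ((r : ℂ) ^ d * (waveConst d m * (2 * Real.pi) ^ m * evalAt p y *
        ((r : ℂ) ^ (2 * m) *
          Complex.exp (-((Real.pi * r ^ 2) ^ 2 * ‖y‖ ^ 2 / (Real.pi * (r ^ 2 : ℝ))))) *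
        (Complex.exp (-Real.pi * n * (r ^ 2 : ℝ)) *
          besselSeries (d / 2 + m) ((Real.pi * r ^ 2) ^ 2 * ‖y‖ ^ 2 * n)))) =
      (r : ℂ) ^ (d + 2 * m) * (waveConst d m * (2 * Real.pi) ^ m * evalAt p y) *
        Complex.exp (-((Real.pi * r ^ 2) ^ 2 * ‖y‖ ^ 2 / (Real.pi * (r ^ 2 : ℝ)))) *
        (a n * Complex.exp (-Real.pi * n * (r ^ 2 : ℝ)) *
          besselSeries (d / 2 + m) ((Real.pi * r ^ 2) ^ 2 * ‖y‖ ^ 2 * n)) := by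
    intro n
    rw [pow_add]
    ring
  simp_rw [h1]
  rw [tsum_mul_left, h]
  have h2 : (r ^ 2) ^ (-((d : ℝ) / 2 + m)) = (r ^ (d + 2 * m))⁻¹ := by
    rw [← Real.rpow_natCast r 2, ← Real.rpow_mul hr.le, ← Real.rpow_natCast, ← Real.rpow_neg hr.le]
    congr 1
    push_cast
    ring
  have h3 : Complex.exp (-((Real.pi * r ^ 2) ^ 2 * ‖y‖ ^ 2 / (Real.pi * (r ^ 2 : ℝ)))) *
      Complex.exp ((Real.pi * r ^ 2) ^ 2 * ‖y‖ ^ 2 / (Real.pi * (r ^ 2 : ℝ))) = 1 := by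
    rw [← Complex.exp_add, neg_add_cancel, Complex.exp_zero]
  have h4 : (r : ℂ) ^ (d + 2 * m) * (((r ^ (d + 2 * m))⁻¹ : ℝ) : ℂ) = 1 := by
    push_cast
    exact mul_inv_cancel₀ (pow_ne_zero _ hrc)
  rw [h2, ← mul_assoc, ← tsum_mul_left]
  refine tsum_congr fun n => ?_
  have h5 : -((Real.pi * r ^ 2) ^ 2 * ‖y‖ ^ 2 : ℂ) / ((r ^ 2 : ℝ) : ℂ) ^ 2 * n =
      -(Real.pi ^ 2 * ‖y‖ ^ 2) * n := by
    push_cast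
    field_simp
  rw [h5]
  linear_combination ((waveConst d m * (2 * Real.pi) ^ m * evalAt p y) * (b n *
    Complex.exp (-Real.pi * n * ((r ^ 2)⁻¹ : ℝ)) *
      besselSeries (d / 2 + m) (-(Real.pi ^ 2 * ‖y‖ ^ 2) * n))) *
      (Complex.exp (-((Real.pi * r ^ 2) ^ 2 * ‖y‖ ^ 2 / (Real.pi * (r ^ 2 : ℝ)))) *
      Complex.exp ((Real.pi * r ^ 2) ^ 2 * ‖y‖ ^ 2 / (Real.pi * (r ^ 2 : ℝ))) * h4 + h3)

end Annihilation

section Annihilation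

variable {d : ℕ} {m : ℕ} {p : Poly d} {a b : ℕ+ → ℂ}

/-- The integral `∫ F(√n ζ) p(ζ/√n) dζ` over the unit sphere. -/
def sphereInt (p : Poly d) (n : ℕ+) (F : Rd d → ℂ) : ℂ :=
  ∫ ζ : Sph d, F (Real.sqrt (n : ℝ) • (ζ : Rd d)) *
    evalAt p ((Real.sqrt (n : ℝ))⁻¹ • (ζ : Rd d)) ∂(sphereProb d)

theorem continuous_evalAt_sphere (p : Poly d) (n : ℕ+) :
    Continuous fun ζ : Sph d => evalAt p ((Real.sqrt (n : ℝ))⁻¹ • (ζ : Rd d)) :=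
  (continuous_evalAt p).comp (by fun_prop)

theorem norm_sqrt_smul (n : ℕ+) (ζ : Sph d) : ‖Real.sqrt (n : ℝ) • (ζ : Rd d)‖ = Real.sqrt n := by
  rw [norm_smul, Real.norm_of_nonneg (Real.sqrt_nonneg _)]
  simp

variable [NeZero d]

theorem integrable_prod_kernel (f : 𝓢(Rd d, ℂ)) (p : Poly d) (n : ℕ+) {k : Rd d → Sph d → ℂ}
    (hk : Continuous (Function.uncurry k)) (hk1 : ∀ y ζ, ‖k y ζ‖ ≤ 1) :
    Integrable (Function.uncurry fun (y : Rd d) (ζ : Sph d) => f y *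
      (k y ζ * evalAt p ((Real.sqrt (n : ℝ))⁻¹ • (ζ : Rd d))))
      ((volume : Measure (Rd d)).prod (sphereProb d)) := by
  obtain ⟨M, hM, h⟩ := exists_norm_evalAt_sphere_le p
  have h1 : Integrable (fun z : Rd d × Sph d => ‖f z.1‖ * M)
      ((volume : Measure (Rd d)).prod (sphereProb d)) :=
    f.integrable.norm.mul_prod (integrable_const M)
  refine h1.mono' (Continuous.aestronglyMeasurable ?_) (Filter.Eventually.of_forall fun z => ?_)
  · have h2 := (continuous_evalAt_sphere p n).comp (continuous_snd (X := Rd d))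
    exact (f.continuous.comp continuous_fst).mul (hk.mul h2)
  · simp only [Function.uncurry]
    rw [norm_mul, norm_mul]
    gcongr
    exact (mul_le_mul (hk1 _ _) (h n z.2) (norm_nonneg _) zero_le_one).trans (one_mul M).le

theorem integral_mul_kernel (f : 𝓢(Rd d, ℂ)) (p : Poly d) (n : ℕ+) {k : Rd d → Sph d → ℂ}
    (hk : Continuous (Function.uncurry k)) (hk1 : ∀ y ζ, ‖k y ζ‖ ≤ 1) :
    ∫ y, f y * ∫ ζ, k y ζ * evalAt p ((Real.sqrt (n : ℝ))⁻¹ • (ζ : Rd d)) ∂(sphereProb d) =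
      ∫ ζ, (∫ y, f y * k y ζ) * evalAt p ((Real.sqrt (n : ℝ))⁻¹ • (ζ : Rd d))
        ∂(sphereProb d) := by
  simp_rw [← integral_const_mul]
  rw [integral_integral_swap (integrable_prod_kernel f p n hk hk1)]
  refine integral_congr_ae (Filter.Eventually.of_forall fun ζ => ?_)
  beta_reduce
  rw [← integral_mul_const]
  simp_rw [mul_assoc]

theorem integrable_mul_kernel (f : 𝓢(Rd d, ℂ)) (p : Poly d) (n : ℕ+) {k : Rd d → Sph d → ℂ}
    (hk : Continuous (Function.uncurry k)) (hk1 : ∀ y ζ, ‖k y ζ‖ ≤ 1) :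
    Integrable fun y => f y *
      ∫ ζ, k y ζ * evalAt p ((Real.sqrt (n : ℝ))⁻¹ • (ζ : Rd d)) ∂(sphereProb d) := by
  simp_rw [← integral_const_mul]
  exact (integrable_prod_kernel f p n hk hk1).integral_prod_left

theorem PolyBounded.exists_summable (ha : PolyBounded a) :
    ∃ L : ℕ, Summable fun n : ℕ+ => ‖a n‖ / (n : ℝ) ^ L := by
  obtain ⟨D, A, hD, h⟩ := ha
  refine ⟨A + 2, ?_⟩
  have h1 : Summable fun n : ℕ+ => D * (1 / (n : ℝ) ^ 2) :=
    ((Real.summable_one_div_nat_pow.2 one_lt_two).comp_injective PNat.coe_injective).mul_left D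
  refine Summable.of_nonneg_of_le (fun _ => by positivity) (fun n => ?_) h1
  have hn : (0 : ℝ) < n := by exact_mod_cast n.pos
  rw [div_le_iff₀ (by positivity)]
  refine (h n).trans_eq ?_
  rw [pow_add]
  field_simp

theorem natCast_pow_le_one_add_sqrt (n : ℕ+) (L : ℕ) :
    (n : ℝ) ^ L ≤ (1 + Real.sqrt n) ^ (2 * L) := by
  rw [pow_mul]
  gcongr
  nlinarith [Real.sq_sqrt (show (0 : ℝ) ≤ n by positivity), Real.sqrt_nonneg (n : ℝ)]

/-- The summation formula for the Gaussian regularisations of a Schwartz function, by integrating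
the formula for the Gaussian centred at `y` against `f(y)`. -/
theorem tsum_sphereInt_mollify (hd : 2 ≤ d) (hp : p ∈ harmonicPoly d m) (ha : PolyBounded a)
    (hb : PolyBounded b)
    (hab : ∀ t : ℝ, 0 < t →
      expSum a 0 t = ((t ^ (-((d : ℝ) / 2 + m)) : ℝ) : ℂ) * expSum b 0 t⁻¹)
    (f : 𝓢(Rd d, ℂ)) {r : ℝ} (hr : 0 < r) :
    ∑' n : ℕ+, a n * sphereInt p n (mollify f r) =
      ∑' n : ℕ+, b n * Complex.exp (-Real.pi * n * ((r ^ 2)⁻¹ : ℝ)) *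
        (Complex.I ^ m * sphereInt p n (𝓕 f : 𝓢(Rd d, ℂ))) := by
  obtain ⟨M, hM, hpM⟩ := exists_norm_evalAt_sphere_le p
  set k1 : ℕ+ → Rd d → Sph d → ℂ := fun n y ζ =>
    gauss (r • (Real.sqrt (n : ℝ) • (ζ : Rd d) - y)) with hk1
  set k2 : ℕ+ → Rd d → Sph d → ℂ := fun n y ζ => Complex.exp ((-2 * Real.pi *
        inner ℝ y (Real.sqrt (n : ℝ) • (ζ : Rd d)) : ℝ) * Complex.I) with hk2
  have hk1c : ∀ n, Continuous (Function.uncurry (k1 n)) := fun n =>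
    continuous_gauss.comp (by fun_prop)
  have hk2c : ∀ n, Continuous (Function.uncurry (k2 n)) := fun n => by
    simp only [hk2, Function.uncurry_def]
    fun_prop
  have hk1n : ∀ n y ζ, ‖k1 n y ζ‖ ≤ 1 := fun n y ζ => norm_gauss_le_one _
  have hk2n : ∀ n y ζ, ‖k2 n y ζ‖ ≤ 1 := fun n y ζ => (Complex.norm_exp_ofReal_mul_I _).le
  have hA : ∀ n, a n * sphereInt p n (mollify f r) = ∫ y, f y * (a n * ((r : ℂ) ^ d *
      ∫ ζ, k1 n y ζ * evalAt p ((Real.sqrt (n : ℝ))⁻¹ • (ζ : Rd d)) ∂(sphereProb d))) := by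
    intro n
    have h1 := integral_mul_kernel f p n (hk1c n) (hk1n n)
    rw [sphereInt]
    simp_rw [mollify_eq f hr, mul_assoc ((r : ℂ) ^ d)]
    rw [integral_const_mul, ← h1, ← integral_const_mul, ← integral_const_mul]
    refine integral_congr_ae (Filter.Eventually.of_forall fun y => ?_)
    beta_reduce
    ring
  have hB : ∀ n, b n * Complex.exp (-Real.pi * n * ((r ^ 2)⁻¹ : ℝ)) *
      (Complex.I ^ m * sphereInt p n (𝓕 f : 𝓢(Rd d, ℂ))) =
      ∫ y, f y * (b n * Complex.exp (-Real.pi * n * ((r ^ 2)⁻¹ : ℝ)) * (Complex.I ^ m *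
      ∫ ζ, k2 n y ζ * evalAt p ((Real.sqrt (n : ℝ))⁻¹ • (ζ : Rd d)) ∂(sphereProb d))) := by
    intro n
    have h1 := integral_mul_kernel f p n (hk2c n) (hk2n n)
    have h2 : sphereInt p n (𝓕 f : 𝓢(Rd d, ℂ)) = ∫ ζ, (∫ y, f y * k2 n y ζ) *
        evalAt p ((Real.sqrt (n : ℝ))⁻¹ • (ζ : Rd d)) ∂(sphereProb d) := by
      rw [sphereInt]
      refine integral_congr_ae (Filter.Eventually.of_forall fun ζ => ?_)
      beta_reduce
      rw [show (𝓕 f : 𝓢(Rd d, ℂ)) (Real.sqrt (n : ℝ) • (ζ : Rd d)) =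
        𝓕 (f : Rd d → ℂ) (Real.sqrt (n : ℝ) • (ζ : Rd d)) from rfl, Real.fourier_eq']
      simp_rw [smul_eq_mul, mul_comm (Complex.exp _)]
      rfl
    rw [h2, ← h1, ← integral_const_mul, ← integral_const_mul]
    refine integral_congr_ae (Filter.Eventually.of_forall fun y => ?_)
    beta_reduce
    ring
  simp_rw [hA, hB]
  rw [integral_tsum_of_summable_integral_norm, integral_tsum_of_summable_integral_norm]
  · refine integral_congr_ae (Filter.Eventually.of_forall fun y => ?_)
    beta_reduce
    rw [tsum_mul_left, tsum_mul_left]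
    congr 1
    exact tsum_gauss_eq hd hp ha hb hab hr y
  · intro n
    refine ((integrable_mul_kernel f p n (hk2c n) (hk2n n)).const_mul
      (b n * Complex.exp (-Real.pi * n * ((r ^ 2)⁻¹ : ℝ)) * Complex.I ^ m)).congr
      (Filter.Eventually.of_forall fun y => ?_)
    beta_reduce
    ring
  · have hs : Summable fun n : ℕ+ => (‖b n‖ * Real.exp (-(Real.pi * (r ^ 2)⁻¹) * n)) *
        ∫ y, ‖f y‖ * M :=
      (hb.summable_norm_mul_exp (by have := Real.pi_pos; positivity)).mul_right _
    refine Summable.of_nonneg_of_le (fun n => integral_nonneg fun _ => norm_nonneg _)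
      (fun n => ?_) hs
    rw [← integral_const_mul]
    refine integral_mono_of_nonneg (Filter.Eventually.of_forall fun _ => norm_nonneg _)
      ((f.integrable.norm.mul_const M).const_mul _) (Filter.Eventually.of_forall fun y => ?_)
    beta_reduce
    have h1 : ‖∫ ζ, k2 n y ζ * evalAt p ((Real.sqrt (n : ℝ))⁻¹ • (ζ : Rd d)) ∂(sphereProb d)‖ ≤
        M := norm_integral_sphere_le fun ζ => by
      rw [norm_mul]
      exact (mul_le_mul (hk2n _ _ _) (hpM n ζ) (norm_nonneg _) zero_le_one).trans (one_mul M).le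
    rw [norm_mul, norm_mul, norm_mul, norm_exp_neg, norm_mul, norm_pow, Complex.norm_I, one_pow,
      one_mul, mul_left_comm]
    gcongr
  · intro n
    refine ((integrable_mul_kernel f p n (hk1c n) (hk1n n)).const_mul
      (a n * (r : ℂ) ^ d)).congr (Filter.Eventually.of_forall fun y => ?_)
    beta_reduce
    ring
  · obtain ⟨L, hL⟩ := ha.exists_summable
    obtain ⟨C, hC, hG⟩ := exists_pow_mul_norm_gauss_le (d := d) (2 * L) hr
    refine Summable.of_nonneg_of_le (fun n => integral_nonneg fun _ => norm_nonneg _)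
      (fun n => ?_) (hL.mul_right (∫ y, (1 + ‖y‖) ^ (2 * L) * ‖f y‖ * (r ^ d * (C * M))))
    rw [← integral_const_mul]
    refine integral_mono_of_nonneg (Filter.Eventually.of_forall fun _ => norm_nonneg _)
      (((SchwartzMap.integrable_one_add_norm_pow_mul f (2 * L)).mul_const _).const_mul _)
      (Filter.Eventually.of_forall fun y => ?_)
    beta_reduce
    have hn : (0 : ℝ) < n := by exact_mod_cast n.pos
    have h1 : ‖∫ ζ, k1 n y ζ * evalAt p ((Real.sqrt (n : ℝ))⁻¹ • (ζ : Rd d)) ∂(sphereProb d)‖ ≤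
        (1 + ‖y‖) ^ (2 * L) * C / (n : ℝ) ^ L * M := norm_integral_sphere_le fun ζ => by
      rw [norm_mul]
      refine mul_le_mul ?_ (hpM n ζ) (norm_nonneg _) (by positivity)
      rw [le_div_iff₀ (by positivity)]
      set x := Real.sqrt (n : ℝ) • (ζ : Rd d) - y with hx
      have h2 : 1 + Real.sqrt n ≤ (1 + ‖y‖) * (1 + ‖x‖) := by
        have h3 := norm_le_norm_sub_add (Real.sqrt (n : ℝ) • (ζ : Rd d)) y
        rw [norm_sqrt_smul, ← hx] at h3
        nlinarith [norm_nonneg y, norm_nonneg x]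
      calc ‖gauss (r • x)‖ * (n : ℝ) ^ L
          ≤ ‖gauss (r • x)‖ * ((1 + ‖y‖) * (1 + ‖x‖)) ^ (2 * L) := by
            gcongr
            exact (natCast_pow_le_one_add_sqrt n L).trans (by gcongr)
        _ = (1 + ‖y‖) ^ (2 * L) * ((1 + ‖x‖) ^ (2 * L) * ‖gauss (r • x)‖) := by
            rw [mul_pow]
            ring
        _ ≤ _ := by
            gcongr
            exact hG x
    rw [norm_mul, norm_mul, norm_mul, norm_pow, Complex.norm_real, Real.norm_of_nonneg hr.le]
    calc _ ≤ ‖f y‖ * (‖a n‖ * (r ^ d * ((1 + ‖y‖) ^ (2 * L) * C / (n : ℝ) ^ L * M))) := by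
          gcongr
      _ = _ := by
          field_simp

/-- The functional equation of an exponential series yields a summation formula of Poisson type
for the restrictions of a Schwartz function and its Fourier transform to the spheres of radius
`√n`, by letting the width of the regularisation tend to zero. -/
theorem tsum_sphereInt_eq (hd : 2 ≤ d) (hp : p ∈ harmonicPoly d m) (ha : PolyBounded a)
    (hb : PolyBounded b)
    (hab : ∀ t : ℝ, 0 < t →
      expSum a 0 t = ((t ^ (-((d : ℝ) / 2 + m)) : ℝ) : ℂ) * expSum b 0 t⁻¹)
    (f : 𝓢(Rd d, ℂ)) :
    ∑' n : ℕ+, a n * sphereInt p n f =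
      Complex.I ^ m * ∑' n : ℕ+, b n * sphereInt p n (𝓕 f : 𝓢(Rd d, ℂ)) := by
  obtain ⟨M, hM, hpM⟩ := exists_norm_evalAt_sphere_le p
  -- decay of the sphere integrals, in a form uniform in the regularisation
  have hdec : ∀ (F : Rd d → ℂ) (L : ℕ) (C : ℝ), (∀ x, (1 + ‖x‖) ^ (2 * L) * ‖F x‖ ≤ C) →
      ∀ n : ℕ+, ‖sphereInt p n F‖ ≤ C * M / (n : ℝ) ^ L := by
    intro F L C hF n
    have hn : (0 : ℝ) < n := by exact_mod_cast n.pos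
    have hC : 0 ≤ C := le_trans (by positivity) (hF 0)
    refine norm_integral_sphere_le fun ζ => ?_
    rw [norm_mul, mul_comm C, mul_div_assoc, mul_comm M]
    refine mul_le_mul ?_ (hpM n ζ) (norm_nonneg _) (by positivity)
    rw [le_div_iff₀ (by positivity), mul_comm]
    refine le_trans ?_ (hF (Real.sqrt (n : ℝ) • (ζ : Rd d)))
    rw [norm_sqrt_smul]
    gcongr
    exact natCast_pow_le_one_add_sqrt n L
  have hlim1 : Filter.Tendsto (fun r : ℝ => ∑' n : ℕ+, a n * sphereInt p n (mollify f r))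
      Filter.atTop (nhds (∑' n : ℕ+, a n * sphereInt p n f)) := by
    obtain ⟨L, hL⟩ := ha.exists_summable
    obtain ⟨C, hC, hf⟩ := exists_pow_mul_norm_mollify_le f (2 * L)
    refine tendsto_tsum_of_dominated_convergence (hL.mul_right (C * M)) (fun n => ?_) ?_
    · refine Filter.Tendsto.const_mul _ ?_
      obtain ⟨C0, hC0, hf0⟩ := exists_pow_mul_norm_mollify_le f 0
      refine tendsto_integral_filter_of_dominated_convergence (fun _ => C0 * M)
        (Filter.Eventually.of_forall fun r => Continuous.aestronglyMeasurable ?_)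
        (Filter.eventually_atTop.2 ⟨1, fun r hr => Filter.Eventually.of_forall fun ζ => ?_⟩)
        (integrable_const _)
        (Filter.Eventually.of_forall fun ζ => (tendsto_mollify f _).mul_const _)
      · exact ((continuous_mollify f r).comp (by fun_prop)).mul (continuous_evalAt_sphere p n)
      · rw [norm_mul]
        refine mul_le_mul ?_ (hpM n ζ) (norm_nonneg _) hC0
        simpa using hf0 r hr (Real.sqrt (n : ℝ) • (ζ : Rd d))
    · refine Filter.eventually_atTop.2 ⟨1, fun r hr n => ?_⟩
      rw [norm_mul, div_mul_eq_mul_div, mul_div_assoc]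
      gcongr
      exact hdec _ L C (hf r hr) n
  have hlim2 : Filter.Tendsto (fun r : ℝ => ∑' n : ℕ+, b n *
      Complex.exp (-Real.pi * n * ((r ^ 2)⁻¹ : ℝ)) *
        (Complex.I ^ m * sphereInt p n (𝓕 f : 𝓢(Rd d, ℂ)))) Filter.atTop
      (nhds (∑' n : ℕ+, b n * (Complex.I ^ m * sphereInt p n (𝓕 f : 𝓢(Rd d, ℂ))))) := by
    obtain ⟨L, hL⟩ := hb.exists_summable
    obtain ⟨C, hC, hf⟩ := SchwartzMap.exists_one_add_norm_pow_mul_le (𝓕 f : 𝓢(Rd d, ℂ)) (2 * L)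
    refine tendsto_tsum_of_dominated_convergence (hL.mul_right (C * M)) (fun n => ?_) ?_
    · have h1 : Filter.Tendsto (fun r : ℝ => ((r ^ 2)⁻¹ : ℝ)) Filter.atTop (nhds 0) :=
        (Filter.tendsto_pow_atTop two_ne_zero).inv_tendsto_atTop
      have h2 : Continuous fun x : ℝ => b n * Complex.exp (-Real.pi * n * (x : ℂ)) *
          (Complex.I ^ m * sphereInt p n (𝓕 f : 𝓢(Rd d, ℂ))) := by fun_prop
      have h3 := (h2.tendsto 0).comp h1
      simp only [Complex.ofReal_zero, mul_zero, Complex.exp_zero, mul_one] at h3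
      exact h3
    · refine Filter.Eventually.of_forall fun r n => ?_
      have h1 : Real.exp (-(Real.pi * (r ^ 2)⁻¹) * n) ≤ 1 := by
        rw [Real.exp_le_one_iff, neg_mul, neg_nonpos]
        have := Real.pi_pos
        positivity
      rw [norm_mul, norm_mul, norm_exp_neg, norm_mul, norm_pow, Complex.norm_I, one_pow, one_mul]
      calc _ ≤ ‖b n‖ * 1 * (C * M / (n : ℝ) ^ L) := by
            gcongr
            exact hdec _ L C hf n
        _ = _ := by ring
  have h1 := tendsto_nhds_unique (hlim1.congr' (Filter.eventually_atTop.2 ⟨1, fun r hr =>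
    tsum_sphereInt_mollify hd hp ha hb hab f (by linarith)⟩)) hlim2
  rw [h1, ← tsum_mul_left]
  exact tsum_congr fun n => by ring

end Annihilation

/-! ### Orthogonality of harmonic polynomials on the sphere -/

section Orthogonality

open MvPolynomial (pderiv X C)

variable {d m : ℕ}

/-- The polynomial with complex conjugate coefficients. -/
def conjPoly (p : Poly d) : Poly d := MvPolynomial.map (starRingEnd ℂ) p

theorem evalAt_conjPoly (p : Poly d) (x : Rd d) : evalAt (conjPoly p) x = conj (evalAt p x) := by
  rw [evalAt, evalAt, conjPoly, MvPolynomial.eval_map, MvPolynomial.eval₂_eq',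
    MvPolynomial.eval_eq', map_sum]
  simp

theorem conjPoly_mem_harmonicPoly {p : Poly d} (hp : p ∈ harmonicPoly d m) :
    conjPoly p ∈ harmonicPoly d m := by
  rw [mem_harmonicPoly] at hp ⊢
  refine ⟨hp.1.map _, ?_⟩
  have h : ∀ i, pderiv i (pderiv i (conjPoly p)) =
      MvPolynomial.map (starRingEnd ℂ) (pderiv i (pderiv i p)) := fun i => by
    rw [conjPoly, MvPolynomial.pderiv_map, MvPolynomial.pderiv_map]
  simp_rw [h, ← map_sum, hp.2, map_zero]

/-- The polynomial `∑_u conj u` whose values are `conjSum u`. -/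
theorem exists_conjSum_eq_evalAt {ι : Type} [Fintype ι] (u : ι → harmonicPoly d m) :
    ∃ p ∈ harmonicPoly d m, conjSum u = evalAt p := by
  refine ⟨conjPoly (∑ i, (u i : Poly d)),
    conjPoly_mem_harmonicPoly (Submodule.sum_mem _ fun i _ => (u i).2), funext fun x => ?_⟩
  rw [evalAt_conjPoly, evalAt_sum, map_sum, conjSum]

theorem contDiff_evalAt (p : Poly d) : ContDiff ℝ ∞ (evalAt p) := by
  induction p using MvPolynomial.induction_on with
  | C a =>
    have : evalAt (C a : Poly d) = fun _ => a := funext fun x => evalAt_C a x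
    rw [this]
    exact contDiff_const
  | add p q hp hq =>
    have : evalAt (p + q) = fun x => evalAt p x + evalAt q x := funext fun x => evalAt_add p q x
    rw [this]
    exact hp.add hq
  | mul_X p i hp =>
    have : evalAt (p * X i) = fun x : Rd d => evalAt p x * ((x i : ℝ) : ℂ) :=
      funext fun x => by rw [evalAt_mul, evalAt_X]
    rw [this]
    refine hp.mul ((Complex.ofRealCLM.contDiff).comp ?_)
    fun_prop

variable [NeZero d]

theorem integral_sphere_mul_eq_zero {n : ℕ} (hmn : m ≠ n) {p q : Poly d}
    (hp : p ∈ harmonicPoly d m) (hq : q ∈ harmonicPoly d n) :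
    ∫ ζ : Sph d, evalAt p ζ * evalAt q ζ ∂(sphereProb d) = 0 := by
  have h := gaussInt_eq_sphere ((mem_harmonicPoly.1 hp).1.mul (mem_harmonicPoly.1 hq).1)
  rw [gaussInt_mul_eq_zero hmn hp hq] at h
  simp only [evalAt_mul] at h
  exact (mul_eq_zero.1 h.symm).resolve_left (by exact_mod_cast (polarConst_pos _).ne')

theorem integral_sphere_mul_conj_ne_zero {p : Poly d} (hp : p ∈ harmonicPoly d m)
    (h0 : ∃ x, evalAt p x ≠ 0) :
    ∫ ζ : Sph d, evalAt p ζ * evalAt (conjPoly p) ζ ∂(sphereProb d) ≠ 0 := by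
  obtain ⟨x, hx⟩ := h0
  have hp' := (mem_harmonicPoly.1 hp).1
  have hpc := (mem_harmonicPoly.1 (conjPoly_mem_harmonicPoly hp)).1
  have h := gaussInt_eq_sphere (hp'.mul hpc)
  simp only [evalAt_mul] at h
  intro h1
  rw [h1, mul_zero, gaussInt_apply] at h
  have h2 : ∀ y : Rd d, evalAt (p * conjPoly p) y * gauss y =
      ((‖evalAt p y‖ ^ 2 * Real.exp (-Real.pi * ‖y‖ ^ 2) : ℝ) : ℂ) := fun y => by
    rw [evalAt_mul, evalAt_conjPoly, Complex.mul_conj, Complex.normSq_eq_norm_sq, gauss]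
    push_cast
    rfl
  simp_rw [h2] at h
  rw [integral_complex_ofReal, Complex.ofReal_eq_zero] at h
  have hc : Continuous fun y : Rd d => ‖evalAt p y‖ ^ 2 * Real.exp (-Real.pi * ‖y‖ ^ 2) := by
    have := continuous_evalAt p
    fun_prop
  have hI : Integrable fun y : Rd d => ‖evalAt p y‖ ^ 2 * Real.exp (-Real.pi * ‖y‖ ^ 2) := by
    have h3 := integrable_evalAt_mul_gauss (p * conjPoly p)
    simp_rw [h2] at h3
    exact h3.re
  refine (integral_pos_of_integrable_nonneg_nonzero (x := x) hc hI (fun y => ?_) ?_).ne' h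
  · positivity
  · have := norm_pos_iff.2 hx
    positivity

/-- An orthonormal basis has nonzero conjugate sum, as soon as it is nonempty: the `L²` norm of
the sum is the square root of the number of elements. -/
theorem exists_conjSum_ne_zero {ι : Type} [Fintype ι] [DecidableEq ι] [Nonempty ι]
    {u : ι → harmonicPoly d m} (hu : IsOrthonormalOnSphere u) : ∃ x, conjSum u x ≠ 0 := by
  by_contra! h
  have hc : ∀ p : Poly d, Continuous fun ζ : Sph d => evalAt p (ζ : Rd d) := fun p =>
    (continuous_evalAt p).comp continuous_subtype_val
  have h1 : ∫ ζ : Sph d, (∑ i, evalAt (u i : Poly d) (ζ : Rd d)) * conjSum u ζ ∂(sphereProb d) =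
      (Fintype.card ι : ℂ) := by
    simp only [conjSum, Finset.sum_mul_sum]
    have hint : ∀ i j, Integrable (fun ζ : Sph d => evalAt (u i : Poly d) (ζ : Rd d) *
        conj (evalAt (u j : Poly d) (ζ : Rd d))) (sphereProb d) := fun i j =>
      continuous_integrable_sphere ((hc _).mul (Complex.continuous_conj.comp (hc _)))
    rw [integral_finsetSum _ fun i _ => integrable_finsetSum _ fun j _ => hint i j]
    simp_rw [integral_finsetSum _ fun j _ => hint _ j, hu _ _]
    simp
  simp only [h, mul_zero, integral_zero] at h1
  exact Fintype.card_ne_zero (α := ι) (by exact_mod_cast h1.symm)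

end Orthogonality

section Explicit

open MvPolynomial (pderiv X C)

variable {d : ℕ}

/-- The polynomial `(x₀ + i x₁)^m`. -/
def isotropicPow (hd : 2 ≤ d) (m : ℕ) : Poly d :=
  (X ⟨0, by omega⟩ + C Complex.I * X ⟨1, by omega⟩) ^ m

theorem isotropicPow_mem_harmonicPoly (hd : 2 ≤ d) (m : ℕ) :
    isotropicPow hd m ∈ harmonicPoly d m := by
  rw [mem_harmonicPoly]
  set i0 : Fin d := ⟨0, by omega⟩ with hi0
  set i1 : Fin d := ⟨1, by omega⟩ with hi1
  have h01 : i0 ≠ i1 := by simp [hi0, hi1]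
  set q : Poly d := X i0 + C Complex.I * X i1 with hq
  have hqh : q.IsHomogeneous 1 := (MvPolynomial.isHomogeneous_X _ _).add (by
    simpa using (MvPolynomial.isHomogeneous_C _ _).mul (MvPolynomial.isHomogeneous_X ℂ i1))
  refine ⟨by simpa [isotropicPow] using hqh.pow m, ?_⟩
  set c : Fin d → ℂ := fun i => if i = i0 then 1 else if i = i1 then Complex.I else 0 with hc
  have hdq : ∀ i, pderiv i q = C (c i) := by
    intro i
    rw [hq, map_add, MvPolynomial.pderiv_C_mul, MvPolynomial.pderiv_X, MvPolynomial.pderiv_X, hc]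
    by_cases h0 : i = i0
    · subst h0
      simp [h01]
    · by_cases h1 : i = i1
      · subst h1
        simp [h01.symm, h01]
      · simp [h0, h1, Ne.symm h0, Ne.symm h1]
  have h2 : ∀ i, pderiv i (pderiv i (q ^ m)) =
      C (c i ^ 2) * ((m : Poly d) * ((m - 1 : ℕ) : Poly d) * q ^ (m - 1 - 1)) := by
    intro i
    rw [MvPolynomial.pderiv_pow, hdq, mul_comm _ (C (c i)), MvPolynomial.pderiv_C_mul,
      ← nsmul_eq_mul, map_nsmul, MvPolynomial.pderiv_pow, hdq, map_pow, nsmul_eq_mul]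
    ring
  change ∑ i, pderiv i (pderiv i (q ^ m)) = 0
  simp_rw [h2]
  rw [← Finset.sum_mul, ← map_sum]
  have h3 : ∑ i, c i ^ 2 = 0 := by
    rw [← Finset.sum_subset (Finset.subset_univ {i0, i1}), Finset.sum_pair h01]
    · simp [hc, h01.symm]
    · intro i _ hi
      simp only [Finset.mem_insert, Finset.mem_singleton, not_or] at hi
      simp [hc, hi.1, hi.2]
  rw [h3, map_zero, zero_mul]

theorem exists_evalAt_isotropicPow_ne_zero (hd : 2 ≤ d) (m : ℕ) :
    ∃ x : Rd d, evalAt (isotropicPow hd m) x ≠ 0 := by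
  refine ⟨EuclideanSpace.single ⟨0, by omega⟩ 1, ?_⟩
  simp [isotropicPow]

end Explicit

/-! ### The functionals `φ^*` -/

section Functional

variable {d : ℕ} [NeZero d] {m : ℕ}

/-- The space of sequences of polynomial growth. -/
def polySeq : Submodule ℂ (ℕ+ → ℂ) where
  carrier := {a | PolyBounded a}
  add_mem' := by
    rintro a b ⟨D, A, hD, ha⟩ ⟨E, B, hE, hb⟩
    refine ⟨D + E, max A B, by positivity, fun n => ?_⟩
    have hn : (1 : ℝ) ≤ n := by exact_mod_cast one_le (a := n)
    rw [add_mul]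
    refine (norm_add_le _ _).trans (add_le_add ((ha n).trans ?_) ((hb n).trans ?_))
    · gcongr
      exact le_max_left _ _
    · gcongr
      exact le_max_right _ _
  zero_mem' := ⟨0, 0, le_rfl, fun n => by simp⟩
  smul_mem' := by
    rintro c a ⟨D, A, hD, ha⟩
    refine ⟨‖c‖ * D, A, by positivity, fun n => ?_⟩
    rw [Pi.smul_apply, smul_eq_mul, norm_mul, mul_assoc]
    gcongr
    exact ha n

theorem RapidSeq.continuous (h : RapidSeq d) (n : ℕ+) : Continuous (h n) := (h.2.1 n).continuous

theorem integrable_rapid_mul (h : RapidSeq d) (p : Poly d) (n : ℕ+) :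
    Integrable (fun ζ : Sph d => h n ζ * evalAt p ((Real.sqrt (n : ℝ))⁻¹ • (ζ : Rd d)))
      (sphereProb d) :=
  continuous_integrable_sphere ((h.continuous n).mul (continuous_evalAt_sphere p n))

/-- The functional `h ↦ ∫ h_n(ζ) p(ζ/√n) dζ`. -/
def sphereFunctional (p : Poly d) (n : ℕ+) : RapidSeq d →ₗ[ℂ] ℂ where
  toFun h := ∫ ζ : Sph d, h n ζ * evalAt p ((Real.sqrt (n : ℝ))⁻¹ • (ζ : Rd d)) ∂(sphereProb d)
  map_add' g h := by
    rw [← integral_add (integrable_rapid_mul g p n) (integrable_rapid_mul h p n)]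
    refine integral_congr_ae (Filter.Eventually.of_forall fun ζ => ?_)
    exact add_mul (g n ζ) (h n ζ) _
  map_smul' c h := by
    rw [RingHom.id_apply, smul_eq_mul, ← integral_const_mul]
    refine integral_congr_ae (Filter.Eventually.of_forall fun ζ => ?_)
    exact mul_assoc c (h n ζ) _

theorem exists_norm_sphereFunctional_le (p : Poly d) :
    ∃ M : ℝ, 0 ≤ M ∧ ∀ (L : ℕ) (n : ℕ+) (h : RapidSeq d),
      ‖sphereFunctional p n h‖ ≤ M * rapidSeminorm d L h / (n : ℝ) ^ L := by
  obtain ⟨M, hM, hpM⟩ := exists_norm_evalAt_sphere_le p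
  refine ⟨M, hM, fun L n h => norm_integral_sphere_le fun ζ => ?_⟩
  have hn : (0 : ℝ) < n := by exact_mod_cast n.pos
  have h1 : (n : ℝ) ^ L * ‖h n ζ‖ ≤ rapidSeminorm d L h :=
    le_ciSup (h.bddAbove L) (n, ζ)
  rw [norm_mul, mul_comm M, mul_div_right_comm]
  refine mul_le_mul ?_ (hpM n ζ) (norm_nonneg _)
    (div_nonneg (apply_nonneg (rapidSeminorm d L) h) (by positivity))
  rwa [le_div_iff₀' (by positivity)]

/-- Absolute convergence of the pairing, controlled by one of the defining seminorms. -/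
theorem PolyBounded.exists_pairing_bound {a : ℕ+ → ℂ} (ha : PolyBounded a) (p : Poly d) :
    ∃ (L : ℕ) (u : ℕ+ → ℝ), Summable u ∧ (∀ n, 0 ≤ u n) ∧ ∀ (h : RapidSeq d) (n : ℕ+),
      ‖a n * sphereFunctional p n h‖ ≤ u n * rapidSeminorm d L h := by
  obtain ⟨L, hL⟩ := ha.exists_summable
  obtain ⟨M, hM, hb⟩ := exists_norm_sphereFunctional_le p
  refine ⟨L, _, hL.mul_right M, fun n => by positivity, fun h n => ?_⟩
  rw [norm_mul]
  calc _ ≤ ‖a n‖ * (M * rapidSeminorm d L h / (n : ℝ) ^ L) := by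
        gcongr
        exact hb L n h
    _ = _ := by ring

theorem PolyBounded.summable_pairing {a : ℕ+ → ℂ} (ha : PolyBounded a) (p : Poly d)
    (h : RapidSeq d) : Summable fun n => a n * sphereFunctional p n h := by
  obtain ⟨L, u, hu, _, hb⟩ := ha.exists_pairing_bound p
  exact Summable.of_norm_bounded (hu.mul_right _) (hb h)

/-- The functional `h ↦ ∑ a_n ∫ h_n(ζ) p(ζ/√n) dζ`. -/
def pairingLinear (p : Poly d) {a : ℕ+ → ℂ} (ha : PolyBounded a) : RapidSeq d →ₗ[ℂ] ℂ where
  toFun h := ∑' n, a n * sphereFunctional p n h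
  map_add' g h := by
    rw [← (ha.summable_pairing p g).tsum_add (ha.summable_pairing p h)]
    simp_rw [map_add, mul_add]
  map_smul' c h := by
    rw [RingHom.id_apply, smul_eq_mul, ← tsum_mul_left]
    simp_rw [map_smul, smul_eq_mul, mul_left_comm]

theorem continuous_pairingLinear (p : Poly d) {a : ℕ+ → ℂ} (ha : PolyBounded a) :
    Continuous (pairingLinear p ha) := by
  obtain ⟨L, u, hu, hu0, hb⟩ := ha.exists_pairing_bound p
  refine (rapid_withSeminorms d).continuous_normedSpace_rng ℂ (pairingLinear p ha)
    ⟨{L}, ⟨∑' n, u n, tsum_nonneg hu0⟩, fun h => ?_⟩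
  rw [Finset.sup_singleton]
  change ‖∑' n, a n * sphereFunctional p n h‖ ≤ (∑' n, u n) * rapidSeminorm d L h
  rw [← tsum_mul_right]
  exact tsum_of_norm_bounded (hu.mul_right _).hasSum (hb h)

/-- The continuous functional `h ↦ ∑ a_n ∫ h_n(ζ) p(ζ/√n) dζ`, linear in the sequence `a`. -/
def pairing (p : Poly d) : polySeq →ₗ[ℂ] (RapidSeq d →L[ℂ] ℂ) where
  toFun a := ⟨pairingLinear p a.2, continuous_pairingLinear p a.2⟩
  map_add' a b := by
    ext h
    change ∑' n, (a.1 n + b.1 n) * _ = (∑' n, _) + ∑' n, _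
    rw [← (PolyBounded.summable_pairing a.2 p h).tsum_add (PolyBounded.summable_pairing b.2 p h)]
    simp_rw [add_mul]
  map_smul' c a := by
    ext h
    change ∑' n, (c * a.1 n) * _ = c * ∑' n, _
    rw [← tsum_mul_left]
    simp_rw [mul_assoc]

theorem IsModerate.analyticAt {ψ : ℍ → ℂ} (h : IsModerate ψ) :
    AnalyticAt ℂ (Function.Periodic.cuspFunction 2 (ψ ∘ ofComplex)) 0 :=
  analyticAt_cuspFunction_zero two_pos h.periodic h.holo h.zero.isBoundedAtImInfty

/-- The Fourier coefficients as a linear map on a space of moderate functions. -/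
def coeffSeq (W : Submodule ℂ (ℍ → ℂ)) (hW : ∀ ψ ∈ W, IsModerate ψ) : W →ₗ[ℂ] polySeq where
  toFun ψ := ⟨fun n => fourierCoeffAt ψ n, (hW _ ψ.2).exists_norm_coeff_le⟩
  map_add' φ ψ := by
    ext n
    change (qExpansion 2 ((φ : ℍ → ℂ) + ψ)).coeff n = _
    rw [qExpansion_add (hW _ φ.2).analyticAt (hW _ ψ.2).analyticAt]
    rfl
  map_smul' c ψ := by
    ext n
    change (qExpansion 2 (c • (ψ : ℍ → ℂ))).coeff n = _
    rw [qExpansion_smul (hW _ ψ.2).analyticAt]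
    rfl

/-- The Fourier coefficients of `φ`. -/
def coeffInfty (κ : ℕ) : cuspType κ →ₗ[ℂ] polySeq :=
  coeffSeq _ fun _ h => isModerate_of_mem_cuspType h

/-- The Fourier coefficients of `φ₀`. -/
def coeffZero (κ : ℕ) : cuspType κ →ₗ[ℂ] polySeq :=
  coeffSeq ((cuspType κ).map (swapCusps κ))
    (by
      rintro _ ⟨φ, hφ, rfl⟩
      exact isModerate_swapCusps hφ) ∘ₗ (swapCusps κ).submoduleMap (cuspType κ)

/-- The functional `φ^*` attached to `φ` and a harmonic polynomial of degree `m`. -/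
def starForm (m : ℕ) (p : Poly d) : cuspType (d + 2 * m) →ₗ[ℂ] (V d →L[ℂ] ℂ) where
  toFun φ := (pairing p (coeffInfty _ φ)).comp (ContinuousLinearMap.fst ℂ _ _) -
    Complex.I ^ m • (pairing p (coeffZero _ φ)).comp (ContinuousLinearMap.snd ℂ _ _)
  map_add' φ ψ := by
    refine ContinuousLinearMap.ext fun v => ?_
    simp only [map_add, sub_apply, ContinuousLinearMap.comp_apply, smul_apply, add_apply,
      smul_eq_mul]
    ring
  map_smul' c φ := by
    refine ContinuousLinearMap.ext fun v => ?_
    simp only [map_smul, sub_apply, ContinuousLinearMap.comp_apply, smul_apply, smul_eq_mul,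
      RingHom.id_apply]
    ring

theorem starForm_apply (m : ℕ) (p : Poly d) (φ : cuspType (d + 2 * m)) (v : V d) :
    starForm m p φ v = (∑' n : ℕ+, pairingTerm φ (evalAt p) v.1 n) -
      Complex.I ^ m * ∑' n : ℕ+, pairingTerm (swapCusps (d + 2 * m) φ) (evalAt p) v.2 n := rfl

theorem summable_pairingTerm {ψ : ℍ → ℂ} (hψ : IsModerate ψ) (p : Poly d) (h : RapidSeq d) :
    Summable (pairingTerm ψ (evalAt p) h) :=
  PolyBounded.summable_pairing (a := fun n => fourierCoeffAt ψ n) hψ.exists_norm_coeff_le p h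

/-- The Fourier coefficients of `φ` and `φ₀` satisfy the hypothesis of the summation formula. -/
theorem starForm_mem_annihilator (hd : 2 ≤ d) {p : Poly d} (hp : p ∈ harmonicPoly d m)
    (φ : cuspType (d + 2 * m)) : starForm m p φ ∈ annihilator d := by
  intro f
  have hab : ∀ t : ℝ, 0 < t → expSum (fun n => fourierCoeffAt φ n) 0 t =
      ((t ^ (-((d : ℝ) / 2 + m)) : ℝ) : ℂ) *
        expSum (fun n => fourierCoeffAt (swapCusps (d + 2 * m) φ) n) 0 t⁻¹ := by
    intro t ht
    have h := tsum_fourierCoeffAt_eq φ.2 ht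
    have h1 : -((d + 2 * m : ℕ) : ℝ) / 2 = -((d : ℝ) / 2 + m) := by
      push_cast
      ring
    rw [h1] at h
    simpa only [expSum, pow_zero, mul_one, Complex.ofReal_inv, div_eq_mul_inv] using h
  have h := tsum_sphereInt_eq hd hp (isModerate_of_mem_cuspType φ.2).exists_norm_coeff_le
    (isModerate_swapCusps φ.2).exists_norm_coeff_le hab f
  rw [starForm_apply]
  exact sub_eq_zero.2 h

/-- The map `φ ↦ φ^*` on the direct sum, for a family of harmonic polynomials. -/
def starMap (hd : 2 ≤ d) (p : ℕ → Poly d) (hp : ∀ m, p m ∈ harmonicPoly d m) :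
    (DirectSum ℕ fun m => cuspType (d + 2 * m)) →ₗ[ℂ] annihilator d :=
  DirectSum.toModule ℂ ℕ _ fun m =>
    (starForm m (p m)).codRestrict (annihilator d) fun φ => starForm_mem_annihilator hd (hp m) φ

theorem starMap_lof (hd : 2 ≤ d) (p : ℕ → Poly d) (hp : ∀ m, p m ∈ harmonicPoly d m) (m : ℕ)
    (φ : cuspType (d + 2 * m)) :
    (starMap hd p hp (DirectSum.lof ℂ ℕ (fun m => cuspType (d + 2 * m)) m φ) : V d →L[ℂ] ℂ) =
      starForm m (p m) φ := by
  rw [starMap, DirectSum.toModule_lof]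
  rfl

/-- The sequence supported at the single index `N`, where it is the polynomial `q`. -/
def singleSeq (q : Poly d) (N : ℕ+) : RapidSeq d :=
  ⟨fun n ζ => if n = N then evalAt q ζ else 0, by
    refine ⟨fun n => ?_, fun k => ?_⟩
    · have h1 : ContMDiff (𝓡 (d - 1)) 𝓘(ℝ, ℂ) ∞ fun ζ : Sph d => evalAt q ζ :=
        (contDiff_evalAt q).contMDiff.comp contMDiff_coe_sphere
      by_cases h : n = N
      · simpa only [h, if_true] using h1
      · simpa only [h, if_false] using
          (contMDiff_const : ContMDiff (𝓡 (d - 1)) 𝓘(ℝ, ℂ) ∞ fun _ : Sph d => (0 : ℂ))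
    · obtain ⟨C, hC⟩ := (isCompact_univ (X := Sph d)).exists_bound_of_continuousOn
        (f := fun ζ => evalAt q (ζ : Rd d))
        ((continuous_evalAt q).comp continuous_subtype_val).continuousOn
      refine ⟨(N : ℝ) ^ k * max C 0, fun n ζ => ?_⟩
      by_cases h : n = N
      · simp only [h, if_true]
        gcongr
        exact (hC ζ trivial).trans (le_max_left _ _)
      · simp only [h, if_false, norm_zero, mul_zero]
        positivity⟩

theorem starForm_singleSeq {p q : Poly d} (hp : p ∈ harmonicPoly d m) (φ : cuspType (d + 2 * m))
    (N : ℕ+) : starForm m p φ (singleSeq q N, 0) = fourierCoeffAt φ N *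
      ((((Real.sqrt N)⁻¹ ^ m : ℝ) : ℂ) *
        ∫ ζ : Sph d, evalAt p ζ * evalAt q ζ ∂(sphereProb d)) := by
  rw [starForm_apply]
  have h0 : ∀ n, pairingTerm (swapCusps (d + 2 * m) φ) (evalAt p) (0 : RapidSeq d) n = 0 :=
    fun n => by
      change _ * sphereFunctional p n 0 = 0
      rw [map_zero, mul_zero]
  simp only [h0, tsum_zero, mul_zero, sub_zero]
  rw [tsum_eq_single N]
  · rw [pairingTerm]
    congr 1
    rw [← integral_const_mul]
    refine integral_congr_ae (Filter.Eventually.of_forall fun ζ => ?_)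
    change (if N = N then evalAt q (ζ : Rd d) else 0) * _ = _
    rw [if_pos rfl, evalAt_inv_sqrt_smul hp]
    ring
  · intro n hn
    have h1 : ∀ ζ, (singleSeq q N) n ζ = 0 := fun ζ => if_neg hn
    simp [pairingTerm, h1]

/-- The functionals attached to harmonic polynomials of distinct degrees are independent: testing
against sequences supported on one sphere, where they are conjugate harmonic polynomials, isolates
one Fourier coefficient of one component. -/
theorem starMap_injective (hd : 2 ≤ d) (p : ℕ → Poly d) (hp : ∀ m, p m ∈ harmonicPoly d m)
    (h0 : ∀ m, ∃ x, evalAt (p m) x ≠ 0) : Function.Injective (starMap hd p hp) := by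
  rw [injective_iff_map_eq_zero]
  intro x hx
  refine DFinsupp.ext fun m => ?_
  by_contra hne
  obtain ⟨N, hN⟩ := exists_fourierCoeffAt_ne_zero (isModerate_of_mem_cuspType (x m).2)
    fun h => hne (Subtype.ext h)
  set v : V d := (singleSeq (conjPoly (p m)) N, 0) with hv
  let ev : (V d →L[ℂ] ℂ) →ₗ[ℂ] ℂ :=
    { toFun := fun ℓ => ℓ v
      map_add' := fun _ _ => rfl
      map_smul' := fun _ _ => rfl }
  have hcomp : (ev ∘ₗ (annihilator d).subtype) ∘ₗ starMap hd p hp = ev ∘ₗ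
      starForm m (p m) ∘ₗ DirectSum.component ℂ ℕ (fun m => cuspType (d + 2 * m)) m := by
    refine DirectSum.linearMap_ext ℂ fun j => LinearMap.ext fun φ => ?_
    change (starMap hd p hp (DirectSum.lof ℂ ℕ (fun m => cuspType (d + 2 * m)) j φ) :
      V d →L[ℂ] ℂ) v = starForm m (p m) (DirectSum.component ℂ ℕ
        (fun m => cuspType (d + 2 * m)) m
          (DirectSum.lof ℂ ℕ (fun m => cuspType (d + 2 * m)) j φ)) v
    rw [starMap_lof]
    by_cases hj : j = m
    · subst hj
      rw [DirectSum.component.lof_self]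
    · rw [DirectSum.component.of, dif_neg hj, map_zero, hv, starForm_singleSeq (hp j),
        integral_sphere_mul_eq_zero hj (hp j) (conjPoly_mem_harmonicPoly (hp m))]
      simp
  have h1 : starForm m (p m) (x m) v = 0 := by
    have h2 := LinearMap.congr_fun hcomp x
    simp only [LinearMap.comp_apply, hx, map_zero] at h2
    exact h2.symm
  rw [hv, starForm_singleSeq (hp m)] at h1
  have hs := one_le_sqrt_pnat N
  have hs0 : (((Real.sqrt N)⁻¹ ^ m : ℝ) : ℂ) ≠ 0 := by
    exact_mod_cast (by positivity : (Real.sqrt N)⁻¹ ^ m ≠ 0)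
  exact mul_ne_zero hN (mul_ne_zero hs0 (integral_sphere_mul_conj_ne_zero (hp m) (h0 m))) h1

/-! ### The annihilator and the cokernel -/

theorem not_finiteDimensional_annihilator (hd : 2 ≤ d) :
    ¬ FiniteDimensional ℂ (annihilator d) := by
  intro hfin
  have hinj := starMap_injective hd (isotropicPow hd) (isotropicPow_mem_harmonicPoly hd)
    (exists_evalAt_isotropicPow_ne_zero hd)
  have hnoeth : IsNoetherian ℂ (annihilator d) :=
    (IsNoetherian.iff_fg (K := ℂ) (V := annihilator d)).2 hfin
  exact not_finiteDimensional_directSum_cuspType d (Module.Finite.of_injective _ hinj)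

/-- The annihilator of the image embeds in the algebraic dual of the cokernel. -/
theorem not_finiteDimensional_cokernel (hd : 2 ≤ d) :
    ¬ FiniteDimensional ℂ (V d ⧸ LinearMap.range (Phi d)) := by
  intro hfin
  refine not_finiteDimensional_annihilator hd ?_
  let T : annihilator d →ₗ[ℂ] Module.Dual ℂ (V d ⧸ LinearMap.range (Phi d)) :=
    { toFun := fun ℓ => (LinearMap.range (Phi d)).liftQ (ℓ : V d →L[ℂ] ℂ).toLinearMap (by
        rintro _ ⟨f, rfl⟩
        exact ℓ.2 f)
      map_add' := fun a b => Submodule.linearMap_qext _ rfl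
      map_smul' := fun c a => Submodule.linearMap_qext _ rfl }
  refine FiniteDimensional.of_injective T fun a b hab => ?_
  refine Subtype.ext (ContinuousLinearMap.ext fun v => ?_)
  exact LinearMap.congr_fun hab (Submodule.Quotient.mk v)

end Functional

end SphereRestriction

end

theorem mainTheorem10 (d : ℕ) [NeZero d] (hd : 5 ≤ d) :
    -- the cokernel of `Φ_d` is infinite-dimensional
    ¬ FiniteDimensional ℂ (SphereRestriction.V d ⧸ LinearMap.range (SphereRestriction.Phi d)) ∧
    -- so is the annihilator of the image in the continuous dual
    ¬ FiniteDimensional ℂ (SphereRestriction.annihilator d) ∧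
    -- the cusp-type forms in the weights `d / 2 + m` span an infinite-dimensional space
    ¬ FiniteDimensional ℂ (DirectSum ℕ fun m => SphereRestriction.cuspType (d + 2 * m)) ∧
    -- which `φ ↦ φ^*` embeds in the annihilator, for every choice of orthonormal bases
    ∀ (N : ℕ → ℕ)
      (B : ∀ m, Module.Basis (Fin (N m)) ℂ (SphereRestriction.harmonicPoly d m)),
      (∀ m, SphereRestriction.IsOrthonormalOnSphere (B m)) →
      ∃ L : (DirectSum ℕ fun m => SphereRestriction.cuspType (d + 2 * m)) →ₗ[ℂ]
          SphereRestriction.annihilator d,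
        Function.Injective L ∧
        ∀ (m : ℕ) (φ : SphereRestriction.cuspType (d + 2 * m)) (v : SphereRestriction.V d),
          Summable (SphereRestriction.pairingTerm φ
            (SphereRestriction.conjSum (B m)) v.1) ∧
          Summable (SphereRestriction.pairingTerm
            (SphereRestriction.swapCusps (d + 2 * m) φ)
            (SphereRestriction.conjSum (B m)) v.2) ∧
          (L (DirectSum.lof ℂ ℕ (fun m => SphereRestriction.cuspType (d + 2 * m)) m φ) :
              SphereRestriction.V d →L[ℂ] ℂ) v =
            (∑' n : ℕ+, SphereRestriction.pairingTerm φ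
              (SphereRestriction.conjSum (B m)) v.1 n) -
            Complex.I ^ m * ∑' n : ℕ+, SphereRestriction.pairingTerm
              (SphereRestriction.swapCusps (d + 2 * m) φ)
              (SphereRestriction.conjSum (B m)) v.2 n := by
  have hd2 : 2 ≤ d := by omega
  refine ⟨SphereRestriction.not_finiteDimensional_cokernel hd2,
    SphereRestriction.not_finiteDimensional_annihilator hd2,
    SphereRestriction.not_finiteDimensional_directSum_cuspType d, fun N B hB => ?_⟩
  choose p hp hpB using fun m => SphereRestriction.exists_conjSum_eq_evalAt (B m)
  have h0 : ∀ m, ∃ x, SphereRestriction.evalAt (p m) x ≠ 0 := by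
    intro m
    -- `(x₀ + i x₁)^m` is harmonic, so the basis is not empty.
    have hne : Nonempty (Fin (N m)) := by
      by_contra hemp
      rw [not_nonempty_iff] at hemp
      have hsub := Module.subsingleton_of_rank_zero
        (R := ℂ) (M := SphereRestriction.harmonicPoly d m) (by
          rw [rank_eq_card_basis (B m)]
          simp)
      obtain ⟨x, hx⟩ := SphereRestriction.exists_evalAt_isotropicPow_ne_zero hd2 m
      have h1 := Subsingleton.elim (α := SphereRestriction.harmonicPoly d m)
        ⟨_, SphereRestriction.isotropicPow_mem_harmonicPoly hd2 m⟩ 0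
      have h2 : SphereRestriction.isotropicPow hd2 m = 0 := congrArg Subtype.val h1
      simp [h2, SphereRestriction.evalAt] at hx
    rw [← hpB m]
    exact SphereRestriction.exists_conjSum_ne_zero (hB m)
  refine ⟨SphereRestriction.starMap hd2 p hp,
    SphereRestriction.starMap_injective hd2 p hp h0, fun m φ v => ?_⟩
  rw [SphereRestriction.starMap_lof, hpB]
  exact ⟨SphereRestriction.summable_pairingTerm
      (SphereRestriction.isModerate_of_mem_cuspType φ.2) (p m) v.1,
    SphereRestriction.summable_pairingTerm
      (SphereRestriction.isModerate_swapCusps φ.2) (p m) v.2,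
    SphereRestriction.starForm_apply m (p m) φ v⟩
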